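/- **Conventions.** $\lambda$ is the security parameter. A function $\mu$ is negligible if $p(\lambda)\mu(\lambda)\to 0$ for every polynomial $p$. "Efficient" / "quantum polynomial-time" refers to families $(C_\lambda)$ of quantum circuits (NOT, CNOT, Toffoli and one-qubit unitary gates) with polynomially many gates and ancillas; efficient deterministic algorithms use only NOT, CNOT and Toffoli gates, and efficient probabilistic ones are such algorithms run on uniformly random coins. An efficiently computable CPTP map appends zero ancillas, applies an efficient circuit and traces out the ancillas. Finite sets $\mathcal X,\mathcal Y$ and the key strings (depending on $\lambda$) are encoded by strings of polynomial length. Two families of distributions $D_{0,\lambda},D_{1,\lambda}$ on bit strings are computationally indistinguishable if for every quantum polynomial-time $\mathcal A$ there is a negligible $\mu$ with $|\Pr_{x\leftarrow D_{0,\lambda}}[\mathcal A(x)=0]-\Pr_{x\leftarrow D_{1,\lambda}}[\mathcal A(x)=0]|\le\mu(\lambda)$ for all $\lambda$. **Families.** A *noisy trapdoor claw-free (NTCF) family* $\mathcal F$ assigns to every $k\in\mathcal K_{\mathcal F}$, $b\in\{0,1\}$, $x\in\mathcal X$ a probability density $f_{k,b}(x)$ on $\mathcal Y$ such that: (1) an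 efficient probabilistic algorithm $\mathrm{GEN}_{\mathcal F}$ produces a key $k\in\mathcal K_{\mathcal F}$ with a trapdoor $t_k$; (2) for fixed $k,b$ the supports of $f_{k,b}(x)$, $x\in\mathcal X$, are disjoint, an efficient deterministic $\mathrm{INV}_{\mathcal F}$ satisfies $\mathrm{INV}_{\mathcal F}(t_k,b,y)=x$ for $y$ in the support of $f_{k,b}(x)$, and there is a perfect matching $\mathcal R_k\subseteq\mathcal X\times\mathcal X$ with $f_{k,0}(x_0)=f_{k,1}(x_1)\iff(x_0,x_1)\in\mathcal R_k$; (3) there are densities $f'_{k,b}(x)$ such that, for $(x_0,x_1)\in\mathcal R_k$ and $y$ in the support of $f'_{k,b}(x_b)$, $\mathrm{INV}_{\mathcal F}(t_k,b,y)=x_b$ and $\mathrm{INV}_{\mathcal F}(t_k,b\oplus1,y)=x_{b\oplus1}$; an efficient deterministic $\mathrm{CHK}_{\mathcal F}(k,b,x,y)$ decides whether $y$ is in the support of $f'_{k,b}(x)$; the average over $x\in\mathcal X$ of the squared Hellinger distance of $f_{k,b}(x)$ and $f'_{k,b}(x)$ is at most negligible; and an efficient quantum procedure $\mathrm{SAMP}_{\mathcal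 F}$ prepares $|\mathcal X|^{-1/2}\sum_{x,y}\sqrt{f'_{k,b}(x)(y)}\,|x\rangle|y\rangle$ from $k,b$; (4) for some polynomially bounded $w$ there are sets $G_{k,b,x}\subseteq\{0,1\}^w$ whose complements have negligible density, with membership efficiently decidable from $k,b,x,t_k$, and an efficiently computable and efficiently invertible injection $J:\mathcal X\to\{0,1\}^w$, such that for every quantum polynomial-time $\mathcal A$ the difference $|\Pr_{(k,t_k)\leftarrow\mathrm{GEN}_{\mathcal F}}[\mathcal A(k)\in H_k]-\Pr_{(k,t_k)\leftarrow\mathrm{GEN}_{\mathcal F}}[\mathcal A(k)\in\overline H_k]|$ is at most negligible, where $H_k=\{(b,x_b,d,d\cdot(J(x_0)\oplus J(x_1))): b\in\{0,1\},(x_0,x_1)\in\mathcal R_k,\ d\in G_{k,0,x_0}\cap G_{k,1,x_1}\}$ and $\overline H_k$ is obtained by flipping the last bit. A *trapdoor injective family* $\mathcal G$ consists of densities $g_{k,b}(x)$ on $\mathcal Y$, $k\in\mathcal K_{\mathcal G}$, with an efficient generator $\mathrm{GEN}_{\mathcal G}$ of keys and trapdoors, pairwise disjoint supports for all distinct pairs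 $(b,x)$, an efficient deterministic $\mathrm{INV}_{\mathcal G}$ with $\mathrm{INV}_{\mathcal G}(t_k,y)=(b,x)$ for $y$ in the support of $g_{k,b}(x)$, and efficient $\mathrm{CHK}_{\mathcal G}$, $\mathrm{SAMP}_{\mathcal G}$ as in (3) with $g$ in place of $f'$. An *extended trapdoor claw-free family* is an NTCF family $\mathcal F$ with a trapdoor injective family $\mathcal G$ such that $\mathrm{CHK}_{\mathcal F}=\mathrm{CHK}_{\mathcal G}$, $\mathrm{SAMP}_{\mathcal F}=\mathrm{SAMP}_{\mathcal G}$; for every quantum polynomial-time $\mathcal A$ the probabilities of $\mathcal A(k)=0$ for $k$ from $\mathrm{GEN}_{\mathcal F}$ and from $\mathrm{GEN}_{\mathcal G}$ differ at most negligibly; and for every quantum polynomial-time $\mathcal A$ there are a negligible $\mu$ and strings $d\in\{0,1\}^w$ (one for each $\lambda$) with $|\Pr_{(k,t_k)\leftarrow\mathrm{GEN}_{\mathcal F}}[\mathcal A(k)\in\{d\cdot(J(x_0)\oplus J(x_1)):(x_0,x_1)\in\mathcal R_k\}]-\tfrac12|\le\mu(\lambda)$. **Protocol.** Let $n=n(\lambda)$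 be polynomially bounded and $h\in\{0,1\}^n$. For each $i$ the verifier samples $(k_i,t_{k_i})$ from $\mathrm{GEN}_{\mathcal G}$ if $h_i=0$ and from $\mathrm{GEN}_{\mathcal F}$ if $h_i=1$, sends $k_1,\dots,k_n$, and receives $y_1,\dots,y_n\in\mathcal Y$. In a *test round* the prover returns $b'_i\in\{0,1\}$, $x'_i\in\mathcal X$ for all $i$, and the verifier accepts iff $\mathrm{CHK}(k_i,b'_i,x'_i,y_i)=1$ for all $i$ (a string which does not encode an element of the required set is rejected). In a *Hadamard round* the prover returns $b'_i\in\{0,1\}$, $d_i\in\{0,1\}^w$. If $h_i=0$ the verifier stores the bit $m_i$ given by $\mathrm{INV}_{\mathcal G}(t_{k_i},y_i)=(m_i,x)$. If $h_i=1$ he computes $x_{c}=\mathrm{INV}_{\mathcal F}(t_{k_i},c,y_i)$ for $c=0,1$ and, if $d_i\in G_{k_i,0,x_0}\cap G_{k_i,1,x_1}$, stores $m_i=b'_i\oplus d_i\cdot(J(x_0)\oplus J(x_1))$. If an inverse does not exist or $d_i$ is not in this set, $m_i$ is a uniformly random bit. For a quantum polynomial-time prover $\mathbb P$, $D_{\mathbb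 P,h}$ is the distribution of $m=(m_1,\dots,m_n)$ in a Hadamard round (not conditioned on acceptance). $\mathbb P$ is *perfect* if for all $\lambda$ and all $h$ it is accepted with probability $1$ in the test round. $\mathbb P$ is *characterized by* $(U_0,\mathcal S)$, where $U_0$ is an efficiently computable unitary and $\mathcal S$ an efficiently computable CPTP map, if for all $h$ it has the same test round acceptance probability and the same $D_{\mathbb P,h}$ as the following prover, whose qubits are $n$ committed qubits (first), $n$ preimage registers, $n$ commitment string registers, auxiliary qubits and key registers: apply $U_0$, which uses the key registers only as controls, to $|0\cdots0\rangle|k_1,\dots,k_n\rangle$; measure the commitment string registers to obtain $y$; in a test round measure the committed qubits and preimage registers in the standard basis; in a Hadamard round append zero ancillas, apply $U_J:|x\rangle|0\rangle\mapsto|J(x)\rangle|0\rangle$ to every preimage register, apply $\mathcal S$ to the entire state, and measure the committed qubits and ($w$-qubit) preimage registers in the Hadamard basis. A *trivial prover* is a perfect prover characterized by some $(U_0,\mathcal S)$ such that $\mathcal S$ commutes with standard basis measurement of the $n$ committed qubits: with $P_m$ the projection onto the value $m$ of these qubits, $\mathcal S(P_m\rho P_m)=P_m\mathcal S(\rho)P_m$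 for all $\rho$ and $m\in\{0,1\}^n$. **Claim.** Let $(\mathcal F,\mathcal G)$ be an extended trapdoor claw-free family with its corresponding trapdoor injective family and let $n$ be polynomially bounded. For every perfect quantum polynomial-time prover $\mathbb P$ there exists a trivial prover $\hat{\mathbb P}$ such that for all basis choices $h$ (that is, for all sequences $h=(h_\lambda)$ with $h_\lambda\in\{0,1\}^{n(\lambda)}$) the distribution $D_{\mathbb P,h}$ is computationally indistinguishable from $D_{\hat{\mathbb P},h}$. -/

import Mathlib

open Matrix Filter

noncomputable section

namespace MeasurementProtocol

/-! ### Asymptotics -/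

/-- Bit strings of length `n`. -/
abbrev Bits (n : ℕ) : Type := Fin n → Bool

/-- `f` is bounded by a polynomial in the security parameter. -/
def PolyBounded (f : ℕ → ℕ) : Prop :=
  ∃ p : Polynomial ℕ, ∀ l, f l ≤ p.eval l

/-- `p(l) * μ(l) → 0` for every polynomial `p`. -/
def Negligible (μ : ℕ → ℝ) : Prop :=
  Asymptotics.SuperpolynomialDecay atTop (fun l : ℕ => (l : ℝ)) μ

/-- Inner product modulo 2. -/
def dot {n : ℕ} (d z : Bits n) : Bool :=
  decide ((Finset.univ.filter fun i => d i = true ∧ z i = true).card % 2 = 1)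

/-- Bitwise exclusive or. -/
def bxor {W : Type} (u v : W → Bool) : W → Bool := fun i => xor (u i) (v i)

/-! ### Quantum circuits -/

/-- Elementary gates on qubits labelled by `W`: the classical reversible gates NOT, CNOT and
Toffoli, and arbitrary one-qubit unitaries. -/
inductive Gate (W : Type) : Type
  | not (q : W) : Gate W
  | cnot (c t : W) (h : c ≠ t) : Gate W
  | toffoli (a b t : W) (hab : a ≠ b) (hat : a ≠ t) (hbt : b ≠ t) : Gate W
  | single (q : W) (V : Matrix.unitaryGroup Bool ℂ) : Gate W

/-- The gates of classical reversible computation. -/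
def Gate.IsClassical {W : Type} : Gate W → Prop
  | .single _ _ => False
  | _ => True

section
variable {W : Type} [Fintype W] [DecidableEq W]

/-- The action of a gate in the standard basis, which is indexed by the assignments
`W → Bool`; the entry at `(z, z')` is the amplitude of `z' ↦ z`. -/
def Gate.toMatrix : Gate W → Matrix (W → Bool) (W → Bool) ℂ
  | .not q => Matrix.of fun z z' => if z = Function.update z' q (!(z' q)) then 1 else 0
  | .cnot c t _ => Matrix.of fun z z' => if z = Function.update z' t (xor (z' t) (z' c)) then 1 else 0
  | .toffoli a b t _ _ _ => Matrix.of fun z z' =>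
      if z = Function.update z' t (xor (z' t) (z' a && z' b)) then 1 else 0
  | .single q V => Matrix.of fun z z' =>
      if z = Function.update z' q (z q) then (V : Matrix Bool Bool ℂ) (z q) (z' q) else 0

/-- A circuit is a list of gates, the head acting first; its number of gates is its length. -/
abbrev Circuit (W : Type) : Type := List (Gate W)

/-- The unitary matrix of a circuit. -/
def Circuit.toMatrix (C : Circuit W) : Matrix (W → Bool) (W → Bool) ℂ :=
  C.foldl (fun M g => g.toMatrix * M) 1

end

/-- A quantum algorithm with classical input and output, at one value of the security
parameter: a circuit on an input register, an output register and `anc` work qubits. -/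
structure QAlg (I O : Type) where
  anc : ℕ
  circ : Circuit (I ⊕ (O ⊕ Fin anc))

namespace QAlg
variable {I O : Type} [Fintype I] [DecidableEq I] [Fintype O] [DecidableEq O]

/-- The final state on input `x`, all the other qubits being initialised to zero. -/
def finalState (A : QAlg I O) (x : I → Bool) : (I ⊕ (O ⊕ Fin A.anc) → Bool) → ℂ :=
  fun v => Circuit.toMatrix A.circ v (Sum.elim x fun _ => false)

/-- The probability that measuring the output register yields `z`. -/
def prob (A : QAlg I O) (x : I → Bool) (z : O → Bool) : ℝ :=
  ∑ v : I ⊕ (O ⊕ Fin A.anc) → Bool,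
    if (fun o => v (.inr (.inl o))) = z then ‖A.finalState x v‖ ^ 2 else 0

open Classical in
/-- The probability that the output lies in `S`. -/
def probMem (A : QAlg I O) (x : I → Bool) (S : Set (O → Bool)) : ℝ :=
  ∑ z : O → Bool, if z ∈ S then A.prob x z else 0

/-- On input `x` the output register is left in the pure state `ψ`. -/
def Prepares (A : QAlg I O) (x : I → Bool) (ψ : (O → Bool) → ℂ) : Prop :=
  ∃ η : (I → Bool) → (Fin A.anc → Bool) → ℂ, ∀ v,
    A.finalState x v = ψ (fun o => v (.inr (.inl o))) *
      η (fun i => v (.inl i)) (fun a => v (.inr (.inr a)))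

end QAlg

/-- A quantum polynomial-time procedure: a family of circuits of polynomial size, one for each
value of the security parameter (non-uniform polynomial time, so that a procedure may depend on any
further string of polynomial length, such as a basis choice). -/
structure QPT (I O : ℕ → Type) where
  alg : ∀ l, QAlg (I l) (O l)
  poly : PolyBounded fun l => (alg l).anc + (alg l).circ.length

/-- There is an efficient deterministic (classical) algorithm which, on input `inp l a`, returns
`out l a`, for every `a`. -/
def EfficientlyComputes {α I O : ℕ → Type}
    [∀ l, Fintype (I l)] [∀ l, DecidableEq (I l)] [∀ l, Fintype (O l)] [∀ l, DecidableEq (O l)]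
    (inp : ∀ l, α l → I l → Bool) (out : ∀ l, α l → O l → Bool) : Prop :=
  ∃ A : QPT I O, (∀ l, ∀ g ∈ (A.alg l).circ, g.IsClassical) ∧
    ∀ l a, (A.alg l).prob (inp l a) (out l a) = 1

/-- Two families of distributions on the strings indexed by `I` cannot be told apart by quantum
polynomial-time attackers (`fun _ => false` is the output `0`). -/
def CompIndist {I : ℕ → Type} [∀ l, Fintype (I l)] [∀ l, DecidableEq (I l)]
    (D₀ D₁ : ∀ l, (I l → Bool) → ℝ) : Prop :=
  ∀ A : QPT I (fun _ => Unit), ∃ μ, Negligible μ ∧ ∀ l,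
    |∑ m, D₀ l m * (A.alg l).prob m (fun _ => false)
      - ∑ m, D₁ l m * (A.alg l).prob m (fun _ => false)| ≤ μ l

/-! ### Encodings by bit strings -/

/-- An encoding of the elements of the sets `α l` by strings of polynomially many bits, the
positions of which are labelled by `W l`. -/
structure BitEncoding (α : ℕ → Type) where
  W : ℕ → Type
  [fintypeW : ∀ l, Fintype (W l)]
  [decEqW : ∀ l, DecidableEq (W l)]
  poly : PolyBounded fun l => Fintype.card (W l)
  enc : ∀ l, α l → W l → Bool
  inj : ∀ l, Function.Injective (enc l)

attribute [instance] BitEncoding.fintypeW BitEncoding.decEqW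

open Classical in
/-- Decoding; `none` if the string does not encode any element. -/
def BitEncoding.dec {α : ℕ → Type} (e : BitEncoding α) (l : ℕ) (z : e.W l → Bool) :
    Option (α l) :=
  if h : ∃ a, e.enc l a = z then some h.choose else none

/-- Encoding of a bit. -/
def encBit (b : Bool) : Unit → Bool := fun _ => b

/-- Encoding of an element of `Option α`, the position `none` holding the flag. -/
def encOption {α W : Type} (e : α → W → Bool) : Option α → Option W → Bool
  | some _, none => true
  | some a, some j => e a j
  | none, _ => false

/-! ### Densities -/

/-- Probability densities on a finite set. -/
def IsDensity {Y : Type} [Fintype Y] (g : Y → ℝ) : Prop :=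
  (∀ y, 0 ≤ g y) ∧ ∑ y, g y = 1

/-- The support of a density. -/
def supp {Y : Type} (g : Y → ℝ) : Set Y := {y | 0 < g y}

/-- The squared Hellinger distance. -/
def hellingerSq {Y : Type} [Fintype Y] (g₁ g₂ : Y → ℝ) : ℝ :=
  1 - ∑ y, Real.sqrt (g₁ y * g₂ y)

/-! ### Function families -/

/-- The finite sets `X`, `Y` and the set of key strings, which depend on the security parameter,
with encodings of their elements by bit strings. -/
structure Domains where
  X : ℕ → Type
  Y : ℕ → Type
  Key : ℕ → Type
  [fintypeX : ∀ l, Fintype (X l)]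
  [fintypeY : ∀ l, Fintype (Y l)]
  encX : BitEncoding X
  encY : BitEncoding Y
  encKey : BitEncoding Key

attribute [instance] Domains.fintypeX Domains.fintypeY

section
variable (D : Domains)

/-- Procedures with input `(k, b)` and a register for a pair `(x, y)` as output. -/
abbrev SampProcedure : Type :=
  QPT (fun l => D.encKey.W l ⊕ Unit) (fun l => D.encX.W l ⊕ D.encY.W l)

variable {D}

/-- The vector `|X|^{-1/2} ∑_{x,y} √(g(x)(y)) |x⟩|y⟩`. -/
def sampState (l : ℕ) (g : D.X l → D.Y l → ℝ) : (D.encX.W l ⊕ D.encY.W l → Bool) → ℂ :=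
  fun z => ∑ x, ∑ y, if z = Sum.elim (D.encX.enc l x) (D.encY.enc l y) then
    ((Real.sqrt (g x y) / Real.sqrt (Fintype.card (D.X l)) : ℝ) : ℂ) else 0

end

/-- The expectation over uniformly random coins. -/
def expect {Ω : Type} [Fintype Ω] (F : Ω → ℝ) : ℝ := (∑ ω, F ω) / Fintype.card Ω

/-- Noisy trapdoor claw-free families. The bit `b` is a Boolean (`0` is `false`, `1` is `true`),
and the key generator is a deterministic algorithm with uniformly random coins `ω`. -/
structure NTCF (D : Domains) where
  /-- the set of keys -/
  K : ∀ l, Set (D.Key l)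
  f : ∀ l, D.Key l → Bool → D.X l → D.Y l → ℝ
  f_density : ∀ l, ∀ k ∈ K l, ∀ b x, IsDensity (f l k b x)
  /- efficient function generation -/
  T : ℕ → Type
  encT : BitEncoding T
  coins : ℕ → ℕ
  coins_poly : PolyBounded coins
  gen : ∀ l, Bits (coins l) → D.Key l × T l
  gen_mem : ∀ l ω, (gen l ω).1 ∈ K l
  gen_eff : EfficientlyComputes (α := fun l => Bits (coins l)) (I := fun l => Fin (coins l))
    (fun _ ω => ω)
    (fun l ω => Sum.elim (D.encKey.enc l (gen l ω).1) (encT.enc l (gen l ω).2))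
  /- trapdoor -/
  disjoint : ∀ l, ∀ k ∈ K l, ∀ b x x', x ≠ x' → supp (f l k b x) ∩ supp (f l k b x') = ∅
  inv : ∀ l, T l → Bool → D.Y l → Option (D.X l)
  inv_eff : EfficientlyComputes (α := fun l => T l × Bool × D.Y l)
    (fun l a => Sum.elim (encT.enc l a.1) (Sum.elim (encBit a.2.1) (D.encY.enc l a.2.2)))
    (fun l a => encOption (D.encX.enc l) (inv l a.1 a.2.1 a.2.2))
  inv_correct : ∀ l ω b x, ∀ y ∈ supp (f l (gen l ω).1 b x), inv l (gen l ω).2 b y = some x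
  /- injective pair: a perfect matching of `X` with `X` -/
  R : ∀ l, D.Key l → Set (D.X l × D.X l)
  R_perfect : ∀ l, ∀ k ∈ K l, (∀ x₀, ∃! x₁, (x₀, x₁) ∈ R l k) ∧ (∀ x₁, ∃! x₀, (x₀, x₁) ∈ R l k)
  R_iff : ∀ l, ∀ k ∈ K l, ∀ x₀ x₁, f l k false x₀ = f l k true x₁ ↔ (x₀, x₁) ∈ R l k
  /- efficient range superposition -/
  f' : ∀ l, D.Key l → Bool → D.X l → D.Y l → ℝ
  f'_density : ∀ l, ∀ k ∈ K l, ∀ b x, IsDensity (f' l k b x)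
  inv_correct_false : ∀ l ω x₀ x₁, (x₀, x₁) ∈ R l (gen l ω).1 →
    ∀ y ∈ supp (f' l (gen l ω).1 false x₀),
      inv l (gen l ω).2 false y = some x₀ ∧ inv l (gen l ω).2 true y = some x₁
  inv_correct_true : ∀ l ω x₀ x₁, (x₀, x₁) ∈ R l (gen l ω).1 →
    ∀ y ∈ supp (f' l (gen l ω).1 true x₁),
      inv l (gen l ω).2 true y = some x₁ ∧ inv l (gen l ω).2 false y = some x₀
  chk : ∀ l, D.Key l → Bool → D.X l → D.Y l → Bool
  chk_eff : EfficientlyComputes (α := fun l => D.Key l × Bool × D.X l × D.Y l)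
    (fun l a => Sum.elim (D.encKey.enc l a.1) (Sum.elim (encBit a.2.1)
      (Sum.elim (D.encX.enc l a.2.2.1) (D.encY.enc l a.2.2.2))))
    (fun l a => encBit (chk l a.1 a.2.1 a.2.2.1 a.2.2.2))
  chk_iff : ∀ l, ∀ k ∈ K l, ∀ b x y, chk l k b x y = true ↔ y ∈ supp (f' l k b x)
  hellinger : ∃ μ, Negligible μ ∧ ∀ l, ∀ k ∈ K l, ∀ b,
    (∑ x, hellingerSq (f l k b x) (f' l k b x)) / Fintype.card (D.X l) ≤ μ l
  samp : SampProcedure D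
  samp_prepares : ∀ l, ∀ k ∈ K l, ∀ b,
    (samp.alg l).Prepares (Sum.elim (D.encKey.enc l k) (encBit b)) (sampState l (f' l k b))
  /- adaptive hardcore bit -/
  w : ℕ → ℕ
  w_poly : PolyBounded w
  G : ∀ l, D.Key l → Bool → D.X l → Set (Bits (w l))
  G_large : ∃ μ, Negligible μ ∧ ∀ l, ∀ k ∈ K l, ∀ b x,
    ((G l k b x)ᶜ.ncard : ℝ) / 2 ^ w l ≤ μ l
  /-- the algorithm which decides membership in `G`, given `k, t, b, x, d` -/
  memG : ∀ l, D.Key l → T l → Bool → D.X l → Bits (w l) → Bool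
  memG_eff : EfficientlyComputes (α := fun l => D.Key l × T l × Bool × D.X l × Bits (w l))
    (fun l a => Sum.elim (D.encKey.enc l a.1) (Sum.elim (encT.enc l a.2.1)
      (Sum.elim (encBit a.2.2.1) (Sum.elim (D.encX.enc l a.2.2.2.1) a.2.2.2.2))))
    (fun l a => encBit (memG l a.1 a.2.1 a.2.2.1 a.2.2.2.1 a.2.2.2.2))
  memG_iff : ∀ l ω b x d,
    memG l (gen l ω).1 (gen l ω).2 b x d = true ↔ d ∈ G l (gen l ω).1 b x
  J : ∀ l, D.X l → Bits (w l)
  J_inj : ∀ l, Function.Injective (J l)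
  J_eff : EfficientlyComputes (α := D.X) (O := fun l => Fin (w l)) (D.encX.enc) J
  J_inv_eff : EfficientlyComputes (α := D.X) (I := fun l => Fin (w l)) J (D.encX.enc)
  /-- For `c = false` the set below is the set of the strings encoding an element of `H_k`, and for
  `c = true` the set of those encoding an element of its companion, in which the last bit is
  flipped. -/
  hardcore : ∀ A : QPT D.encKey.W
      (fun l => Unit ⊕ (D.encX.W l ⊕ (Fin (w l) ⊕ Unit))),
    let S : ∀ l, D.Key l → Bool → Set (Unit ⊕ (D.encX.W l ⊕ (Fin (w l) ⊕ Unit)) → Bool) :=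
      fun l k c => {z | ∃ b x₀ x₁ d, (x₀, x₁) ∈ R l k ∧ d ∈ G l k false x₀ ∩ G l k true x₁ ∧
        z = Sum.elim (encBit b) (Sum.elim (D.encX.enc l (if b then x₁ else x₀))
          (Sum.elim d (encBit (xor c (dot d (bxor (J l x₀) (J l x₁)))))))}
    ∃ μ, Negligible μ ∧ ∀ l,
      |expect (fun ω => (A.alg l).probMem (D.encKey.enc l (gen l ω).1) (S l (gen l ω).1 false))
        - expect (fun ω => (A.alg l).probMem (D.encKey.enc l (gen l ω).1)
            (S l (gen l ω).1 true))| ≤ μ l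

/-- Trapdoor injective families. -/
structure TrapdoorInjective (D : Domains) where
  /-- the set of keys -/
  K : ∀ l, Set (D.Key l)
  g : ∀ l, D.Key l → Bool → D.X l → D.Y l → ℝ
  g_density : ∀ l, ∀ k ∈ K l, ∀ b x, IsDensity (g l k b x)
  T : ℕ → Type
  encT : BitEncoding T
  coins : ℕ → ℕ
  coins_poly : PolyBounded coins
  gen : ∀ l, Bits (coins l) → D.Key l × T l
  gen_mem : ∀ l ω, (gen l ω).1 ∈ K l
  gen_eff : EfficientlyComputes (α := fun l => Bits (coins l)) (I := fun l => Fin (coins l))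
    (fun _ ω => ω)
    (fun l ω => Sum.elim (D.encKey.enc l (gen l ω).1) (encT.enc l (gen l ω).2))
  disjoint : ∀ l, ∀ k ∈ K l, ∀ b b' x x', (b, x) ≠ (b', x') →
    supp (g l k b x) ∩ supp (g l k b' x') = ∅
  inv : ∀ l, T l → D.Y l → Option (Bool × D.X l)
  inv_eff : EfficientlyComputes (α := fun l => T l × D.Y l)
    (fun l a => Sum.elim (encT.enc l a.1) (D.encY.enc l a.2))
    (fun l a => encOption (fun p : Bool × D.X l => Sum.elim (encBit p.1) (D.encX.enc l p.2))
      (inv l a.1 a.2))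
  inv_correct : ∀ l ω b x, ∀ y ∈ supp (g l (gen l ω).1 b x),
    inv l (gen l ω).2 y = some (b, x)
  chk : ∀ l, D.Key l → Bool → D.X l → D.Y l → Bool
  chk_eff : EfficientlyComputes (α := fun l => D.Key l × Bool × D.X l × D.Y l)
    (fun l a => Sum.elim (D.encKey.enc l a.1) (Sum.elim (encBit a.2.1)
      (Sum.elim (D.encX.enc l a.2.2.1) (D.encY.enc l a.2.2.2))))
    (fun l a => encBit (chk l a.1 a.2.1 a.2.2.1 a.2.2.2))
  chk_iff : ∀ l, ∀ k ∈ K l, ∀ b x y, chk l k b x y = true ↔ y ∈ supp (g l k b x)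
  samp : SampProcedure D
  samp_prepares : ∀ l, ∀ k ∈ K l, ∀ b,
    (samp.alg l).Prepares (Sum.elim (D.encKey.enc l k) (encBit b)) (sampState l (g l k b))

/-- Extended trapdoor claw-free families, together with the corresponding trapdoor injective
family. -/
structure ExtendedTCF (D : Domains) where
  F : NTCF D
  G : TrapdoorInjective D
  chk_eq : F.chk = G.chk
  samp_eq : F.samp = G.samp
  key_indist : ∀ A : QPT D.encKey.W (fun _ => Unit), ∃ μ, Negligible μ ∧ ∀ l,
    |expect (fun ω => (A.alg l).prob (D.encKey.enc l (F.gen l ω).1) (fun _ => false))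
      - expect (fun ω => (A.alg l).prob (D.encKey.enc l (G.gen l ω).1) (fun _ => false))| ≤ μ l
  hardcore' : ∀ A : QPT D.encKey.W (fun _ => Unit), ∃ μ, Negligible μ ∧
    ∃ d : ∀ l, Bits (F.w l), ∀ l,
      |expect (fun ω => (A.alg l).probMem (D.encKey.enc l (F.gen l ω).1)
          {z | ∃ x₀ x₁, (x₀, x₁) ∈ F.R l (F.gen l ω).1 ∧
            z = encBit (dot (d l) (bxor (F.J l x₀) (F.J l x₁)))})
        - 1 / 2| ≤ μ l

/-! ### The verifier -/

section Verifier
variable {D : Domains} (E : ExtendedTCF D) (l : ℕ)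

/-- The coins of one run of each of the two key generators; only one of the two runs is used. -/
abbrev Coins : Type := Bits (E.F.coins l) × Bits (E.G.coins l)

variable {E l} in
/-- The key sent for a qubit with basis choice `h` (`true` is the Hadamard basis). -/
def sampleKey (h : Bool) (ω : Coins E l) : D.Key l :=
  if h then (E.F.gen l ω.1).1 else (E.G.gen l ω.2).1

variable {E l} in
/-- The check of the test round for one qubit, on the strings received from the prover. -/
def testCheck (h : Bool) (ω : Coins E l) (y : D.encY.W l → Bool) (b : Bool)
    (x : D.encX.W l → Bool) : Bool :=
  match D.encX.dec l x, D.encY.dec l y with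
  | some x, some y =>
      if h then E.F.chk l (E.F.gen l ω.1).1 b x y else E.G.chk l (E.G.gen l ω.2).1 b x y
  | _, _ => false

variable {E l} in
/-- The measurement result of the Hadamard round for one qubit; `none` if the verifier rejects
(and stores a random bit). -/
def decode (h : Bool) (ω : Coins E l) (y : D.encY.W l → Bool) (b : Bool)
    (d : Bits (E.F.w l)) : Option Bool :=
  match D.encY.dec l y with
  | none => none
  | some y =>
    if h then
      let k := (E.F.gen l ω.1).1
      let t := (E.F.gen l ω.1).2
      match E.F.inv l t false y, E.F.inv l t true y with
      | some x₀, some x₁ =>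
          if E.F.memG l k t false x₀ d && E.F.memG l k t true x₁ d then
            some (xor b (dot d (bxor (E.F.J l x₀) (E.F.J l x₁))))
          else none
      | _, _ => none
    else (E.G.inv l (E.G.gen l ω.2).2 y).map Prod.fst

/-- The probability that the stored bit is `m`. -/
def storedProb : Option Bool → Bool → ℝ
  | some c, m => if m = c then 1 else 0
  | none, _ => 1 / 2

variable (n : ℕ)

/-- The behaviour of a prover in a test round: for each function choice, the probability of
sending `y` and then `(b, x)`. -/
abbrev TestBehaviour : Type :=
  (Fin n → D.Key l) → (Fin n → D.encY.W l → Bool) → (Fin n → Bool) →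
    (Fin n → D.encX.W l → Bool) → ℝ

/-- The behaviour of a prover in a Hadamard round: for each function choice, the probability of
sending `y` and then `(b, d)`. -/
abbrev HadamardBehaviour : Type :=
  (Fin n → D.Key l) → (Fin n → D.encY.W l → Bool) → (Fin n → Bool) →
    (Fin n → Bits (E.F.w l)) → ℝ

variable {E l n}

/-- The probability that the verifier accepts in a test round. -/
def acceptProb (E : ExtendedTCF D) (p : TestBehaviour (D := D) l n) (h : Fin n → Bool) : ℝ :=
  expect fun ω : Fin n → Coins E l => ∑ y, ∑ b, ∑ x,
    if ∀ i, testCheck (h i) (ω i) (y i) (b i) (x i) = true then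
      p (fun i => sampleKey (h i) (ω i)) y b x else 0

/-- The distribution of the measurement results stored by the verifier in a Hadamard round. -/
def resultDist (p : HadamardBehaviour E l n) (h m : Fin n → Bool) : ℝ :=
  expect fun ω : Fin n → Coins E l => ∑ y, ∑ b, ∑ d,
    p (fun i => sampleKey (h i) (ω i)) y b d *
      ∏ i, storedProb (decode (h i) (ω i) (y i) (b i) (d i)) (m i)

end Verifier

/-! ### Provers -/

/-- The qubits of a prover: `n` committed qubits, `n` preimage registers, `n` further registers,
`n` commitment string registers, `n` key registers, and `a` auxiliary qubits. -/
inductive Wire (n : ℕ) (P R Y K : Type) (a : ℕ) : Type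
  | committed (i : Fin n)
  | preimage (i : Fin n) (j : P)
  | extra (i : Fin n) (j : R)
  | image (i : Fin n) (j : Y)
  | key (i : Fin n) (j : K)
  | aux (j : Fin a)
  deriving DecidableEq, Fintype

section Provers
variable {D : Domains} (E : ExtendedTCF D) (n : ℕ) (l : ℕ)

section
variable {n l} {P R : Type} {a : ℕ}

/-- The initial basis state: `k` in the key registers and zero elsewhere. -/
def initial (k : Fin n → D.Key l) :
    Wire n P R (D.encY.W l) (D.encKey.W l) a → Bool
  | .key i j => D.encKey.enc l (k i) j
  | _ => false

variable [Fintype P] [DecidableEq P] [Fintype R] [DecidableEq R]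

/-- The (unnormalised) state after applying `C` to the initial state and obtaining `y` when
measuring the commitment string registers. -/
def committedState (C : Circuit (Wire n P R (D.encY.W l) (D.encKey.W l) a))
    (k : Fin n → D.Key l) (y : Fin n → D.encY.W l → Bool) :
    (Wire n P R (D.encY.W l) (D.encKey.W l) a → Bool) → ℂ :=
  fun v => if (fun i j => v (.image i j)) = y then Circuit.toMatrix C v (initial k) else 0

end

/-- An arbitrary prover at one value of the security parameter. On receiving the keys he applies
`commit` and sends the measured commitment string registers. In a test round he then applies
`test` and sends the measured `committed` and `preimage` registers; in a Hadamard round he applies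
`had` and sends the measured `committed` and `extra` registers. -/
structure ProverAt where
  aux : ℕ
  commit : Circuit (Wire n (D.encX.W l) (Fin (E.F.w l)) (D.encY.W l) (D.encKey.W l) aux)
  test : Circuit (Wire n (D.encX.W l) (Fin (E.F.w l)) (D.encY.W l) (D.encKey.W l) aux)
  had : Circuit (Wire n (D.encX.W l) (Fin (E.F.w l)) (D.encY.W l) (D.encKey.W l) aux)

namespace ProverAt
variable {E n l} (P : ProverAt E n l)

def testBehaviour : TestBehaviour (D := D) l n := fun k y b x =>
  ∑ v, if (fun i => v (.committed i)) = b ∧ (fun i j => v (.preimage i j)) = x then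
    ‖(Circuit.toMatrix P.test *ᵥ committedState P.commit k y) v‖ ^ 2 else 0

def hadamardBehaviour : HadamardBehaviour E l n := fun k y b d =>
  ∑ v, if (fun i => v (.committed i)) = b ∧ (fun i j => v (.extra i j)) = d then
    ‖(Circuit.toMatrix P.had *ᵥ committedState P.commit k y) v‖ ^ 2 else 0

end ProverAt

/-- The registers of a prover in standard form before the application of `U_J`. -/
abbrev CommitWire (a : ℕ) : Type :=
  Wire n (D.encX.W l) Empty (D.encY.W l) (D.encKey.W l) a

/-- The registers of a prover in standard form after the application of `U_J`: the preimage
registers have `w` qubits, and the `extra` registers hold the remaining qubits. -/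
abbrev AttackWire (a : ℕ) : Type :=
  Wire n (Fin (E.F.w l)) (D.encX.W l) (D.encY.W l) (D.encKey.W l) a

/-- `J` on bit strings; `0` on strings which do not encode an element of `X`. -/
def Jbits (x : D.encX.W l → Bool) : Bits (E.F.w l) :=
  ((D.encX.dec l x).map (E.F.J l)).getD fun _ => false

open Classical in
/-- The inverse of `J` on bit strings; `0` outside the range of `J`. -/
def JinvBits (z : Bits (E.F.w l)) : D.encX.W l → Bool :=
  if h : ∃ x, E.F.J l x = z then D.encX.enc l h.choose else fun _ => false

variable {n}

/-- The action on basis states of appending zeros and applying `U_J` to all preimage registers: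
`|x⟩|0⟩ ↦ |x⟩|J(x)⟩ ↦ |x ⊕ J⁻¹(J(x))⟩|J(x)⟩`, which is `|0⟩|J(x)⟩` for `x` in `X`. -/
def mapJ {a : ℕ} (v : CommitWire (D := D) n l a → Bool) : AttackWire E n l a → Bool
  | .committed i => v (.committed i)
  | .preimage i j => Jbits E l (fun j' => v (.preimage i j')) j
  | .extra i j => xor (v (.preimage i j))
      (JinvBits E l (Jbits E l fun j' => v (.preimage i j')) j)
  | .image i j => v (.image i j)
  | .key i j => v (.key i j)
  | .aux j => v (.aux j)

/-- The isometry defined by `mapJ`. -/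
def isometryJ (a : ℕ) : Matrix (AttackWire E n l a → Bool) (CommitWire (D := D) n l a → Bool) ℂ :=
  Matrix.of fun v u => if v = mapJ E l u then 1 else 0

end Provers

section Channels
variable {W : Type} [Fintype W] [DecidableEq W]

/-- The CPTP map computed by a circuit: append `anc` zero qubits, apply the circuit, and trace
them out. -/
def channel {anc : ℕ} (C : Circuit (W ⊕ Fin anc)) (ρ : Matrix (W → Bool) (W → Bool) ℂ) :
    Matrix (W → Bool) (W → Bool) ℂ :=
  let ρ' : Matrix (W ⊕ Fin anc → Bool) (W ⊕ Fin anc → Bool) ℂ := Matrix.of fun u u' =>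
    if (∀ e, u (.inr e) = false) ∧ (∀ e, u' (.inr e) = false) then
      ρ (fun i => u (.inl i)) (fun i => u' (.inl i)) else 0
  Matrix.of fun v v' => ∑ e : Fin anc → Bool,
    (Circuit.toMatrix C * ρ' * (Circuit.toMatrix C)ᴴ) (Sum.elim v e) (Sum.elim v' e)

/-- The Hadamard transform on the qubits in `s`. -/
def hadamardOn (s : Finset W) : Matrix (W → Bool) (W → Bool) ℂ := Matrix.of fun v v' =>
  if ∀ q, q ∉ s → v q = v' q then
    ∏ q ∈ s, ((if v q && v' q then -1 else 1) / (Real.sqrt 2 : ℂ)) else 0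

end Channels

section Provers
variable {D : Domains} (E : ExtendedTCF D) (n : ℕ) (l : ℕ)

/-- The data `(U₀, S)` of a prover in standard form, at one value of the security parameter:
circuits for the unitary `U₀` and for (a dilation of) the CPTP map `S`. -/
structure StandardFormAt where
  aux : ℕ
  U₀ : Circuit (CommitWire (D := D) n l aux)
  anc : ℕ
  S : Circuit (AttackWire E n l aux ⊕ Fin anc)

namespace StandardFormAt
variable {E n l} (Q : StandardFormAt E n l)

/-- The key registers are only used as control registers by `U₀`. -/
def KeyControlled : Prop :=
  ∀ v v', (∃ i j, v (.key i j) ≠ v' (.key i j)) → Circuit.toMatrix Q.U₀ v v' = 0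

/-- The attack `S`. -/
def attack (ρ : Matrix (AttackWire E n l Q.aux → Bool) (AttackWire E n l Q.aux → Bool) ℂ) :
    Matrix (AttackWire E n l Q.aux → Bool) (AttackWire E n l Q.aux → Bool) ℂ :=
  channel Q.S ρ

/-- The projection onto the outcome `m` of a standard basis measurement of the committed
qubits. -/
def proj (m : Fin n → Bool) :
    Matrix (AttackWire E n l Q.aux → Bool) (AttackWire E n l Q.aux → Bool) ℂ :=
  Matrix.diagonal fun v => if (fun i => v (.committed i)) = m then 1 else 0

/-- The attack commutes with standard basis measurement of the committed qubits. -/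
def Commutes : Prop :=
  ∀ m ρ, Q.attack (Q.proj m * ρ * Q.proj m) = Q.proj m * Q.attack ρ * Q.proj m

/-- Test round: apply `U₀`, measure the commitment string registers, then the committed qubits and
preimage registers, all in the standard basis. -/
def testBehaviour : TestBehaviour (D := D) l n := fun k y b x =>
  ∑ v, if (fun i => v (.committed i)) = b ∧ (fun i j => v (.preimage i j)) = x then
    ‖committedState Q.U₀ k y v‖ ^ 2 else 0

/-- The committed qubits and preimage registers. -/
def measured : Finset (AttackWire E n l Q.aux) :=
  Finset.univ.filter fun q => (∃ i, q = .committed i) ∨ ∃ i j, q = .preimage i j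

/-- Hadamard round: apply `U₀`, measure the commitment string registers, apply `U_J` to the preimage
registers, apply `S`, and measure the committed qubits and preimage registers in the Hadamard
basis. -/
def hadamardBehaviour : HadamardBehaviour E l n := fun k y b d =>
  let ψ := isometryJ E l Q.aux *ᵥ committedState Q.U₀ k y
  let ρ := hadamardOn Q.measured * Q.attack (Matrix.vecMulVec ψ (star ψ)) *
    (hadamardOn Q.measured)ᴴ
  ∑ v, if (fun i => v (.committed i)) = b ∧ (fun i j => v (.preimage i j)) = d then
    (ρ v v).re else 0

end StandardFormAt

end Provers

/-- A prover which runs in quantum polynomial time. -/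
structure Prover {D : Domains} (E : ExtendedTCF D) (n : ℕ → ℕ) where
  at_ : ∀ l, ProverAt E (n l) l
  poly : PolyBounded fun l =>
    (at_ l).aux + (at_ l).commit.length + (at_ l).test.length + (at_ l).had.length

/-- An efficiently computable pair `(U₀, S)`, where the unitary `U₀` uses the key registers as
control registers. -/
structure StandardForm {D : Domains} (E : ExtendedTCF D) (n : ℕ → ℕ) where
  at_ : ∀ l, StandardFormAt E (n l) l
  poly : PolyBounded fun l =>
    (at_ l).aux + (at_ l).U₀.length + (at_ l).anc + (at_ l).S.length
  keyControlled : ∀ l, (at_ l).KeyControlled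

namespace Prover
variable {D : Domains} {E : ExtendedTCF D} {n : ℕ → ℕ} (P : Prover E n)

/-- The distribution over measurement results obtained by the verifier in a Hadamard round. -/
def dist (l : ℕ) (h : Fin (n l) → Bool) : (Fin (n l) → Bool) → ℝ :=
  resultDist (P.at_ l).hadamardBehaviour h

/-- The probability of acceptance in a test round. -/
def testAccept (l : ℕ) (h : Fin (n l) → Bool) : ℝ :=
  acceptProb E (P.at_ l).testBehaviour h

/-- Always accepted in a test round. -/
def IsPerfect : Prop := ∀ l h, P.testAccept l h = 1

/-- `P` is accepted in a test round with the same probability, and leads to the same distribution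
over measurement results, as the prover in standard form given by `(U₀, S)`. -/
def CharacterizedBy (Q : StandardForm E n) : Prop :=
  ∀ l h, P.testAccept l h = acceptProb E (Q.at_ l).testBehaviour h ∧
    P.dist l h = resultDist (Q.at_ l).hadamardBehaviour h

/-- A perfect prover characterized by an efficiently computable pair `(U₀, S)` such that `S` commutes
with standard basis measurement of the committed qubits. -/
def IsTrivial : Prop :=
  P.IsPerfect ∧ ∃ Q : StandardForm E n, P.CharacterizedBy Q ∧ ∀ l, (Q.at_ l).Commutes

end Prover

end MeasurementProtocol

end

set_option linter.unusedSectionVars false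
set_option linter.unnecessarySeqFocus false
set_option synthInstance.maxSize 1000

noncomputable section

namespace MeasurementProtocol

/-! ### Operators on assignments -/

section Operators
variable {V W : Type} [Fintype V] [DecidableEq V] [Fintype W] [DecidableEq W]

/-! The trivial prover is obtained from the given one by averaging over random phases. Let V
(`attackOp`) be the operator that takes the final state of the test round to that of the Hadamard
round: undo the test circuit, then apply the Hadamard circuit. For r in {0,1}^n let the r-twisted
prover apply Z^r to the committed qubits of the final test state, then V, and then add r to the
answer bits. The twist r = 0 is the original prover, and the new prover has the average of the
twisted behaviours over uniform r.

The average is trivial. In its standard form U₀ runs the old prover up to the end of the test round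
on a private copy of the registers and copies the keys, commitments, committed bits and preimages in
or out by CNOTs. The attack clears the preimage registers, runs V on the private copy, places the
strings d in the preimage registers, and joins the outer committed qubits to the inner answer bits
by controlled phases. The outer committed qubits are touched only by these diagonal gates, so the
attack commutes with their standard basis measurement (`standardAttack_fixes`). Measuring them in
the Hadamard basis yields c together with the operator Z^(c + b') before V, where b' is the inner
answer; thus c = b' + r with r uniform (`standardAttack_mulVec`, `average_isTrivial`).

The average is indistinguishable from the original. A hybrid argument switches the entries of r on
one at a time (`abs_sum_sub_sum_averaged_le`), so it is enough to compare r with r_j = 0 and the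
twist with r_j = 1. Perfectness enters because every string in the support of the final test state
passes the check, for all coins of the verifier (`testCheck_of_accept`). If h_j = 0, the commitment
y_j determines the committed bit, Z is a global sign for each y, and the verifier ignores the answer
bit (`valueAt_update_of_false`).

If h_j = 1, the final test state is a sum of two branches according to the value of the j-th
committed qubit, and y_j determines a claw, so the value of the qubit determines its preimage
register. The two twists lead to the sum and to the difference of the branches ψ₀, ψ₁ after the
attack, and flipping the answer bit flips the stored bit. Expanding the squares
(`valueAt_sub_valueAt`) leaves two kinds of terms.

The diagonal term compares the distinguisher on the stored bit and on its negation, when the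
committed qubit has been measured. Such a measurement also provides a preimage, after which V yields
d; a distinguisher that notices the bit b' + d·(J(x₀) + J(x₁)) therefore predicts d·(J(x₀) + J(x₁)),
against the adaptive hardcore bit (`sum_runGuess`).

The cross term is the real part of the inner product of ψ₀ and ψ₁, weighted by the distinguisher's
bias. It is an overlap of the branch of x₀ with the image of the branch of x₁ under undoing the
attack after a phase on the distinguisher's verdict. If it were large, then measuring x₁, applying
this operation and measuring the preimage register again would give x₀; by Cauchy-Schwarz this has
at least the square of the cross term as its probability (`sq_crossTerm_le`). Both preimages give
d·(J(x₀) + J(x₁)) for a random d, again a contradiction, up to the density of the complements of the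
sets G (`sq_crossTerm_le_sum`). The total is n(μ + 2√(μ + 2ν)) with negligible μ and ν.

The attackers have all the verifier's coins except those of the j-th key as constants, so they can
decode the other coordinates. They depend on these coins, on r and on j, which is why one bound is
needed for all circuits of a given size (`hardcore_uniform`). The rest is the evaluation of circuits
with clean ancillas and of their sizes. -/

/-- The operator of a map of basis states. -/
def basisMap (σ : (W → Bool) → (W → Bool)) : Matrix (W → Bool) (W → Bool) ℂ :=
  Matrix.of fun z z' => if z = σ z' then 1 else 0

theorem basisMap_mulVec {σ : (W → Bool) → (W → Bool)} (hσ : Function.Involutive σ)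
    (f : (W → Bool) → ℂ) (z : W → Bool) : (basisMap σ *ᵥ f) z = f (σ z) := by
  have h : ∀ z', (z = σ z') ↔ (z' = σ z) := fun z' =>
    ⟨fun h => by rw [h, hσ], fun h => by rw [h, hσ]⟩
  simp [basisMap, mulVec, dotProduct, h]

/-- The operator `M`, acting on the qubits in the range of `ι`. -/
def lift (ι : V → W) (M : Matrix (V → Bool) (V → Bool) ℂ) : Matrix (W → Bool) (W → Bool) ℂ :=
  Matrix.of fun z z' => if z = Function.extend ι (z ∘ ι) z' then M (z ∘ ι) (z' ∘ ι) else 0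

theorem extend_comp' {ι : V → W} (hι : Function.Injective ι) (p : V → Bool) (z : W → Bool) :
    Function.extend ι p z ∘ ι = p := by
  funext a; simp [hι.extend_apply]

theorem extend_extend' {ι : V → W} (hι : Function.Injective ι) (p p' : V → Bool) (z : W → Bool) :
    Function.extend ι p (Function.extend ι p' z) = Function.extend ι p z := by
  funext a
  by_cases h : ∃ b, ι b = a
  · obtain ⟨b, rfl⟩ := h; simp [hι.extend_apply]
  · simp [Function.extend_apply' _ _ _ h]

theorem extend_self' {ι : V → W} (hι : Function.Injective ι) (z : W → Bool) :
    Function.extend ι (z ∘ ι) z = z := by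
  funext a
  by_cases h : ∃ b, ι b = a
  · obtain ⟨b, rfl⟩ := h; simp [hι.extend_apply]
  · simp [Function.extend_apply' _ _ _ h]

/-- Both sides say that the two assignments agree off the range of `ι`, which is symmetric. -/
theorem eq_extend_comm {ι : V → W} (hι : Function.Injective ι) (z z' : W → Bool) :
    z = Function.extend ι (z ∘ ι) z' ↔ z' = Function.extend ι (z' ∘ ι) z := by
  have key : ∀ z z' : W → Bool, z = Function.extend ι (z ∘ ι) z' →
      z' = Function.extend ι (z' ∘ ι) z := by
    intro z z' h
    rw [h, extend_extend' hι, extend_self' hι]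
  exact ⟨key z z', key z' z⟩

/-- The row of `z` is supported on the assignments that differ from `z` only on the range of `ι`,
one for each `p`. Throughout, operators are evaluated in this pointwise form, so a circuit is read
backwards from the final assignment. -/
theorem lift_mulVec {ι : V → W} (hι : Function.Injective ι)
    (M : Matrix (V → Bool) (V → Bool) ℂ) (f : (W → Bool) → ℂ) (z : W → Bool) :
    (lift ι M *ᵥ f) z = (M *ᵥ fun p => f (Function.extend ι p z)) (z ∘ ι) := by
  simp only [lift, mulVec, dotProduct, Matrix.of_apply, eq_extend_comm hι z]
  rw [← Finset.sum_subset (Finset.subset_univ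
    (Finset.univ.image fun p : V → Bool => Function.extend ι p z))]
  · rw [Finset.sum_image]
    · refine Finset.sum_congr rfl fun p _ => ?_
      rw [extend_comp' hι, if_pos rfl]
    · intro p _ p' _ h
      have := congrArg (· ∘ ι) h
      simpa only [extend_comp' hι] using this
  · intro z' _ h
    rw [if_neg, zero_mul]
    intro h'
    exact h (Finset.mem_image.2 ⟨z' ∘ ι, Finset.mem_univ _, h'.symm⟩)

theorem lift_basisMap_mulVec {ι : V → W} (hι : Function.Injective ι)
    {σ : (V → Bool) → (V → Bool)} (hσ : Function.Involutive σ) (f : (W → Bool) → ℂ)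
    (z : W → Bool) : (lift ι (basisMap σ) *ᵥ f) z = f (Function.extend ι (σ (z ∘ ι)) z) := by
  rw [lift_mulVec hι, basisMap_mulVec hσ]

theorem lift_mul {ι : V → W} (hι : Function.Injective ι)
    (M N : Matrix (V → Bool) (V → Bool) ℂ) : lift ι (M * N) = lift ι M * lift ι N := by
  refine ext_iff_mulVec.2 fun f => funext fun z => ?_
  rw [← mulVec_mulVec, lift_mulVec hι, lift_mulVec hι, ← mulVec_mulVec]
  refine congrArg (fun g => (M *ᵥ g) (z ∘ ι)) (funext fun p => ?_)
  rw [lift_mulVec hι, extend_comp' hι]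
  simp only [extend_extend' hι]

theorem lift_one {ι : V → W} (hι : Function.Injective ι) :
    lift ι (1 : Matrix (V → Bool) (V → Bool) ℂ) = 1 := by
  refine ext_iff_mulVec.2 fun f => funext fun z => ?_
  rw [lift_mulVec hι, one_mulVec, one_mulVec, extend_self' hι]

theorem lift_conjTranspose {ι : V → W} (hι : Function.Injective ι)
    (M : Matrix (V → Bool) (V → Bool) ℂ) : (lift ι M)ᴴ = lift ι Mᴴ := by
  ext z z'
  simp only [lift, conjTranspose_apply, Matrix.of_apply, eq_extend_comm hι z' z]
  split_ifs <;> simp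

/-- `M` is unitary. -/
def IsUnitary (M : Matrix (W → Bool) (W → Bool) ℂ) : Prop := Mᴴ * M = 1

theorem IsUnitary.one : IsUnitary (1 : Matrix (W → Bool) (W → Bool) ℂ) := by simp [IsUnitary]

theorem IsUnitary.mul {M N : Matrix (W → Bool) (W → Bool) ℂ} (hM : IsUnitary M)
    (hN : IsUnitary N) : IsUnitary (M * N) := by
  unfold IsUnitary at *
  rw [conjTranspose_mul, Matrix.mul_assoc, ← Matrix.mul_assoc Mᴴ, hM, Matrix.one_mul, hN]

theorem IsUnitary.mul_conjTranspose {M : Matrix (W → Bool) (W → Bool) ℂ} (hM : IsUnitary M) :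
    M * Mᴴ = 1 := mul_eq_one_comm.1 hM

theorem IsUnitary.conjTranspose {M : Matrix (W → Bool) (W → Bool) ℂ} (hM : IsUnitary M) :
    IsUnitary Mᴴ := by
  simpa [IsUnitary] using hM.mul_conjTranspose

theorem IsUnitary.lift {ι : V → W} (hι : Function.Injective ι)
    {M : Matrix (V → Bool) (V → Bool) ℂ} (hM : IsUnitary M) : IsUnitary (lift ι M) := by
  unfold IsUnitary at *
  rw [lift_conjTranspose hι, ← lift_mul hι, hM, lift_one hι]

theorem IsUnitary.basisMap {σ : (W → Bool) → (W → Bool)} (hσ : Function.Involutive σ) :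
    IsUnitary (basisMap σ) := by
  have h : (MeasurementProtocol.basisMap σ)ᴴ = MeasurementProtocol.basisMap σ := by
    ext z z'
    have : (z' = σ z) ↔ (z = σ z') := ⟨fun h => by rw [h, hσ], fun h => by rw [h, hσ]⟩
    simp only [MeasurementProtocol.basisMap, conjTranspose_apply, Matrix.of_apply, this]
    split_ifs <;> simp
  unfold IsUnitary
  rw [h]
  refine ext_iff_mulVec.2 fun f => funext fun z => ?_
  rw [← mulVec_mulVec, basisMap_mulVec hσ, basisMap_mulVec hσ, hσ, one_mulVec]

/-- The inner product of state vectors. -/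
def ip (f g : (W → Bool) → ℂ) : ℂ := ∑ v, star (f v) * g v

theorem IsUnitary.ip_mulVec {M : Matrix (W → Bool) (W → Bool) ℂ} (hM : IsUnitary M)
    (f g : (W → Bool) → ℂ) : ip (M *ᵥ f) (M *ᵥ g) = ip f g := by
  have h : ∀ f g : (W → Bool) → ℂ, ip f g = star f ⬝ᵥ g := fun f g => rfl
  rw [h, h, star_mulVec, dotProduct_mulVec, vecMul_vecMul, hM, vecMul_one]

theorem ip_self (f : (W → Bool) → ℂ) : ip f f = ((∑ v, ‖f v‖ ^ 2 : ℝ) : ℂ) := by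
  simp only [ip, Complex.ofReal_sum]
  refine Finset.sum_congr rfl fun v _ => ?_
  rw [Complex.star_def, Complex.conj_mul']; simp

theorem IsUnitary.norm_mulVec {M : Matrix (W → Bool) (W → Bool) ℂ} (hM : IsUnitary M)
    (f : (W → Bool) → ℂ) : ∑ v, ‖(M *ᵥ f) v‖ ^ 2 = ∑ v, ‖f v‖ ^ 2 := by
  have := hM.ip_mulVec f f
  rw [ip_self, ip_self] at this
  exact_mod_cast this

end Operators

/-! ### Gates -/

section Gates
variable {V W : Type} [Fintype V] [DecidableEq V] [Fintype W] [DecidableEq W]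

theorem Gate.toMatrix_not (q : W) :
    (Gate.not q).toMatrix = basisMap fun z => Function.update z q (!(z q)) := rfl

theorem Gate.toMatrix_cnot (c t : W) (h : c ≠ t) :
    (Gate.cnot c t h).toMatrix = basisMap fun z => Function.update z t (xor (z t) (z c)) := rfl

theorem Gate.toMatrix_toffoli (a b t : W) (hab : a ≠ b) (hat : a ≠ t) (hbt : b ≠ t) :
    (Gate.toffoli a b t hab hat hbt).toMatrix =
      basisMap fun z => Function.update z t (xor (z t) (z a && z b)) := rfl

theorem involutive_not (q : W) :
    Function.Involutive fun z : W → Bool => Function.update z q (!(z q)) := by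
  intro z; simp

theorem involutive_cnot (c t : W) (h : c ≠ t) :
    Function.Involutive fun z : W → Bool => Function.update z t (xor (z t) (z c)) := by
  intro z; simp [Function.update_of_ne h]

theorem involutive_toffoli (a b t : W) (hat : a ≠ t) (hbt : b ≠ t) :
    Function.Involutive fun z : W → Bool => Function.update z t (xor (z t) (z a && z b)) := by
  intro z; simp [Function.update_of_ne hat, Function.update_of_ne hbt]

theorem Gate.single_mulVec (q : W) (U : Matrix.unitaryGroup Bool ℂ) (f : (W → Bool) → ℂ)
    (z : W → Bool) : ((Gate.single q U).toMatrix *ᵥ f) z =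
      ∑ b, (U : Matrix Bool Bool ℂ) (z q) b * f (Function.update z q b) := by
  have h : ∀ z', z = Function.update z' q (z q) ↔ ∃ b, Function.update z q b = z' := by
    intro z'
    constructor
    · intro h; exact ⟨z' q, by rw [h]; simp⟩
    · rintro ⟨b, rfl⟩; simp
  simp only [Gate.toMatrix, mulVec, dotProduct, Matrix.of_apply]
  rw [← Finset.sum_subset (Finset.subset_univ
    (Finset.univ.image fun b : Bool => Function.update z q b))]
  · rw [Finset.sum_image]
    · refine Finset.sum_congr rfl fun b _ => ?_
      rw [if_pos ((h _).2 ⟨b, rfl⟩), Function.update_self]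
    · intro b _ b' _ h'
      simpa using congrFun h' q
  · intro z' _ h'
    rw [if_neg, zero_mul]
    intro hz
    obtain ⟨b, hb⟩ := (h z').1 hz
    exact h' (Finset.mem_image.2 ⟨b, Finset.mem_univ _, hb⟩)

theorem extend_update {ι : V → W} (hι : Function.Injective ι) (p : V → Bool) (z : W → Bool)
    (q : V) (b : Bool) : Function.extend ι (Function.update p q b) z =
      Function.update (Function.extend ι p z) (ι q) b := by
  funext a
  by_cases h : ∃ c, ι c = a
  · obtain ⟨c, rfl⟩ := h
    simp [hι.extend_apply, Function.update_apply, hι.eq_iff]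
  · rw [Function.extend_apply' _ _ _ h, Function.update_of_ne (fun h' => h ⟨q, h'.symm⟩),
      Function.extend_apply' _ _ _ h]

/-- A gate on the qubits in the range of an injective map. -/
def Gate.map (ι : V → W) (hι : Function.Injective ι) : Gate V → Gate W
  | .not q => .not (ι q)
  | .cnot c t h => .cnot (ι c) (ι t) (hι.ne h)
  | .toffoli a b t hab hat hbt => .toffoli (ι a) (ι b) (ι t) (hι.ne hab) (hι.ne hat) (hι.ne hbt)
  | .single q U => .single (ι q) U

theorem Gate.toMatrix_map {ι : V → W} (hι : Function.Injective ι) (g : Gate V) :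
    (g.map ι hι).toMatrix = lift ι g.toMatrix := by
  refine ext_iff_mulVec.2 fun f => funext fun z => ?_
  rw [lift_mulVec hι]
  cases g with
  | not q =>
    simp only [Gate.map, Gate.toMatrix_not]
    rw [basisMap_mulVec (involutive_not _), basisMap_mulVec (involutive_not _), extend_update hι,
      extend_self' hι]; rfl
  | cnot c t h =>
    simp only [Gate.map, Gate.toMatrix_cnot]
    rw [basisMap_mulVec (involutive_cnot _ _ (hι.ne h)), basisMap_mulVec (involutive_cnot _ _ h),
      extend_update hι, extend_self' hι]; rfl
  | toffoli a b t hab hat hbt =>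
    simp only [Gate.map, Gate.toMatrix_toffoli]
    rw [basisMap_mulVec (involutive_toffoli _ _ _ (hι.ne hat) (hι.ne hbt)),
      basisMap_mulVec (involutive_toffoli _ _ _ hat hbt), extend_update hι, extend_self' hι]; rfl
  | single q U =>
    simp only [Gate.map]
    rw [Gate.single_mulVec, Gate.single_mulVec]
    simp only [extend_update hι, extend_self' hι]; rfl

theorem Gate.single_eq_lift (q : W) (U : Matrix.unitaryGroup Bool ℂ) :
    (Gate.single q U).toMatrix = lift (fun _ : Unit => q)
      ((U : Matrix Bool Bool ℂ).submatrix (· ()) (· ())) := by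
  have hι : Function.Injective fun _ : Unit => q := Function.injective_of_subsingleton _
  rw [show (Gate.single q U).toMatrix = ((Gate.single () U).map _ hι).toMatrix from rfl,
    Gate.toMatrix_map]
  congr 1
  ext z z'
  rw [submatrix_apply]
  refine if_pos (funext fun u => ?_)
  simp

theorem Gate.isUnitary (g : Gate W) : IsUnitary g.toMatrix := by
  cases g with
  | not q => exact IsUnitary.basisMap (involutive_not q)
  | cnot c t h => exact IsUnitary.basisMap (involutive_cnot c t h)
  | toffoli a b t hab hat hbt => exact IsUnitary.basisMap (involutive_toffoli a b t hat hbt)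
  | single q U =>
    rw [Gate.single_eq_lift]
    refine IsUnitary.lift (Function.injective_of_subsingleton _) ?_
    have h : (U : Matrix Bool Bool ℂ)ᴴ * U = 1 := (Matrix.mem_unitaryGroup_iff').1 U.2
    unfold IsUnitary
    rw [conjTranspose_submatrix,
      show (fun x : Unit → Bool => x ()) = Equiv.funUnique Unit Bool from rfl,
      submatrix_mul_equiv, h, submatrix_one_equiv]

/-- The inverse gate. -/
def Gate.inv : Gate W → Gate W
  | .single q U => .single q U⁻¹
  | g => g

theorem Gate.toMatrix_inv (g : Gate W) : g.inv.toMatrix = g.toMatrixᴴ := by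
  have key : ∀ σ : (W → Bool) → (W → Bool), Function.Involutive σ →
      basisMap σ = (basisMap σ)ᴴ := by
    intro σ hσ
    have h1 : basisMap σ * basisMap σ = 1 := by
      refine ext_iff_mulVec.2 fun f => funext fun z => ?_
      rw [← mulVec_mulVec, basisMap_mulVec hσ, basisMap_mulVec hσ, hσ, one_mulVec]
    calc basisMap σ = (basisMap σ)ᴴ * basisMap σ * basisMap σ := by
          rw [IsUnitary.basisMap hσ, Matrix.one_mul]
      _ = _ := by rw [Matrix.mul_assoc, h1, Matrix.mul_one]
  cases g with
  | not q => exact key _ (involutive_not q)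
  | cnot c t h => exact key _ (involutive_cnot c t h)
  | toffoli a b t hab hat hbt => exact key _ (involutive_toffoli a b t hat hbt)
  | single q U =>
    rw [Gate.single_eq_lift, lift_conjTranspose (Function.injective_of_subsingleton _),
      Gate.inv, Gate.single_eq_lift]
    rfl

end Gates

/-! ### Circuits -/

namespace Circuit
variable {V W : Type} [Fintype V] [DecidableEq V] [Fintype W] [DecidableEq W]

theorem toMatrix_nil : Circuit.toMatrix ([] : Circuit W) = 1 := rfl

theorem foldl_eq (C : Circuit W) (N : Matrix (W → Bool) (W → Bool) ℂ) :
    C.foldl (fun M g => g.toMatrix * M) N = Circuit.toMatrix C * N := by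
  unfold Circuit.toMatrix
  induction C generalizing N with
  | nil => simp
  | cons g C ih =>
    rw [List.foldl_cons, List.foldl_cons, ih, ih (g.toMatrix * 1), Matrix.mul_one,
      Matrix.mul_assoc]

theorem toMatrix_cons (g : Gate W) (C : Circuit W) :
    Circuit.toMatrix (g :: C) = Circuit.toMatrix C * g.toMatrix := by
  rw [Circuit.toMatrix, List.foldl_cons, foldl_eq, Matrix.mul_one]

theorem toMatrix_append (C C' : Circuit W) :
    Circuit.toMatrix (C ++ C') = Circuit.toMatrix C' * Circuit.toMatrix C := by
  rw [Circuit.toMatrix, List.foldl_append, foldl_eq]; rfl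

theorem toMatrix_singleton (g : Gate W) : Circuit.toMatrix [g] = g.toMatrix := by
  rw [toMatrix_cons, toMatrix_nil, Matrix.one_mul]

/-- A circuit on the qubits in the range of an injective map. -/
def map (ι : V → W) (hι : Function.Injective ι) (C : Circuit V) : Circuit W :=
  List.map (Gate.map ι hι) C

theorem length_map (ι : V → W) (hι : Function.Injective ι) (C : Circuit V) :
    (Circuit.map ι hι C).length = C.length := List.length_map _

theorem toMatrix_map {ι : V → W} (hι : Function.Injective ι) (C : Circuit V) :
    Circuit.toMatrix (Circuit.map ι hι C) = lift ι (Circuit.toMatrix C) := by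
  induction C with
  | nil => exact (lift_one hι).symm
  | cons g C ih =>
    rw [show Circuit.map ι hι (g :: C) = g.map ι hι :: Circuit.map ι hι C from rfl,
      toMatrix_cons, toMatrix_cons, ih, lift_mul hι, Gate.toMatrix_map]

theorem isUnitary (C : Circuit W) : IsUnitary (Circuit.toMatrix C) := by
  induction C with
  | nil => exact IsUnitary.one
  | cons g C ih => rw [toMatrix_cons]; exact ih.mul g.isUnitary

/-- The inverse circuit. -/
def inv (C : Circuit W) : Circuit W := (List.map Gate.inv C).reverse

theorem length_inv (C : Circuit W) : (Circuit.inv C).length = C.length := by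
  simp [Circuit.inv]

theorem toMatrix_inv (C : Circuit W) :
    Circuit.toMatrix (Circuit.inv C) = (Circuit.toMatrix C)ᴴ := by
  induction C with
  | nil => simp [Circuit.inv, toMatrix_nil]
  | cons g C ih =>
    rw [show Circuit.inv (g :: C) = Circuit.inv C ++ [g.inv] by simp [Circuit.inv],
      toMatrix_append, toMatrix_singleton, ih, toMatrix_cons, conjTranspose_mul,
      Gate.toMatrix_inv]

end Circuit

/-! ### Copying circuits -/

section Copy
variable {κ W : Type} [Fintype κ] [DecidableEq κ] [Fintype W] [DecidableEq W]

/-- CNOT gates from `src a` to `dst a`. -/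
def Circuit.copy (src dst : κ → W) (h : ∀ a b, src a ≠ dst b) : Circuit W :=
  (Finset.univ : Finset κ).toList.map fun a => .cnot (src a) (dst a) (h a a)

theorem Circuit.length_copy (src dst : κ → W) (h : ∀ a b, src a ≠ dst b) :
    (Circuit.copy src dst h).length = Fintype.card κ := by
  simp [Circuit.copy]

/-- No source is a target, so every CNOT reads an unaltered source and their order does not matter.
-/
theorem Circuit.copy_mulVec {src dst : κ → W} (h : ∀ a b, src a ≠ dst b)
    (hd : Function.Injective dst) (f : (W → Bool) → ℂ) (z : W → Bool) :
    (Circuit.toMatrix (Circuit.copy src dst h) *ᵥ f) z =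
      f (Function.extend dst (bxor (z ∘ dst) (z ∘ src)) z) := by
  have key : ∀ L : List κ, L.Nodup → ∀ f : (W → Bool) → ℂ,
      (Circuit.toMatrix (L.map fun a => Gate.cnot (src a) (dst a) (h a a)) *ᵥ f) z =
        f (Function.extend dst (fun a => if a ∈ L then xor (z (dst a)) (z (src a))
          else z (dst a)) z) := by
    intro L
    induction L with
    | nil =>
      intro _ f
      have := extend_self' hd z
      rw [List.map_nil, Circuit.toMatrix_nil, one_mulVec]
      simp only [List.not_mem_nil, if_false]
      exact congrArg f this.symm
    | cons a L ih =>
      intro hL f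
      rw [List.map_cons, Circuit.toMatrix_cons, ← mulVec_mulVec, ih (List.nodup_cons.1 hL).2,
        Gate.toMatrix_cnot, basisMap_mulVec (involutive_cnot _ _ (h a a)), hd.extend_apply,
        Function.extend_apply' _ _ _ (fun ⟨b, hb⟩ => h a b hb.symm), ← extend_update hd]
      refine congrArg (fun p => f (Function.extend dst p z)) (funext fun b => ?_)
      rw [if_neg (List.nodup_cons.1 hL).1]
      by_cases hb : b = a
      · subst hb; simp
      · simp [hb]
  rw [Circuit.copy, key _ (Finset.nodup_toList _)]
  simp only [Finset.mem_toList, Finset.mem_univ, if_true]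
  rfl

end Copy

/-! ### Operators computed with clean ancillas -/

section Implementation
variable {V W A : Type} [Fintype V] [DecidableEq V] [Fintype W] [DecidableEq W]
  [Fintype A] [DecidableEq A]

/-- The tensor product of a state with zeros in the register `A`. -/
def padZero (A : Type) [Fintype A] (f : (W → Bool) → ℂ) : (W ⊕ A → Bool) → ℂ := fun v =>
  if v ∘ Sum.inr = fun _ => false then f (v ∘ Sum.inl) else 0

theorem padZero_elim (f : (W → Bool) → ℂ) (z : W → Bool) (e : A → Bool) :
    padZero A f (Sum.elim z e) = if e = fun _ => false then f z else 0 := rfl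

theorem sum_ext {W A : Type} {β : Sort*} {f g : (W ⊕ A → Bool) → β}
    (h : ∀ z e, f (Sum.elim z e) = g (Sum.elim z e)) : f = g := by
  funext v
  have := h (v ∘ Sum.inl) (v ∘ Sum.inr)
  rwa [Sum.elim_comp_inl_inr] at this

theorem sum_ext₃ {W A A' : Type} {β : Sort*} {f g : (W ⊕ (A ⊕ A') → Bool) → β}
    (h : ∀ z e e', f (Sum.elim z (Sum.elim e e')) = g (Sum.elim z (Sum.elim e e'))) : f = g := by
  refine sum_ext fun z e => ?_
  have := h z (e ∘ Sum.inl) (e ∘ Sum.inr)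
  rwa [Sum.elim_comp_inl_inr] at this

theorem sum_ext₃' {W A A' : Type} {β : Sort*} {f g : ((W ⊕ A) ⊕ A' → Bool) → β}
    (h : ∀ z e e', f (Sum.elim (Sum.elim z e) e') = g (Sum.elim (Sum.elim z e) e')) : f = g := by
  refine sum_ext fun z e => ?_
  have := h (z ∘ Sum.inl) (z ∘ Sum.inr) e
  rwa [Sum.elim_comp_inl_inr] at this

theorem elim_eq_const {V W : Type} (z : V → Bool) (e : W → Bool) (c : Bool) :
    (Sum.elim z e = fun _ => c) ↔ (z = fun _ => c) ∧ (e = fun _ => c) := by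
  simp [funext_iff]

theorem extend_inl (p z : W → Bool) (e : A → Bool) :
    Function.extend Sum.inl p (Sum.elim z e) = Sum.elim p e := by
  funext q
  rcases q with q | q
  · simp [Sum.inl_injective.extend_apply]
  · rw [Function.extend_apply' _ _ _ (by simp)]; rfl

theorem extend_inr (p e : A → Bool) (z : W → Bool) :
    Function.extend Sum.inr p (Sum.elim z e) = Sum.elim z p := by
  funext q
  rcases q with q | q
  · rw [Function.extend_apply' _ _ _ (by simp)]; rfl
  · simp [Sum.inr_injective.extend_apply]

theorem extend_map {V' W' : Type} {ι : V → W} (hι : Function.Injective ι) {ι' : V' → W'}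
    (hι' : Function.Injective ι') (p : V → Bool) (p' : V' → Bool) (z : W → Bool)
    (z' : W' → Bool) :
    Function.extend (Sum.map ι ι') (Sum.elim p p') (Sum.elim z z') =
      Sum.elim (Function.extend ι p z) (Function.extend ι' p' z') := by
  have hinj : Function.Injective (Sum.map ι ι') := Sum.map_injective.2 ⟨hι, hι'⟩
  funext q
  rcases q with q | q
  · by_cases h : ∃ b, ι b = q
    · obtain ⟨b, rfl⟩ := h
      rw [show (Sum.inl (ι b) : W ⊕ W') = Sum.map ι ι' (.inl b) from rfl, hinj.extend_apply]
      simp [hι.extend_apply]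
    · rw [Function.extend_apply', Sum.elim_inl, Sum.elim_inl, Function.extend_apply' _ _ _ h]
      rintro ⟨b | b, hb⟩
      · exact h ⟨b, Sum.inl_injective hb⟩
      · simp at hb
  · by_cases h : ∃ b, ι' b = q
    · obtain ⟨b, rfl⟩ := h
      rw [show (Sum.inr (ι' b) : W ⊕ W') = Sum.map ι ι' (.inr b) from rfl, hinj.extend_apply]
      simp [hι'.extend_apply]
    · rw [Function.extend_apply', Sum.elim_inr, Sum.elim_inr, Function.extend_apply' _ _ _ h]
      rintro ⟨b | b, hb⟩
      · simp at hb
      · exact h ⟨b, Sum.inr_injective hb⟩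

theorem extend_id {α : Type} (p z : α → Bool) : Function.extend id p z = p :=
  funext fun a => Function.injective_id.extend_apply p z a

/-- `U` is computed by a circuit with at most `s` gates and at most `s` ancillas, which start and
end in the state zero. -/
def Impl (s : ℕ) (U : Matrix (W → Bool) (W → Bool) ℂ) : Prop :=
  ∃ (A : Type) (_ : Fintype A) (_ : DecidableEq A) (C : Circuit (W ⊕ A)),
    Fintype.card A ≤ s ∧ C.length ≤ s ∧
      ∀ f, Circuit.toMatrix C *ᵥ padZero A f = padZero A (U *ᵥ f)

theorem Impl.mono {s s' : ℕ} {U : Matrix (W → Bool) (W → Bool) ℂ} (h : Impl s U)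
    (hs : s ≤ s') : Impl s' U := by
  obtain ⟨A, i₁, i₂, C, h₁, h₂, h₃⟩ := h
  exact ⟨A, i₁, i₂, C, h₁.trans hs, h₂.trans hs, h₃⟩

theorem lift_inl_padZero (M : Matrix (W → Bool) (W → Bool) ℂ) (f : (W → Bool) → ℂ) :
    lift Sum.inl M *ᵥ padZero A f = padZero A (M *ᵥ f) := by
  refine sum_ext fun z e => ?_
  rw [lift_mulVec Sum.inl_injective, padZero_elim, Sum.elim_comp_inl]
  simp only [extend_inl, padZero_elim]
  split_ifs with h
  · rfl
  · exact congrFun (mulVec_zero M) z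

theorem Impl.circuit (C : Circuit W) : Impl C.length (Circuit.toMatrix C) := by
  refine ⟨Empty, inferInstance, inferInstance, Circuit.map Sum.inl Sum.inl_injective C,
    by simp, by simp [Circuit.length_map], fun f => ?_⟩
  rw [Circuit.toMatrix_map, lift_inl_padZero]

theorem Impl.one : Impl 0 (1 : Matrix (W → Bool) (W → Bool) ℂ) := Impl.circuit []

theorem padZero_assoc {A' : Type} [Fintype A'] (f : (W → Bool) → ℂ) (z : W → Bool)
    (e : A → Bool) (e' : A' → Bool) :
    padZero (A ⊕ A') f (Sum.elim z (Sum.elim e e')) =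
      padZero A' (padZero A f) (Sum.elim (Sum.elim z e) e') := by
  simp only [padZero_elim, elim_eq_const]
  split_ifs <;> simp_all

/-- The two circuits get separate ancilla registers; each register is in the state zero while the
other circuit acts, so each step reduces to the hypothesis on a single circuit. -/
theorem Impl.mul {s s' : ℕ} {U U' : Matrix (W → Bool) (W → Bool) ℂ} (h : Impl s U)
    (h' : Impl s' U') : Impl (s + s') (U * U') := by
  obtain ⟨A, _, _, C, h₁, h₂, h₃⟩ := h
  obtain ⟨A', _, _, C', h₁', h₂', h₃'⟩ := h'
  have i₁ : Function.Injective (Sum.map (id : W → W) (Sum.inl : A → A ⊕ A')) :=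
    Sum.map_injective.2 ⟨Function.injective_id, Sum.inl_injective⟩
  have i₂ : Function.Injective (Sum.map (id : W → W) (Sum.inr : A' → A ⊕ A')) :=
    Sum.map_injective.2 ⟨Function.injective_id, Sum.inr_injective⟩
  refine ⟨A ⊕ A', inferInstance, inferInstance,
    Circuit.map _ i₂ C' ++ Circuit.map _ i₁ C, ?_, ?_, fun f => ?_⟩
  · rw [Fintype.card_sum]; omega
  · rw [List.length_append, Circuit.length_map, Circuit.length_map]; omega
  · have e₁ : ∀ f, Circuit.toMatrix (Circuit.map _ i₁ C) *ᵥ padZero (A ⊕ A') f =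
        padZero (A ⊕ A') (U *ᵥ f) := by
      intro f
      rw [Circuit.toMatrix_map]
      refine sum_ext₃ fun z e e' => ?_
      rw [lift_mulVec i₁, show Sum.elim z (Sum.elim e e') ∘ Sum.map id Sum.inl = Sum.elim z e by
        funext q; rcases q with q | q <;> rfl, padZero_assoc, ← h₃]
      have : (fun p => padZero (A ⊕ A') f (Function.extend (Sum.map id Sum.inl) p
          (Sum.elim z (Sum.elim e e')))) =
          fun p => if e' = fun _ => false then padZero A f p else 0 := by
        refine sum_ext fun p q => ?_
        rw [extend_map Function.injective_id Sum.inl_injective, extend_id, extend_inl,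
          padZero_assoc, padZero_elim (W := W ⊕ A)]
      rw [this, padZero_elim]
      split_ifs
      · rfl
      · exact congrFun (mulVec_zero _) _
    have e₂ : ∀ f, Circuit.toMatrix (Circuit.map _ i₂ C') *ᵥ padZero (A ⊕ A') f =
        padZero (A ⊕ A') (U' *ᵥ f) := by
      intro f
      rw [Circuit.toMatrix_map]
      refine sum_ext₃ fun z e e' => ?_
      have sw : ∀ (f : (W → Bool) → ℂ) (z : W → Bool) (e : A → Bool) (e' : A' → Bool),
          padZero (A ⊕ A') f (Sum.elim z (Sum.elim e e')) =
          if e = fun _ => false then padZero A' f (Sum.elim z e') else 0 := by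
        intro f z e e'
        simp only [padZero_elim, elim_eq_const]
        split_ifs <;> simp_all
      rw [lift_mulVec i₂, show Sum.elim z (Sum.elim e e') ∘ Sum.map id Sum.inr = Sum.elim z e' by
        funext q; rcases q with q | q <;> rfl, sw, ← h₃']
      have : (fun p => padZero (A ⊕ A') f (Function.extend (Sum.map id Sum.inr) p
          (Sum.elim z (Sum.elim e e')))) =
          fun p => if e = fun _ => false then padZero A' f p else 0 := by
        refine sum_ext fun p q => ?_
        rw [extend_map Function.injective_id Sum.inr_injective, extend_id, extend_inr, sw]
      rw [this]
      split_ifs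
      · rfl
      · exact congrFun (mulVec_zero _) _
    rw [Circuit.toMatrix_append, ← mulVec_mulVec, e₂, e₁, mulVec_mulVec]

theorem Impl.lift {s : ℕ} {ι : V → W} (hι : Function.Injective ι)
    {U : Matrix (V → Bool) (V → Bool) ℂ} (h : Impl s U) : Impl s (lift ι U) := by
  obtain ⟨A, _, _, C, h₁, h₂, h₃⟩ := h
  have hi : Function.Injective (Sum.map ι (id : A → A)) :=
    Sum.map_injective.2 ⟨hι, Function.injective_id⟩
  refine ⟨A, inferInstance, inferInstance, Circuit.map _ hi C, h₁,
    by rwa [Circuit.length_map], fun f => ?_⟩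
  rw [Circuit.toMatrix_map]
  refine sum_ext fun z e => ?_
  rw [lift_mulVec hi, show Sum.elim z e ∘ Sum.map ι id = Sum.elim (z ∘ ι) e by
    funext q; rcases q with q | q <;> rfl, padZero_elim, lift_mulVec hι]
  have : (fun p => padZero A f (Function.extend (Sum.map ι id) p (Sum.elim z e))) =
      padZero A fun p => f (Function.extend ι p z) := by
    refine sum_ext fun p q => ?_
    rw [extend_map hι Function.injective_id, extend_id, padZero_elim, padZero_elim]
  rw [this, h₃, padZero_elim]

/-- A register that the larger operator returns to zero can be counted among the ancillas. -/
theorem Impl.of_ancilla {s : ℕ} {U' : Matrix (W ⊕ A → Bool) (W ⊕ A → Bool) ℂ}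
    {U : Matrix (W → Bool) (W → Bool) ℂ} (h : Impl s U')
    (hU : ∀ f, U' *ᵥ padZero A f = padZero A (U *ᵥ f)) : Impl (s + Fintype.card A) U := by
  obtain ⟨A', _, _, C, h₁, h₂, h₃⟩ := h
  let ι := (Equiv.sumAssoc W A A')
  refine ⟨A ⊕ A', inferInstance, inferInstance, Circuit.map ι ι.injective C,
    by rw [Fintype.card_sum]; omega, by rw [Circuit.length_map]; omega, fun f => ?_⟩
  rw [Circuit.toMatrix_map]
  refine sum_ext₃ fun z e e' => ?_
  have hc : ∀ z (e : A → Bool) (e' : A' → Bool), Sum.elim z (Sum.elim e e') ∘ ι =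
      Sum.elim (Sum.elim z e) e' := by
    intro z e e'; funext q; rcases q with (q | q) | q <;> rfl
  rw [lift_mulVec ι.injective, hc, padZero_assoc, ← hU, ← h₃]
  refine congrArg (fun g => (Circuit.toMatrix C *ᵥ g) _) (sum_ext₃' fun p q q' => ?_)
  rw [← padZero_assoc]
  refine congrArg _ ?_
  rw [← hc p q q']
  funext a
  obtain ⟨b, rfl⟩ := ι.surjective a
  rw [ι.injective.extend_apply]
  rfl

end Implementation

/-! ### Classical functions computed by circuits -/

section Oracles
variable {I O Q V W : Type} [Fintype I] [DecidableEq I] [Fintype O] [DecidableEq O]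
  [Fintype Q] [DecidableEq Q] [Fintype V] [DecidableEq V] [Fintype W] [DecidableEq W]

theorem bxor_bxor_self (u v : W → Bool) : bxor (bxor u v) v = u := by
  funext a; simp [bxor]

theorem bxor_false (u : W → Bool) : bxor u (fun _ => false) = u := by
  funext a; simp [bxor]

theorem bxor_comm' (u v : W → Bool) : bxor u v = bxor v u := by
  funext a; simp [bxor, Bool.xor_comm]

theorem bxor_assoc' (u v w : W → Bool) : bxor (bxor u v) w = bxor u (bxor v w) := by
  funext a; simp [bxor]

theorem bxor_eq_false_iff (u v : W → Bool) : (bxor u v = fun _ => false) ↔ u = v := by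
  constructor
  · intro h; funext a; simpa [bxor] using congrFun h a
  · rintro rfl; funext a; simp [bxor]

theorem sum_elim {β : Type*} [AddCommMonoid β] (f : (V ⊕ W → Bool) → β) :
    ∑ v, f v = ∑ x, ∑ y, f (Sum.elim x y) := by
  rw [← Fintype.sum_prod_type', ← Equiv.sum_comp (Equiv.sumArrowEquivProdArrow V W Bool).symm]
  rfl

/-- After `x` has been added to the range of `i`, the all-zero state can only have come from `x`
padded with zeros. This evaluates the amplitude of an initial basis state behind a copying circuit.
-/
theorem extend_bxor_eq_false_iff {i : V → W} (hi : Function.Injective i) (x : V → Bool)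
    (p : W → Bool) : (Function.extend i (bxor (p ∘ i) x) p = fun _ => false) ↔
      p = Function.extend i x fun _ => false := by
  constructor
  · intro h
    have h₁ : bxor (p ∘ i) x = fun _ => false := by
      rw [← extend_comp' hi (bxor (p ∘ i) x) p, h]; rfl
    rw [← (bxor_eq_false_iff _ _).1 h₁, ← h, extend_extend' hi, extend_self' hi]
  · rintro rfl
    rw [extend_comp' hi, extend_extend' hi, (bxor_eq_false_iff _ _).2 rfl]
    exact extend_self' hi fun _ => false

/-- The exclusive or of the value of `F` with the second register. -/
def xorMap (F : (I → Bool) → O → Bool) (v : I ⊕ O → Bool) : I ⊕ O → Bool :=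
  Sum.elim (v ∘ Sum.inl) (bxor (v ∘ Sum.inr) (F (v ∘ Sum.inl)))

theorem involutive_xorMap (F : (I → Bool) → O → Bool) : Function.Involutive (xorMap F) := by
  intro v
  simp only [xorMap, Sum.elim_comp_inl, Sum.elim_comp_inr, bxor_bxor_self, Sum.elim_comp_inl_inr]

/-- The operator `|x⟩|t⟩ ↦ |x⟩|t ⊕ F x⟩`. -/
def oracle (F : (I → Bool) → O → Bool) : Matrix (I ⊕ O → Bool) (I ⊕ O → Bool) ℂ :=
  basisMap (xorMap F)

theorem extend_elim {ι : I → W} {o : O → W} (h : Function.Injective (Sum.elim ι o))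
    (t : O → Bool) (z : W → Bool) :
    Function.extend (Sum.elim ι o) (Sum.elim (z ∘ ι) t) z = Function.extend o t z := by
  have ho : Function.Injective o := fun a b hab => Sum.inr_injective (h hab)
  funext a
  by_cases h₁ : ∃ b, o b = a
  · obtain ⟨b, rfl⟩ := h₁
    rw [ho.extend_apply, show o b = Sum.elim ι o (.inr b) from rfl, h.extend_apply]; rfl
  rw [Function.extend_apply' _ _ _ h₁]
  by_cases h₂ : ∃ b, ι b = a
  · obtain ⟨b, rfl⟩ := h₂
    conv_lhs => rw [show ι b = Sum.elim ι o (.inl b) from rfl, h.extend_apply]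
    rfl
  · rw [Function.extend_apply']
    rintro ⟨b | b, hb⟩
    · exact h₂ ⟨b, hb⟩
    · exact h₁ ⟨b, hb⟩

theorem lift_oracle_mulVec {ι : I → W} {o : O → W} (h : Function.Injective (Sum.elim ι o))
    (F : (I → Bool) → O → Bool) (f : (W → Bool) → ℂ) (z : W → Bool) :
    (lift (Sum.elim ι o) (oracle F) *ᵥ f) z =
      f (Function.extend o (bxor (z ∘ o) (F (z ∘ ι))) z) := by
  rw [oracle, lift_basisMap_mulVec h (involutive_xorMap F), ← extend_elim h]
  rfl

theorem oracle_mulVec (F : (I → Bool) → O → Bool) (f : (I ⊕ O → Bool) → ℂ) (x : I → Bool)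
    (t : O → Bool) : (oracle F *ᵥ f) (Sum.elim x t) = f (Sum.elim x (bxor t (F x))) := by
  rw [oracle, basisMap_mulVec (involutive_xorMap F)]; rfl

theorem extend_inl_comp {ι : V → I} (hι : Function.Injective ι) (p : V → Bool) (z : I → Bool)
    (e : O → Bool) : Function.extend (Sum.inl ∘ ι) p (Sum.elim z e) =
      Sum.elim (Function.extend ι p z) e := by
  have hinj : Function.Injective ((Sum.inl : I → I ⊕ O) ∘ ι) := Sum.inl_injective.comp hι
  funext q
  by_cases h : ∃ b, ((Sum.inl : I → I ⊕ O) ∘ ι) b = q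
  · obtain ⟨b, rfl⟩ := h
    rw [hinj.extend_apply]; simp [hι.extend_apply]
  · rw [Function.extend_apply' _ _ _ h]
    rcases q with q | q
    · rw [Sum.elim_inl, Sum.elim_inl, Function.extend_apply']
      rintro ⟨b, rfl⟩; exact h ⟨b, rfl⟩
    · rfl

theorem extend_inr_comp {ι : V → O} (hι : Function.Injective ι) (p : V → Bool) (z : I → Bool)
    (e : O → Bool) : Function.extend (Sum.inr ∘ ι) p (Sum.elim z e) =
      Sum.elim z (Function.extend ι p e) := by
  have hinj : Function.Injective ((Sum.inr : O → I ⊕ O) ∘ ι) := Sum.inr_injective.comp hι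
  funext q
  by_cases h : ∃ b, ((Sum.inr : O → I ⊕ O) ∘ ι) b = q
  · obtain ⟨b, rfl⟩ := h
    rw [hinj.extend_apply]; simp [hι.extend_apply]
  · rw [Function.extend_apply' _ _ _ h]
    rcases q with q | q
    · rfl
    · rw [Sum.elim_inr, Sum.elim_inr, Function.extend_apply']
      rintro ⟨b, rfl⟩; exact h ⟨b, rfl⟩

/-- `F` is computed, reversibly and with clean ancillas, by a circuit of size `s`. -/
def Comp (s : ℕ) (F : (I → Bool) → O → Bool) : Prop := Impl s (oracle F)

namespace Comp

theorem mono {s s' : ℕ} {F : (I → Bool) → O → Bool} (h : Comp s F) (hs : s ≤ s') : Comp s' F :=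
  Impl.mono h hs

theorem lift {s : ℕ} {F : (I → Bool) → O → Bool} (h : Comp s F) {ι : I → W} {o : O → W}
    (hi : Function.Injective (Sum.elim ι o)) :
    Impl s (MeasurementProtocol.lift (Sum.elim ι o) (oracle F)) :=
  Impl.lift hi h

theorem congr_matrix {s : ℕ} {F : (I → Bool) → O → Bool}
    {U : Matrix (I ⊕ O → Bool) (I ⊕ O → Bool) ℂ} (h : Impl s U)
    (hU : ∀ f x t, (U *ᵥ f) (Sum.elim x t) = f (Sum.elim x (bxor t (F x)))) : Comp s F := by
  have : oracle F = U := ext_iff_mulVec.2 fun f => sum_ext fun x t => by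
    rw [hU, oracle_mulVec]
  rw [Comp, this]; exact h

/-- The value of `F` is computed into an ancilla register, `G` is applied to it, and since the
oracle of `F` is its own inverse a second call clears the register. Hence `s'` occurs twice and the
size of the register is added. -/
theorem comp {s s' : ℕ} {G : (O → Bool) → Q → Bool} {F : (I → Bool) → O → Bool}
    (hG : Comp s G) (hF : Comp s' F) :
    Comp (s' + s + s' + Fintype.card O) fun x => G (F x) := by
  have i₁ : Function.Injective
      (Sum.elim (Sum.inl ∘ Sum.inl) Sum.inr : I ⊕ O → (I ⊕ Q) ⊕ O) := by
    rintro (a | a) (b | b) <;> simp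
  have i₂ : Function.Injective
      (Sum.elim Sum.inr (Sum.inl ∘ Sum.inr) : O ⊕ Q → (I ⊕ Q) ⊕ O) := by
    rintro (a | a) (b | b) <;> simp
  refine Impl.of_ancilla (((hF.lift i₁).mul (hG.lift i₂)).mul (hF.lift i₁)) fun f =>
    sum_ext₃' fun x t e => ?_
  have c₁ : ∀ (x : I → Bool) (t : Q → Bool) (e : O → Bool),
      Sum.elim (Sum.elim x t) e ∘ (Sum.inl ∘ Sum.inl) = x := fun _ _ _ => rfl
  have c₂ : ∀ (x : I → Bool) (t : Q → Bool) (e : O → Bool),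
      Sum.elim (Sum.elim x t) e ∘ (Sum.inl ∘ Sum.inr) = t := fun _ _ _ => rfl
  rw [← mulVec_mulVec, ← mulVec_mulVec, lift_oracle_mulVec i₁, extend_inr, lift_oracle_mulVec i₂,
    extend_inl_comp Sum.inr_injective, extend_inr, lift_oracle_mulVec i₁, extend_inr, c₁, c₂, c₁,
    Sum.elim_comp_inr, Sum.elim_comp_inr, Sum.elim_comp_inr, bxor_bxor_self]
  change (if e = fun _ => false then f _ else 0) = if e = fun _ => false then
    (oracle (fun x => G (F x)) *ᵥ f) (Sum.elim x t) else 0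
  rw [oracle_mulVec]
  split_ifs with h
  · subst h
    rw [bxor_comm' (fun _ => false), bxor_false]; rfl
  · rfl

theorem prod {s s' : ℕ} {F : (I → Bool) → O → Bool} {G : (I → Bool) → Q → Bool}
    (hF : Comp s F) (hG : Comp s' G) : Comp (s + s') fun x => Sum.elim (F x) (G x) := by
  have i₁ : Function.Injective
      (Sum.elim Sum.inl (Sum.inr ∘ Sum.inl) : I ⊕ O → I ⊕ (O ⊕ Q)) := by
    rintro (a | a) (b | b) <;> simp
  have i₂ : Function.Injective
      (Sum.elim Sum.inl (Sum.inr ∘ Sum.inr) : I ⊕ Q → I ⊕ (O ⊕ Q)) := by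
    rintro (a | a) (b | b) <;> simp
  refine congr_matrix ((hF.lift i₁).mul (hG.lift i₂)) fun f x t => ?_
  rw [← mulVec_mulVec, lift_oracle_mulVec i₁, extend_inr_comp Sum.inl_injective,
    lift_oracle_mulVec i₂, extend_inr_comp Sum.inr_injective]
  refine congrArg f (congrArg (Sum.elim x) ?_)
  conv_lhs => rw [← Sum.elim_comp_inl_inr t, extend_inl, extend_inr]
  funext q
  rcases q with q | q <;> rfl

theorem xor {s s' : ℕ} {F G : (I → Bool) → O → Bool} (hF : Comp s F) (hG : Comp s' G) :
    Comp (s + s') fun x => bxor (F x) (G x) := by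
  refine congr_matrix (Impl.mul hF hG) fun f x t => ?_
  rw [← mulVec_mulVec, oracle_mulVec, oracle_mulVec, bxor_assoc']

theorem zero : Comp 0 fun (_ : I → Bool) (_ : O) => false :=
  congr_matrix Impl.one fun f x t => by rw [one_mulVec, bxor_false]

theorem at_ {s : ℕ} {f : (I → Bool) → Unit → Bool} (h : Comp s f) (o : O) :
    Comp s fun x o' => if o' = o then f x () else false := by
  have i₁ : Function.Injective
      (Sum.elim Sum.inl (Sum.inr ∘ fun _ => o) : I ⊕ Unit → I ⊕ O) := by
    rintro (a | a) (b | b) <;> simp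
  refine congr_matrix (h.lift i₁) fun g x t => ?_
  rw [lift_oracle_mulVec i₁, extend_inr_comp (Function.injective_of_subsingleton _)]
  refine congrArg g (congrArg (Sum.elim x) ?_)
  funext q
  by_cases hq : q = o
  · subst hq
    have := (Function.injective_of_subsingleton (fun _ : Unit => q)).extend_apply
      (bxor (Sum.elim x t ∘ (Sum.inr ∘ fun _ => q)) (f (Sum.elim x t ∘ Sum.inl))) t ()
    rw [this]; simp [bxor]
  · rw [Function.extend_apply' _ _ _ (by rintro ⟨_, rfl⟩; exact hq rfl)]
    simp [bxor, hq]

/-- The output bits have separate targets, so they can be computed independently one after the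
other; a sum over a finite set of outputs makes this an induction. -/
theorem pi {s : ℕ} {F : O → (I → Bool) → Unit → Bool} (h : ∀ o, Comp s (F o)) :
    Comp (Fintype.card O * s) fun x o => F o x () := by
  have key : ∀ S : Finset O, Comp (S.card * s) fun x o => if o ∈ S then F o x () else false := by
    intro S
    induction S using Finset.induction_on with
    | empty => simpa using zero
    | insert o S ho ih =>
      rw [Finset.card_insert_of_notMem ho, Nat.add_mul, Nat.one_mul]
      convert ih.xor ((h o).at_ o) using 1
      funext x o'
      by_cases h' : o' = o
      · subst h'; simp [bxor, ho]
      · simp [bxor, h']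
  simpa using key Finset.univ

theorem bit (i : I) : Comp 1 fun x (_ : Unit) => x i := by
  refine congr_matrix (Impl.circuit [Gate.cnot (Sum.inl i) (Sum.inr ()) Sum.inl_ne_inr])
    fun f x t => ?_
  rw [Circuit.toMatrix_singleton, Gate.toMatrix_cnot, basisMap_mulVec (involutive_cnot _ _ Sum.inl_ne_inr)]
  refine congrArg f ?_
  funext q
  rcases q with q | q <;> simp [bxor]

theorem const (c : Bool) : Comp 1 fun (_ : I → Bool) (_ : Unit) => c := by
  cases c
  · exact zero.mono (Nat.zero_le 1)
  · refine congr_matrix (Impl.circuit [Gate.not (Sum.inr ())]) fun f x t => ?_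
    rw [Circuit.toMatrix_singleton, Gate.toMatrix_not, basisMap_mulVec (involutive_not _)]
    refine congrArg f ?_
    funext q
    rcases q with q | q <;> simp [bxor]

theorem wire (g : O → I) : Comp (Fintype.card O) fun x o => x (g o) := by
  have := pi (O := O) fun o => bit (g o)
  rwa [mul_one] at this

theorem consts (c : O → Bool) : Comp (Fintype.card O) fun (_ : I → Bool) o => c o := by
  have := pi (I := I) (O := O) fun o => const (c o)
  rwa [mul_one] at this

theorem and {s s' : ℕ} {f g : (I → Bool) → Unit → Bool} (hf : Comp s f) (hg : Comp s' g) :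
    Comp (2 * (s + s') + 3) fun x (_ : Unit) => f x () && g x () := by
  have : Comp 1 fun (x : Unit ⊕ Unit → Bool) (_ : Unit) => x (.inl ()) && x (.inr ()) := by
    refine congr_matrix (Impl.circuit [Gate.toffoli (W := (Unit ⊕ Unit) ⊕ Unit) (Sum.inl (Sum.inl ())) (Sum.inl (Sum.inr ()))
      (Sum.inr ()) (by simp) Sum.inl_ne_inr Sum.inl_ne_inr]) fun f x t => ?_
    rw [Circuit.toMatrix_singleton, Gate.toMatrix_toffoli,
      basisMap_mulVec (involutive_toffoli (W := (Unit ⊕ Unit) ⊕ Unit) _ _ _ Sum.inl_ne_inr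
        Sum.inl_ne_inr)]
    refine congrArg f ?_
    funext q
    rcases q with q | q <;> simp [bxor]
  refine (Comp.comp this (Comp.prod hf hg)).mono ?_
  simp; omega

/-- Selection of one of two values by a bit. -/
theorem cond {s s' s'' : ℕ} {c f g : (I → Bool) → Unit → Bool} (hc : Comp s'' c) (hf : Comp s f)
    (hg : Comp s' g) :
    Comp (2 * (s'' + (s + s')) + 3 + s') fun x (_ : Unit) => if c x () then f x () else g x () := by
  -- A selection is `(c && (f xor g)) xor g`.
  convert Comp.xor (Comp.and hc (Comp.xor hf hg)) hg using 1
  funext x u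
  simp only [bxor]
  cases c x () <;> cases f x () <;> cases g x () <;> rfl

theorem dot {n s s' : ℕ} {F G : (I → Bool) → Fin n → Bool} (hF : Comp s F) (hG : Comp s' G) :
    Comp (2 * (s + s') + 9 * n) fun x (_ : Unit) => MeasurementProtocol.dot (F x) (G x) := by
  -- The parity is accumulated one index at a time; 7 = 2(1 + 1) + 3 is the cost of one conjunction
  -- of two input bits. Composition with the pair `(F, G)` adds its 2n wires, which gives 9n in all.
  have key : ∀ S : Finset (Fin n), Comp (S.card * 7)
      fun (x : Fin n ⊕ Fin n → Bool) (_ : Unit) =>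
        decide ((S.filter fun i => x (.inl i) = true ∧ x (.inr i) = true).card % 2 = 1) := by
    intro S
    induction S using Finset.induction_on with
    | empty => simpa using zero
    | insert o S ho ih =>
      rw [Finset.card_insert_of_notMem ho, Nat.add_mul, Nat.one_mul]
      convert Comp.xor ih (Comp.and (bit (.inl o)) (bit (.inr o))) using 1
      funext x u
      rw [Finset.filter_insert, bxor]
      by_cases h : x (.inl o) = true ∧ x (.inr o) = true
      · rw [if_pos h, Finset.card_insert_of_notMem (by simp [ho]), h.1, h.2]
        have : ∀ k : ℕ, decide ((k + 1) % 2 = 1) = Bool.xor (decide (k % 2 = 1)) true := by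
          intro k
          rcases Nat.mod_two_eq_zero_or_one k with h | h <;> simp [Nat.add_mod, h]
        exact this _
      · rw [if_neg h]
        have : (x (.inl o) && x (.inr o)) = false := by
          simpa using h
        rw [this, Bool.xor_false]
  refine (Comp.comp (key Finset.univ) (Comp.prod hF hG)).mono ?_
  simp; omega

end Comp

/-! ### Efficient deterministic algorithms -/

/-- Each classical gate is an involution of the basis. The permutation acts here by pullback, so the
circuit sends the basis state `z` to `σ.symm z`. -/
theorem Circuit.exists_perm (C : Circuit W) (hC : ∀ g ∈ C, g.IsClassical) :
    ∃ σ : Equiv.Perm (W → Bool), ∀ f, Circuit.toMatrix C *ᵥ f = f ∘ σ := by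
  induction C with
  | nil => exact ⟨Equiv.refl _, fun f => by rw [Circuit.toMatrix_nil, one_mulVec]; rfl⟩
  | cons g C ih =>
    obtain ⟨σ, hσ⟩ := ih fun g' hg' => hC g' (List.mem_cons_of_mem _ hg')
    have hg : ∃ τ : Equiv.Perm (W → Bool), ∀ f, g.toMatrix *ᵥ f = f ∘ τ := by
      have hgc := hC g List.mem_cons_self
      cases g with
      | not q =>
        exact ⟨(involutive_not q).toPerm _, fun f => funext fun z => by
          rw [Gate.toMatrix_not, basisMap_mulVec (involutive_not q)]; rfl⟩
      | cnot c t h =>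
        exact ⟨(involutive_cnot c t h).toPerm _, fun f => funext fun z => by
          rw [Gate.toMatrix_cnot, basisMap_mulVec (involutive_cnot c t h)]; rfl⟩
      | toffoli a b t hab hat hbt =>
        exact ⟨(involutive_toffoli a b t hat hbt).toPerm _, fun f => funext fun z => by
          rw [Gate.toMatrix_toffoli, basisMap_mulVec (involutive_toffoli a b t hat hbt)]; rfl⟩
      | single q U => exact hgc.elim
    obtain ⟨τ, hτ⟩ := hg
    exact ⟨σ.trans τ, fun f => by
      rw [Circuit.toMatrix_cons, ← mulVec_mulVec, hσ, hτ]; rfl⟩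

theorem Circuit.inv_mulVec_of_perm {C : Circuit W} {σ : Equiv.Perm (W → Bool)}
    (hσ : ∀ f, Circuit.toMatrix C *ᵥ f = f ∘ σ) (f : (W → Bool) → ℂ) :
    Circuit.toMatrix (Circuit.inv C) *ᵥ f = f ∘ σ.symm := by
  have : f = Circuit.toMatrix C *ᵥ (f ∘ σ.symm) := by
    rw [hσ]; funext z; simp
  conv_lhs => rw [this, Circuit.toMatrix_inv, mulVec_mulVec, Circuit.isUnitary C, one_mulVec]

/-- The algorithm is run with its output and work registers as ancillas, the output is copied, and
the run is undone. The resulting `F` is defined on all strings, although the algorithm is specified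
only where some output has probability 1. -/
theorem QAlg.exists_comp (A : QAlg I O) (hA : ∀ g ∈ A.circ, g.IsClassical) :
    ∃ F : (I → Bool) → O → Bool,
      Comp (2 * (A.anc + A.circ.length) + 2 * Fintype.card O) F ∧
        ∀ x z, A.prob x z = 1 → F x = z := by
  obtain ⟨σ, hσ⟩ := Circuit.exists_perm A.circ hA
  have hσ' := Circuit.inv_mulVec_of_perm hσ
  refine ⟨fun x => σ.symm (Sum.elim x fun _ => false) ∘ Sum.inr ∘ Sum.inl, ?_, ?_⟩
  · have hj : Function.Injective (Sum.map (Sum.inl : I → I ⊕ O) (id : O ⊕ Fin A.anc → _)) :=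
      Sum.map_injective.2 ⟨Sum.inl_injective, Function.injective_id⟩
    have hk : ∀ a b : O, (Sum.inr (Sum.inl a) : (I ⊕ O) ⊕ (O ⊕ Fin A.anc)) ≠
        (Sum.inl ∘ Sum.inr) b := by simp
    refine Impl.mono (Impl.of_ancilla (A := O ⊕ Fin A.anc) (((Impl.circuit (Circuit.map _ hj (Circuit.inv A.circ))).mul
      (Impl.circuit (Circuit.copy _ _ hk))).mul (Impl.circuit (Circuit.map _ hj A.circ)))
      fun f => sum_ext₃' fun x t e => ?_) ?_
    · have hjc : ∀ (x : I → Bool) (t : O → Bool) (e : O ⊕ Fin A.anc → Bool),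
          Sum.elim (Sum.elim x t) e ∘ Sum.map Sum.inl id = Sum.elim x e := by
        intro x t e; funext q; rcases q with q | q <;> rfl
      have hje : ∀ (p : I ⊕ (O ⊕ Fin A.anc) → Bool) (x : I → Bool) (t : O → Bool)
          (e : O ⊕ Fin A.anc → Bool),
          Function.extend (Sum.map Sum.inl id) p (Sum.elim (Sum.elim x t) e) =
            Sum.elim (Sum.elim (p ∘ Sum.inl) t) (p ∘ Sum.inr) := by
        intro p x t e
        conv_lhs => rw [← Sum.elim_comp_inl_inr p]
        rw [extend_map Sum.inl_injective Function.injective_id, extend_inl, extend_id]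
      rw [← mulVec_mulVec, ← mulVec_mulVec, Circuit.toMatrix_map, lift_mulVec hj, hσ', hjc,
        Function.comp_apply, hje, Circuit.copy_mulVec hk (Sum.inl_injective.comp Sum.inr_injective),
        extend_inl_comp Sum.inr_injective, extend_inr, Circuit.toMatrix_map, lift_mulVec hj, hσ,
        hjc, Function.comp_apply, hje, Sum.elim_comp_inl_inr, Equiv.apply_symm_apply]
      change (if e = fun _ => false then f (Sum.elim x (bxor t
        (σ.symm (Sum.elim x e) ∘ Sum.inr ∘ Sum.inl))) else 0) = if e = fun _ => false then
          (oracle (fun x => σ.symm (Sum.elim x fun _ => false) ∘ Sum.inr ∘ Sum.inl) *ᵥ f)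
            (Sum.elim x t) else 0
      rw [oracle_mulVec]
      split_ifs with h
      · subst h; rfl
      · rfl
    · rw [Circuit.length_map, Circuit.length_map, Circuit.length_inv, Circuit.length_copy,
        Fintype.card_sum, Fintype.card_fin]
      omega
  · intro x z h
    -- The circuit reaches a single basis state, so every output other than that of `F` has
    -- probability zero.
    by_contra hne
    have : A.prob x z = 0 := by
      refine Finset.sum_eq_zero fun v _ => ?_
      split_ifs with hv
      · have : A.finalState x v =
            (Circuit.toMatrix A.circ *ᵥ Pi.single (Sum.elim x fun _ => false) 1) v := by
          rw [mulVec_single_one]; rfl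
        rw [this, hσ, Function.comp_apply, Pi.single_apply, if_neg]
        · simp
        · intro h'
          refine hne ?_
          change σ.symm (Sum.elim x fun _ => false) ∘ Sum.inr ∘ Sum.inl = z
          rw [← h', Equiv.symm_apply_apply]
          exact hv
      · rfl
    rw [this] at h
    exact zero_ne_one h

/-- Measurement after a unitary with clean ancillas, the input being copied to the wires `i` and
the result being a function of the measured string. -/
theorem exists_qalg {s s' : ℕ} {i : I → W} (hi : Function.Injective i)
    {U : Matrix (W → Bool) (W → Bool) ℂ} (hU : Impl s U) {F : (W → Bool) → O → Bool}
    (hF : Comp s' F) :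
    ∃ A : QAlg I O, A.anc + A.circ.length ≤ 2 * (s + s' + Fintype.card I) + Fintype.card W ∧
      ∀ x z, A.prob x z = ∑ v : W → Bool, if F v = z then
        ‖(U *ᵥ Pi.single (Function.extend i x fun _ => false) 1) v‖ ^ 2 else 0 := by
  have hk : ∀ a b : I, (Sum.inl a : I ⊕ (O ⊕ W)) ≠ (Sum.inr ∘ Sum.inr ∘ i) b := by simp
  have hw : Function.Injective ((Sum.inr : O ⊕ W → I ⊕ (O ⊕ W)) ∘ Sum.inr) :=
    Sum.inr_injective.comp Sum.inr_injective
  have hf : Function.Injective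
      (Sum.elim (Sum.inr ∘ Sum.inr) (Sum.inr ∘ Sum.inl) : W ⊕ O → I ⊕ (O ⊕ W)) := by
    rintro (a | a) (b | b) <;> simp
  -- The input is only copied into `W` and stays in place; `U` acts on `W`, and the function of the
  -- result is written to the output register. The wires `W` and the ancillas become the work
  -- qubits.
  obtain ⟨A, _, _, C, h₁, h₂, h₃⟩ := ((hF.lift hf).mul (hU.lift hw)).mul
    (Impl.circuit (Circuit.copy _ _ hk))
  let e : W ⊕ A ≃ Fin (Fintype.card (W ⊕ A)) := Fintype.equivFin _
  let j : (I ⊕ (O ⊕ W)) ⊕ A ≃ I ⊕ (O ⊕ Fin (Fintype.card (W ⊕ A))) :=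
    (Equiv.sumAssoc _ _ _).trans (Equiv.sumCongr (Equiv.refl I)
      ((Equiv.sumAssoc _ _ _).trans (Equiv.sumCongr (Equiv.refl O) e)))
  refine ⟨⟨Fintype.card (W ⊕ A), Circuit.map j j.injective C⟩, ?_, fun x z => ?_⟩
  · simp only [Circuit.length_map, Fintype.card_sum]
    rw [Circuit.length_copy] at h₁ h₂
    omega
  · have hjc : ∀ (x : I → Bool) (o : O → Bool) (w : W → Bool) (a : A → Bool),
        Sum.elim x (Sum.elim o (Sum.elim w a ∘ e.symm)) ∘ j =
          Sum.elim (Sum.elim x (Sum.elim o w)) a := by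
      intro x o w a
      funext q
      rcases q with (q | q | q) | q <;> simp [j]
    -- The amplitude vanishes unless the ancillas are zero, the input is intact and the output
    -- register agrees with `F`. The output distribution is therefore that of `F` on a measurement
    -- of `W`.
    have hfin : ∀ (x' : I → Bool) (o : O → Bool) (w : W → Bool) (a : A → Bool),
        QAlg.finalState ⟨Fintype.card (W ⊕ A), Circuit.map j j.injective C⟩ x
          (Sum.elim x' (Sum.elim o (Sum.elim w a ∘ e.symm))) =
        if a = fun _ => false then if x' = x then if F w = o then
          (U *ᵥ Pi.single (Function.extend i x fun _ => false) 1) w else 0 else 0 else 0 := by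
      intro x' o w a
      have hs : QAlg.finalState ⟨Fintype.card (W ⊕ A), Circuit.map j j.injective C⟩ x
          (Sum.elim x' (Sum.elim o (Sum.elim w a ∘ e.symm))) =
          (Circuit.toMatrix (Circuit.map j j.injective C) *ᵥ
            Pi.single (Sum.elim x fun _ => false) 1)
            (Sum.elim x' (Sum.elim o (Sum.elim w a ∘ e.symm))) := by
        rw [mulVec_single_one]; rfl
      have hz : (Sum.elim x fun _ => false : I ⊕ (O ⊕ Fin (Fintype.card (W ⊕ A))) → Bool) ∘ j =
          Sum.elim (Sum.elim x fun _ => false) fun _ => false := by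
        funext q
        rcases q with (q | q | q) | q <;> simp [j]
      have hp : (fun p => (Pi.single (Sum.elim x fun _ => false) (1 : ℂ) :
            (I ⊕ (O ⊕ Fin (Fintype.card (W ⊕ A))) → Bool) → ℂ)
            (Function.extend j p (Sum.elim x' (Sum.elim o (Sum.elim w a ∘ e.symm))))) =
          padZero A (Pi.single (Sum.elim x fun _ => false) 1) := by
        refine sum_ext fun p q => ?_
        have hext : Function.extend j (Sum.elim p q)
            (Sum.elim x' (Sum.elim o (Sum.elim w a ∘ e.symm))) = Sum.elim p q ∘ j.symm := by
          funext b
          obtain ⟨c, rfl⟩ := j.surjective b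
          rw [j.injective.extend_apply]; simp
        rw [hext, padZero_elim]
        simp only [Pi.single_apply, Equiv.comp_symm_eq, hz, Sum.elim_eq_iff]
        split_ifs <;> simp_all
      rw [hs, Circuit.toMatrix_map, lift_mulVec j.injective, hp, hjc, h₃, padZero_elim]
      refine if_congr Iff.rfl ?_ rfl
      rw [← mulVec_mulVec, ← mulVec_mulVec, lift_oracle_mulVec hf,
        extend_inr_comp Sum.inl_injective, extend_inl, lift_mulVec hw]
      have hcopy : ∀ (x' : I → Bool) (t : O → Bool) (p w : W → Bool),
          (Circuit.toMatrix (Circuit.copy Sum.inl (Sum.inr ∘ Sum.inr ∘ i) hk) *ᵥ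
            Pi.single (Sum.elim x fun _ => false) 1)
            (Function.extend (Sum.inr ∘ Sum.inr) p (Sum.elim x' (Sum.elim t w))) =
          if x' = x then if t = fun _ => false then
            (Pi.single (Function.extend i x fun _ => false) (1 : ℂ) : (W → Bool) → ℂ) p
            else 0 else 0 := by
        intro x' t p w
        have e₁ : bxor (Sum.elim x' (Sum.elim t p) ∘ (Sum.inr ∘ Sum.inr ∘ i))
            (Sum.elim x' (Sum.elim t p) ∘ Sum.inl) = bxor (p ∘ i) x' := rfl
        have e₂ : (Sum.elim x fun _ => false : I ⊕ (O ⊕ W) → Bool) =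
            Sum.elim x (Sum.elim (fun _ => false) fun _ => false) := by
          rw [(elim_eq_const _ _ _).2 ⟨rfl, rfl⟩]
        have e₃ := extend_bxor_eq_false_iff hi x' p
        rw [extend_inr_comp Sum.inr_injective, extend_inr,
          Circuit.copy_mulVec hk (Sum.inr_injective.comp (Sum.inr_injective.comp hi)), e₁,
          extend_inr_comp (Sum.inr_injective.comp hi), extend_inr_comp hi, e₂]
        simp only [Pi.single_apply, Sum.elim_eq_iff, e₃]
        split_ifs <;> simp_all
      have e₀ : Sum.elim x' (Sum.elim o w) ∘ (Sum.inr ∘ Sum.inr) = w := rfl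
      have e₁ : Sum.elim x' (Sum.elim o w) ∘ (Sum.inr ∘ Sum.inl) = o := rfl
      simp only [hcopy]
      change (U *ᵥ fun p => if x' = x then if bxor o (F w) = fun _ => false then _ else 0 else 0) w
        = _
      simp only [bxor_eq_false_iff, eq_comm (a := o)]
      split_ifs
      · rfl
      · exact congrFun (mulVec_zero U) w
      · exact congrFun (mulVec_zero U) w
    rw [QAlg.prob, sum_elim, Finset.sum_eq_single x]
    · rw [sum_elim, Finset.sum_eq_single z]
      · rw [← Equiv.sum_comp (Equiv.arrowCongr e (Equiv.refl Bool)), sum_elim]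
        refine Finset.sum_congr rfl fun w _ => ?_
        rw [Finset.sum_eq_single fun _ => false]
        · have := hfin x z w fun _ => false
          rw [if_pos rfl, if_pos rfl] at this
          rw [show (Equiv.arrowCongr e (Equiv.refl Bool)) (Sum.elim w fun _ => false) =
            Sum.elim w (fun _ => false) ∘ e.symm from rfl, this]
          split_ifs <;> simp_all
        · intro a _ ha
          have := hfin x z w a
          rw [if_neg ha] at this
          rw [show (Equiv.arrowCongr e (Equiv.refl Bool)) (Sum.elim w a) =
            Sum.elim w a ∘ e.symm from rfl, this]
          simp
        · simp
      · intro o _ ho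
        refine Finset.sum_eq_zero fun u _ => if_neg ho
      · simp
    · intro x' _ hx'
      rw [sum_elim]
      refine Finset.sum_eq_zero fun o _ => Finset.sum_eq_zero fun u _ => ?_
      have := hfin x' o (u ∘ e ∘ Sum.inl) (u ∘ e ∘ Sum.inr)
      rw [if_neg hx', ite_self] at this
      rw [show Sum.elim (u ∘ e ∘ Sum.inl) (u ∘ e ∘ Sum.inr) ∘ e.symm = u by
        rw [Equiv.comp_symm_eq]; exact Sum.elim_comp_inl_inr (u ∘ e)] at this
      rw [this]
      simp
    · simp

end Oracles

/-! ### Expectations -/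

section Expect
variable {Ω : Type} [Fintype Ω]

theorem expect_mono {F G : Ω → ℝ} (h : ∀ ω, F ω ≤ G ω) : expect F ≤ expect G :=
  div_le_div_of_nonneg_right (Finset.sum_le_sum fun ω _ => h ω) (Nat.cast_nonneg _)

theorem expect_add (F G : Ω → ℝ) : expect (fun ω => F ω + G ω) = expect F + expect G := by
  simp only [expect, Finset.sum_add_distrib, add_div]

theorem expect_sub (F G : Ω → ℝ) : expect (fun ω => F ω - G ω) = expect F - expect G := by
  simp only [expect, Finset.sum_sub_distrib, sub_div]

theorem expect_const_mul (c : ℝ) (F : Ω → ℝ) : expect (fun ω => c * F ω) = c * expect F := by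
  simp only [expect, ← Finset.mul_sum, mul_div_assoc]

theorem expect_mul_const (c : ℝ) (F : Ω → ℝ) : expect (fun ω => F ω * c) = expect F * c := by
  simp only [mul_comm _ c, expect_const_mul]

theorem expect_sum {ι : Type*} (s : Finset ι) (F : ι → Ω → ℝ) :
    expect (fun ω => ∑ i ∈ s, F i ω) = ∑ i ∈ s, expect (F i) := by
  simp only [expect]
  rw [Finset.sum_comm, Finset.sum_div]

theorem expect_const [Nonempty Ω] (c : ℝ) : expect (fun _ : Ω => c) = c := by
  simp [expect]

theorem abs_expect_le [Nonempty Ω] {F : Ω → ℝ} {c : ℝ} (h : ∀ ω, |F ω| ≤ c) : |expect F| ≤ c := by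
  rw [abs_le]
  constructor
  · rw [← expect_const (Ω := Ω) (-c)]; exact expect_mono fun ω => (abs_le.1 (h ω)).1
  · rw [← expect_const (Ω := Ω) c]; exact expect_mono fun ω => (abs_le.1 (h ω)).2

theorem expect_eq_zero_iff [Nonempty Ω] {F : Ω → ℝ} (h : ∀ ω, 0 ≤ F ω) :
    expect F = 0 ↔ ∀ ω, F ω = 0 := by
  have hc : (Fintype.card Ω : ℝ) ≠ 0 := by simp
  rw [expect, div_eq_zero_iff, or_iff_left hc,
    Finset.sum_eq_zero_iff_of_nonneg fun ω _ => h ω]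
  simp

theorem expect_comm {Ω' : Type} [Fintype Ω'] (F : Ω → Ω' → ℝ) :
    expect (fun ω => expect (F ω)) = expect fun ω' => expect fun ω => F ω ω' := by
  simp only [expect]
  rw [← Finset.sum_div, ← Finset.sum_div, Finset.sum_comm, div_right_comm]

/-- Convexity of the square: it turns a bound on the mean square of the cross term into one on its
mean. -/
theorem expect_sq_le (F : Ω → ℝ) : expect F ^ 2 ≤ expect fun ω => F ω ^ 2 := by
  have := sum_div_card_sq_le_sum_sq_div_card (s := (Finset.univ : Finset Ω)) (f := F)
  simpa [expect, Finset.card_univ] using this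

end Expect

/-! ### Phases -/

/-- The character `b ↦ (-1)^(r·b)`. -/
def chi {n : ℕ} (r b : Fin n → Bool) : ℂ := ∏ i, if r i && b i then -1 else 1

theorem chi_zero {n : ℕ} (b : Fin n → Bool) : chi (fun _ => false) b = 1 := by simp [chi]

theorem chi_update {n : ℕ} (r b : Fin n → Bool) (j : Fin n) (hj : r j = false) :
    chi (Function.update r j true) b = (if b j then -1 else 1) * chi r b := by
  rw [chi, chi, ← Finset.mul_prod_erase _ _ (Finset.mem_univ j),
    ← Finset.mul_prod_erase _ _ (Finset.mem_univ j)]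
  simp only [Function.update_self, Bool.true_and, hj, Bool.false_and]
  rw [if_neg (by simp : ¬(false = true)), one_mul]
  congr 1
  refine Finset.prod_congr rfl fun i hi => ?_
  rw [Function.update_of_ne (Finset.ne_of_mem_erase hi)]

/-! ### The behaviour of a prover -/

section Behaviour
variable {D : Domains} {E : ExtendedTCF D} {n l : ℕ}

/-- The wires of a prover. -/
abbrev ProverWire (E : ExtendedTCF D) (n l aux : ℕ) : Type :=
  Wire n (D.encX.W l) (Fin (E.F.w l)) (D.encY.W l) (D.encKey.W l) aux

namespace ProverAt
variable (P : ProverAt E n l)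

/-- The state before the measurement in the test round. -/
def testState (k : Fin n → D.Key l) (y : Fin n → D.encY.W l → Bool) :
    (ProverWire E n l P.aux → Bool) → ℂ :=
  Circuit.toMatrix P.test *ᵥ committedState P.commit k y

/-- The operator which maps the final state of the test round to that of the Hadamard round. -/
def attackOp : Matrix (ProverWire E n l P.aux → Bool) (ProverWire E n l P.aux → Bool) ℂ :=
  Circuit.toMatrix P.had * (Circuit.toMatrix P.test)ᴴ

theorem isUnitary_attackOp : IsUnitary P.attackOp :=
  (Circuit.isUnitary _).mul (Circuit.isUnitary _).conjTranspose

theorem attackOp_testState (k : Fin n → D.Key l) (y : Fin n → D.encY.W l → Bool) :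
    P.attackOp *ᵥ P.testState k y = Circuit.toMatrix P.had *ᵥ committedState P.commit k y := by
  rw [attackOp, testState, mulVec_mulVec, Matrix.mul_assoc, Circuit.isUnitary, Matrix.mul_one]

/-- The operator `Z^r` on the committed qubits. -/
def _root_.MeasurementProtocol.phase {aux : ℕ} (r : Fin n → Bool)
    (f : (ProverWire E n l aux → Bool) → ℂ) : (ProverWire E n l aux → Bool) → ℂ :=
  fun v => chi r (fun i => v (.committed i)) * f v

/-- The Hadamard round behaviour of the prover who applies `Z^r` to the committed qubits of the
final state of the test round, and flips the answer bits by `r`. -/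
def twisted (r : Fin n → Bool) : HadamardBehaviour E l n := fun k y b d =>
  ∑ v, if (fun i => xor (v (.committed i)) (r i)) = b ∧ (fun i j => v (.extra i j)) = d then
    ‖(P.attackOp *ᵥ phase r (P.testState k y)) v‖ ^ 2 else 0

theorem twisted_zero : P.twisted (fun _ => false) = P.hadamardBehaviour := by
  funext k y b d
  have : phase (fun _ => false) (P.testState k y) = P.testState k y := by
    funext v; rw [phase, chi_zero, one_mul]
  simp only [twisted, hadamardBehaviour, Bool.xor_false, this, attackOp_testState]

/-- The average of the twisted behaviours. -/
def averaged : HadamardBehaviour E l n := fun k y b d => expect fun r => P.twisted r k y b d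

end ProverAt

theorem committedState_eq {Pr R : Type} {a : ℕ} [Fintype Pr] [DecidableEq Pr] [Fintype R]
    [DecidableEq R] (C : Circuit (Wire n Pr R (D.encY.W l) (D.encKey.W l) a))
    (k : Fin n → D.Key l) (y : Fin n → D.encY.W l → Bool)
    (v : Wire n Pr R (D.encY.W l) (D.encKey.W l) a → Bool) :
    committedState C k y v = if (fun i j => v (.image i j)) = y then
      (Circuit.toMatrix C *ᵥ Pi.single (initial k) 1) v else 0 := by
  rw [mulVec_single_one]; rfl

theorem sum_committedState {Pr R : Type} {a : ℕ} [Fintype Pr] [DecidableEq Pr] [Fintype R]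
    [DecidableEq R] (C : Circuit (Wire n Pr R (D.encY.W l) (D.encKey.W l) a))
    (k : Fin n → D.Key l) : ∑ y, ∑ v, ‖committedState C k y v‖ ^ 2 = 1 := by
  rw [Finset.sum_comm]
  calc ∑ v, ∑ y, ‖committedState C k y v‖ ^ 2
      = ∑ v, ‖(Circuit.toMatrix C *ᵥ Pi.single (initial k) 1) v‖ ^ 2 := by
        refine Finset.sum_congr rfl fun v _ => ?_
        rw [Finset.sum_eq_single (fun i j => v (.image i j))]
        · rw [committedState_eq, if_pos rfl]
        · intro y _ hy
          rw [committedState_eq, if_neg hy.symm]; simp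
        · simp
    _ = 1 := by
        rw [(Circuit.isUnitary C).norm_mulVec, Finset.sum_eq_single (initial k)]
        · simp
        · intro v _ hv; simp [hv]
        · simp

theorem ProverAt.sum_testState (P : ProverAt E n l) (k : Fin n → D.Key l) :
    ∑ y, ∑ v, ‖P.testState k y v‖ ^ 2 = 1 := by
  rw [← sum_committedState P.commit k]
  exact Finset.sum_congr rfl fun y _ => (Circuit.isUnitary P.test).norm_mulVec _

/-- Summation over the values of two functions. -/
theorem sum_fiber {α β γ : Type} [Fintype α] [Fintype β] [DecidableEq β] [Fintype γ]
    [DecidableEq γ] (f : α → β) (g : α → γ) (w : α → ℝ) (G : β → γ → ℝ) :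
    ∑ b, ∑ d, (∑ v, if f v = b ∧ g v = d then w v else 0) * G b d =
      ∑ v, w v * G (f v) (g v) := by
  simp only [Finset.sum_mul]
  rw [Finset.sum_congr rfl fun b _ => Finset.sum_comm, Finset.sum_comm]
  refine Finset.sum_congr rfl fun v _ => ?_
  rw [Finset.sum_eq_single (f v), Finset.sum_eq_single (g v)]
  · rw [if_pos ⟨rfl, rfl⟩]
  · intro d _ hd; rw [if_neg fun h => hd h.2.symm, zero_mul]
  · simp
  · intro b _ hb
    exact Finset.sum_eq_zero fun d _ => by rw [if_neg fun h => hb h.1.symm, zero_mul]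
  · simp

theorem ProverAt.sum_testBehaviour (P : ProverAt E n l) (k : Fin n → D.Key l)
    (y : Fin n → D.encY.W l → Bool) (G : (Fin n → Bool) → (Fin n → D.encX.W l → Bool) → ℝ) :
    ∑ b, ∑ x, P.testBehaviour k y b x * G b x = ∑ v, ‖P.testState k y v‖ ^ 2 *
      G (fun i => v (.committed i)) fun i j => v (.preimage i j) :=
  sum_fiber _ _ (fun v => ‖P.testState k y v‖ ^ 2) G

/-- The final states in the test round of a perfect prover are superpositions of accepted
strings. -/
theorem ProverAt.testCheck_of_accept {P : ProverAt E n l} {h : Fin n → Bool}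
    (hP : acceptProb E P.testBehaviour h = 1) (ω : Fin n → Coins E l)
    (y : Fin n → D.encY.W l → Bool) (v : ProverWire E n l P.aux → Bool)
    (hv : P.testState (fun i => sampleKey (h i) (ω i)) y v ≠ 0) (i : Fin n) :
    testCheck (h i) (ω i) (y i) (v (.committed i)) (fun j => v (.preimage i j)) = true := by
  classical
  let acc : (Fin n → Coins E l) → (Fin n → D.encY.W l → Bool) → (Fin n → Bool) →
      (Fin n → D.encX.W l → Bool) → Prop := fun ω y b x =>
    ∀ i, testCheck (h i) (ω i) (y i) (b i) (x i) = true
  let k : (Fin n → Coins E l) → Fin n → D.Key l := fun ω i => sampleKey (h i) (ω i)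
  have h₁ : ∀ ω, (∑ y, ∑ b, ∑ x, if acc ω y b x then P.testBehaviour (k ω) y b x else 0) =
      ∑ y, ∑ v, ‖P.testState (k ω) y v‖ ^ 2 * if acc ω y (fun i => v (.committed i))
        (fun i j => v (.preimage i j)) then 1 else 0 := by
    intro ω
    refine Finset.sum_congr rfl fun y _ => ?_
    rw [← P.sum_testBehaviour (k ω) y fun b x => if acc ω y b x then 1 else 0]
    simp only [mul_ite, mul_one, mul_zero]
  -- The rejection probability is a sum of nonnegative terms, one for each commitment and each basis
  -- state. Its mean over the coins is zero, so every term vanishes for every choice of the coins.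
  have h₂ : ∀ ω, (1 - ∑ y, ∑ b, ∑ x, if acc ω y b x then P.testBehaviour (k ω) y b x else 0) =
      ∑ y, ∑ v, ‖P.testState (k ω) y v‖ ^ 2 * if acc ω y (fun i => v (.committed i))
        (fun i j => v (.preimage i j)) then 0 else 1 := by
    intro ω
    rw [h₁]
    refine sub_eq_of_eq_add ((P.sum_testState (k ω)).symm.trans ?_)
    rw [← Finset.sum_add_distrib]
    refine Finset.sum_congr rfl fun y _ => ?_
    rw [← Finset.sum_add_distrib]
    refine Finset.sum_congr rfl fun v _ => ?_
    split_ifs <;> ring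
  have h₃ : ∀ ω y v, 0 ≤ ‖P.testState (k ω) y v‖ ^ 2 * if acc ω y (fun i => v (.committed i))
        (fun i j => v (.preimage i j)) then (0 : ℝ) else 1 := by
    intro ω y v
    refine mul_nonneg (by positivity) ?_
    split_ifs <;> norm_num
  have h₄ : expect (fun ω => 1 - ∑ y, ∑ b, ∑ x,
      if acc ω y b x then P.testBehaviour (k ω) y b x else 0) = 0 := by
    rw [expect_sub, expect_const, sub_eq_zero, ← hP, acceptProb]
  rw [expect_eq_zero_iff fun ω => by
    rw [h₂]; exact Finset.sum_nonneg fun y _ => Finset.sum_nonneg fun v _ => h₃ ω y v] at h₄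
  have h₅ := h₄ ω
  rw [h₂, Finset.sum_eq_zero_iff_of_nonneg fun y _ => Finset.sum_nonneg fun v _ => h₃ ω y v] at h₅
  have h₆ := h₅ y (Finset.mem_univ y)
  rw [Finset.sum_eq_zero_iff_of_nonneg fun v _ => h₃ ω y v] at h₆
  have h₇ := h₆ v (Finset.mem_univ v)
  by_contra hne
  rw [if_neg fun h => hne (h i), mul_one] at h₇
  exact hv (by simpa using h₇)

theorem ProverAt.resultDist_twisted (P : ProverAt E n l) (r h m : Fin n → Bool) :
    resultDist (P.twisted r) h m = expect fun ω : Fin n → Coins E l => ∑ y, ∑ v,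
      ‖(P.attackOp *ᵥ phase r (P.testState (fun i => sampleKey (h i) (ω i)) y)) v‖ ^ 2 *
        ∏ i, storedProb (decode (h i) (ω i) (y i) (xor (v (.committed i)) (r i))
          fun j => v (.extra i j)) (m i) := by
  unfold resultDist
  congr 1
  funext ω
  refine Finset.sum_congr rfl fun y _ => ?_
  exact sum_fiber (fun v i => xor (v (.committed i)) (r i)) (fun v i j => v (.extra i j))
    (fun v => ‖(P.attackOp *ᵥ phase r (P.testState (fun i => sampleKey (h i) (ω i)) y)) v‖ ^ 2)
    fun b d => ∏ i, storedProb (decode (h i) (ω i) (y i) (b i) (d i)) (m i)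

theorem ProverAt.resultDist_averaged (P : ProverAt E n l) (h m : Fin n → Bool) :
    resultDist P.averaged h m = expect fun r => resultDist (P.twisted r) h m := by
  unfold resultDist
  rw [expect_comm]
  congr 1
  funext ω
  simp only [expect_sum, expect_mul_const]
  rfl

end Behaviour

/-! ### Hadamard transforms -/

section Hadamard
variable {V W : Type} [Fintype V] [DecidableEq V] [Fintype W] [DecidableEq W]

theorem inv_sqrt_two_mul_self : ((Real.sqrt 2 : ℂ))⁻¹ * (Real.sqrt 2 : ℂ)⁻¹ = 2⁻¹ := by
  rw [← mul_inv, ← Complex.ofReal_mul, Real.mul_self_sqrt (by norm_num)]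
  norm_num

/-- The Hadamard gate. -/
def hadamardGate : Matrix.unitaryGroup Bool ℂ :=
  ⟨Matrix.of fun b b' => (if b && b' then -1 else 1) / (Real.sqrt 2 : ℂ), by
    rw [Matrix.mem_unitaryGroup_iff]
    ext b b'
    have h := inv_sqrt_two_mul_self
    cases b <;> cases b' <;>
      simp [Matrix.mul_apply, star_eq_conjTranspose, conjTranspose_apply, div_eq_mul_inv, h] <;>
      norm_num⟩

theorem hadamardOn_insert {q : W} {s : Finset W} (hq : q ∉ s) :
    hadamardOn (insert q s) = (Gate.single q hadamardGate).toMatrix * hadamardOn s := by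
  ext v v'
  have : ((Gate.single q hadamardGate).toMatrix * hadamardOn s) v v' =
      ((Gate.single q hadamardGate).toMatrix *ᵥ fun u => hadamardOn s u v') v := rfl
  rw [this, Gate.single_mulVec, Finset.sum_eq_single (v' q)]
  · have h₁ : (∀ q', q' ∉ insert q s → v q' = v' q') ↔
        ∀ q', q' ∉ s → Function.update v q (v' q) q' = v' q' := by
      refine forall_congr' fun q' => ?_
      by_cases h : q' = q
      · subst h; simp
      · simp [h]
    simp only [hadamardOn, Matrix.of_apply, h₁]
    split_ifs
    · rw [Finset.prod_insert hq]
      congr 1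
      refine Finset.prod_congr rfl fun q' hq' => ?_
      rw [Function.update_of_ne fun h => hq (by rwa [h] at hq')]
    · simp
  · intro b _ hb
    rw [hadamardOn, Matrix.of_apply, if_neg, mul_zero]
    intro h
    exact hb (by simpa using h q hq)
  · simp

theorem hadamardOn_empty : hadamardOn (∅ : Finset W) = 1 := by
  ext v v'
  simp [hadamardOn, Matrix.one_apply, funext_iff]

/-- The Hadamard gates on a set of qubits. -/
def Circuit.hadamard (L : List W) : Circuit W := L.reverse.map fun q => .single q hadamardGate

theorem Circuit.toMatrix_hadamard (L : List W) (hL : L.Nodup) :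
    Circuit.toMatrix (Circuit.hadamard L) = hadamardOn L.toFinset := by
  induction L with
  | nil => simp [Circuit.hadamard, Circuit.toMatrix_nil, hadamardOn_empty]
  | cons q L ih =>
    rw [List.toFinset_cons, hadamardOn_insert (by simpa using (List.nodup_cons.1 hL).1),
      ← ih (List.nodup_cons.1 hL).2, Circuit.hadamard, List.reverse_cons, List.map_append,
      Circuit.toMatrix_append, List.map_singleton, Circuit.toMatrix_singleton]
    rfl

theorem Circuit.toMatrix_hadamard_toList (s : Finset W) :
    Circuit.toMatrix (Circuit.hadamard s.toList) = hadamardOn s := by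
  rw [Circuit.toMatrix_hadamard _ s.nodup_toList, Finset.toList_toFinset]

theorem Circuit.length_hadamard (s : Finset W) :
    (Circuit.hadamard s.toList).length = s.card := by
  simp [Circuit.hadamard]

theorem hadamardOn_conjTranspose (s : Finset W) : (hadamardOn s)ᴴ = hadamardOn s := by
  ext v v'
  have : (∀ q, q ∉ s → v' q = v q) ↔ ∀ q, q ∉ s → v q = v' q :=
    forall₂_congr fun q _ => eq_comm
  simp only [hadamardOn, conjTranspose_apply, Matrix.of_apply, this, Complex.star_def]
  split_ifs
  · rw [map_prod]
    refine Finset.prod_congr rfl fun q _ => ?_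
    rw [map_div₀, Complex.conj_ofReal, Bool.and_comm]
    split_ifs <;> simp
  · simp

theorem hadamardOn_mul_self (s : Finset W) : hadamardOn s * hadamardOn s = 1 := by
  have := Circuit.isUnitary (Circuit.hadamard s.toList)
  rw [IsUnitary, Circuit.toMatrix_hadamard_toList, hadamardOn_conjTranspose] at this
  exact this

theorem hadamardOn_union {s t : Finset W} (h : Disjoint s t) :
    hadamardOn (s ∪ t) = hadamardOn s * hadamardOn t := by
  induction s using Finset.induction_on with
  | empty => simp [hadamardOn_empty]
  | insert q s hq ih =>
    rw [Finset.disjoint_insert_left] at h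
    rw [Finset.insert_union, hadamardOn_insert (by simp [hq, h.1]), hadamardOn_insert hq, ih h.2,
      Matrix.mul_assoc]

theorem hadamardOn_map {ι : V → W} (hι : Function.Injective ι) :
    hadamardOn (Finset.univ.image ι) = lift ι (hadamardOn Finset.univ) := by
  ext v v'
  have h : (∀ q, q ∉ Finset.univ.image ι → v q = v' q) ↔ v = Function.extend ι (v ∘ ι) v' := by
    constructor
    · intro h
      funext q
      by_cases hq : ∃ a, ι a = q
      · obtain ⟨a, rfl⟩ := hq; rw [hι.extend_apply]; rfl
      · rw [Function.extend_apply' _ _ _ hq]; exact h q (by simpa using hq)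
    · intro h q hq
      rw [h, Function.extend_apply' _ _ _ (by simpa using hq)]
  simp only [hadamardOn, lift, Matrix.of_apply, h]
  split_ifs
  · rw [Finset.prod_image fun a _ b _ hab => hι hab]; rfl
  · exact absurd (fun q hq => absurd (Finset.mem_univ q) hq) ‹¬_›
  · rfl

theorem hadamardOn_mulVec {n : ℕ} {ι : Fin n → W} (hι : Function.Injective ι)
    (f : (W → Bool) → ℂ) (z : W → Bool) :
    (hadamardOn (Finset.univ.image ι) *ᵥ f) z =
      ((Real.sqrt 2 : ℂ)⁻¹ ^ n) * ∑ b, chi (z ∘ ι) b * f (Function.extend ι b z) := by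
  rw [hadamardOn_map hι, lift_mulVec hι, mulVec, dotProduct, Finset.mul_sum]
  refine Finset.sum_congr rfl fun b _ => ?_
  rw [hadamardOn, Matrix.of_apply, if_pos (by simp), Finset.prod_div_distrib, chi,
    Finset.prod_const, Finset.card_univ, Fintype.card_fin, div_eq_mul_inv, inv_pow]
  ring

theorem norm_inv_sqrt_two_pow (n : ℕ) : ‖((Real.sqrt 2 : ℂ)⁻¹ ^ n)‖ ^ 2 = ((2 : ℝ) ^ n)⁻¹ := by
  rw [norm_pow, norm_inv, Complex.norm_real, Real.norm_of_nonneg (Real.sqrt_nonneg 2), ← pow_mul,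
    mul_comm, pow_mul, inv_pow, Real.sq_sqrt (by norm_num), inv_pow]

end Hadamard

/-! ### Relabelling of the qubits -/

theorem extend_equiv {V W : Type} (e : V ≃ W) (p : V → Bool) (z : W → Bool) :
    Function.extend e p z = p ∘ e.symm := by
  funext a
  obtain ⟨b, rfl⟩ := e.surjective a
  rw [e.injective.extend_apply]; simp

theorem lift_equiv_mulVec {V W : Type} [Fintype V] [DecidableEq V] [Fintype W] [DecidableEq W]
    (e : V ≃ W) (M : Matrix (V → Bool) (V → Bool) ℂ) (g : (V → Bool) → ℂ) :
    lift e M *ᵥ (fun z => g (z ∘ e)) = fun z => (M *ᵥ g) (z ∘ e) := by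
  funext z
  rw [lift_mulVec e.injective]
  simp only [extend_equiv]
  refine congrArg (fun g => (M *ᵥ g) (z ∘ e)) (funext fun p => congrArg g ?_)
  funext a; simp

theorem sum_comp_equiv {V W : Type} [Fintype V] [DecidableEq V] [Fintype W] [DecidableEq W]
    (e : V ≃ W) (g : (V → Bool) → ℝ) : ∑ z : W → Bool, g (z ∘ e) = ∑ p, g p :=
  Equiv.sum_comp (Equiv.arrowCongr e.symm (Equiv.refl Bool)) g

/-! ### The prover whose behaviour is the averaged one -/

section Averaged
variable {D : Domains} {E : ExtendedTCF D} {n l : ℕ}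

/-- `m` further auxiliary qubits. -/
def wireSplit (E : ExtendedTCF D) (n l a m : ℕ) :
    ProverWire E n l a ⊕ Fin m ≃ ProverWire E n l (a + m) where
  toFun
    | .inl (.committed i) => .committed i
    | .inl (.preimage i j) => .preimage i j
    | .inl (.extra i j) => .extra i j
    | .inl (.image i j) => .image i j
    | .inl (.key i j) => .key i j
    | .inl (.aux j) => .aux (j.castAdd m)
    | .inr j => .aux (j.natAdd a)
  invFun
    | .committed i => .inl (.committed i)
    | .preimage i j => .inl (.preimage i j)
    | .extra i j => .inl (.extra i j)
    | .image i j => .inl (.image i j)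
    | .key i j => .inl (.key i j)
    | .aux j => Fin.addCases (fun j => .inl (.aux j)) .inr j
  left_inv := by
    rintro ((_ | _ | _ | _ | _ | _) | _) <;> simp
  right_inv := by
    rintro (_ | _ | _ | _ | _ | j) <;> try rfl
    refine Fin.addCases (fun j => ?_) (fun j => ?_) j <;> simp

namespace ProverAt
variable (P : ProverAt E n l)

/-- The wires of the averaged prover. -/
abbrev split : ProverWire E n l P.aux ⊕ Fin n ≃ ProverWire E n l (P.aux + n) :=
  wireSplit E n l P.aux n

/-- The Hadamard round circuit of the averaged prover. -/
def averagedHad : Circuit (ProverWire E n l P.aux ⊕ Fin n) :=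
  Circuit.map Sum.inl Sum.inl_injective P.test ++
    (Circuit.copy (fun i => Sum.inl (.committed i)) Sum.inr (by simp) ++
    (Circuit.map Sum.inl Sum.inl_injective (Circuit.inv P.test ++ P.had) ++
    (Circuit.hadamard (Finset.univ.image Sum.inr).toList ++
      Circuit.copy Sum.inr (fun i => Sum.inl (.committed i)) (by simp))))

/-- A circuit of the prover, on the wires of the averaged prover. -/
def widen (C : Circuit (ProverWire E n l P.aux)) : Circuit (ProverWire E n l (P.aux + n)) :=
  Circuit.map P.split P.split.injective (Circuit.map Sum.inl Sum.inl_injective C)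

theorem widen_mulVec (C : Circuit (ProverWire E n l P.aux))
    (f : (ProverWire E n l P.aux → Bool) → ℂ) :
    Circuit.toMatrix (P.widen C) *ᵥ (fun z => padZero (Fin n) f (z ∘ P.split)) =
      fun z => padZero (Fin n) (Circuit.toMatrix C *ᵥ f) (z ∘ P.split) := by
  rw [widen, Circuit.toMatrix_map, lift_equiv_mulVec, Circuit.toMatrix_map, lift_inl_padZero]

/-- The prover with the averaged Hadamard round behaviour. -/
def average : ProverAt E n l where
  aux := P.aux + n
  commit := P.widen P.commit
  test := P.widen P.test
  had := Circuit.map P.split P.split.injective P.averagedHad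

theorem average_committedState (k : Fin n → D.Key l) (y : Fin n → D.encY.W l → Bool) :
    committedState (P.widen P.commit) k y =
      fun z => padZero (Fin n) (committedState P.commit k y) (z ∘ P.split) := by
  funext z
  rw [committedState_eq]
  have h₁ : (Pi.single (initial k) (1 : ℂ) : (ProverWire E n l (P.aux + n) → Bool) → ℂ) =
      fun z => padZero (Fin n) (Pi.single (initial k) 1) (z ∘ P.split) := by
    funext z
    rw [padZero]
    simp only [Pi.single_apply]
    have : z = initial k ↔ (z ∘ P.split) ∘ Sum.inr = (fun _ => false) ∧
        (z ∘ P.split) ∘ Sum.inl = initial k := by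
      have : z = initial k ↔ z ∘ P.split = Sum.elim (initial k) fun _ => false := by
        rw [← Equiv.eq_comp_symm]
        refine iff_of_eq (congrArg _ ?_)
        rw [Equiv.eq_comp_symm]
        funext q
        rcases q with (_ | _ | _ | _ | _ | _) | _ <;> rfl
      rw [this]
      conv_lhs => rw [← Sum.elim_comp_inl_inr (z ∘ P.split)]
      rw [Sum.elim_eq_iff, and_comm]
    simp only [this]
    split_ifs <;> simp_all
  rw [h₁, widen_mulVec]
  simp only [padZero, committedState_eq]
  have : (fun i j => ((z ∘ P.split) ∘ Sum.inl) (.image i j)) = fun i j => z (.image i j) := rfl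
  rw [this]
  split_ifs <;> rfl

theorem average_testBehaviour : P.average.testBehaviour = P.testBehaviour := by
  funext k y b x
  change (∑ v : ProverWire E n l (P.aux + n) → Bool, if (fun i => v (.committed i)) = b ∧
    (fun i j => v (.preimage i j)) = x then ‖(Circuit.toMatrix (P.widen P.test) *ᵥ
      committedState (P.widen P.commit) k y) v‖ ^ 2 else 0) = _
  rw [average_committedState, widen_mulVec]
  refine (sum_comp_equiv P.split fun v => if (fun i => v (.inl (.committed i))) = b ∧
    (fun i j => v (.inl (.preimage i j))) = x then
      ‖padZero (Fin n) (Circuit.toMatrix P.test *ᵥ committedState P.commit k y) v‖ ^ 2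
      else 0).trans ?_
  rw [sum_elim]
  refine Finset.sum_congr rfl fun p _ => ?_
  rw [Finset.sum_eq_single fun _ => false]
  · rw [padZero_elim, if_pos rfl]; rfl
  · intro e _ he
    rw [padZero_elim, if_neg he]; simp
  · simp

/-- The exclusive or with `r` on the committed qubits. -/
def _root_.MeasurementProtocol.flipCommitted {aux : ℕ} (r : Fin n → Bool)
    (p : ProverWire E n l aux → Bool) : ProverWire E n l aux → Bool :=
  Function.extend (fun i => .committed i) (bxor (fun i => p (.committed i)) r) p

theorem _root_.MeasurementProtocol.committed_injective {Pr R Y K : Type} {aux : ℕ} :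
    Function.Injective fun i : Fin n => (.committed i : Wire n Pr R Y K aux) :=
  fun i j h => by injection h

theorem _root_.MeasurementProtocol.involutive_flipCommitted {aux : ℕ} (r : Fin n → Bool) :
    Function.Involutive (flipCommitted (E := E) (l := l) (aux := aux) r) := by
  intro p
  have h : (fun i => flipCommitted r p (.committed i)) = bxor (fun i => p (.committed i)) r :=
    extend_comp' committed_injective _ _
  rw [flipCommitted, h, flipCommitted, extend_extend' committed_injective, bxor_bxor_self]
  exact extend_self' committed_injective p

/-- Copying the committed qubits to fresh ones and measuring these in the Hadamard basis gives a
uniform `r` and applies `Z^r` to the state before the attack. The last CNOT gates add the same `r`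
to the answers. -/
theorem averagedHad_mulVec (k : Fin n → D.Key l) (y : Fin n → D.encY.W l → Bool)
    (p : ProverWire E n l P.aux → Bool) (r : Fin n → Bool) :
    (Circuit.toMatrix P.averagedHad *ᵥ padZero (Fin n) (committedState P.commit k y))
      (Sum.elim p r) = (Real.sqrt 2 : ℂ)⁻¹ ^ n *
        (P.attackOp *ᵥ phase r (P.testState k y)) (flipCommitted r p) := by
  have hc : Function.Injective fun i : Fin n =>
      (Sum.inl (.committed i) : ProverWire E n l P.aux ⊕ Fin n) :=
    Sum.inl_injective.comp committed_injective
  simp only [averagedHad, Circuit.toMatrix_append, ← mulVec_mulVec, Circuit.toMatrix_map,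
    lift_inl_padZero, Circuit.toMatrix_hadamard_toList]
  rw [Circuit.copy_mulVec _ hc, show Function.extend (fun i : Fin n =>
    (Sum.inl (.committed i) : ProverWire E n l P.aux ⊕ Fin n)) (bxor (Sum.elim p r ∘ fun i =>
      Sum.inl (.committed i)) (Sum.elim p r ∘ Sum.inr)) (Sum.elim p r) =
      Sum.elim (flipCommitted r p) r from extend_inl_comp committed_injective _ _ _,
    hadamardOn_mulVec Sum.inr_injective, Sum.elim_comp_inr]
  congr 1
  simp only [extend_inr]
  -- Before the Hadamard gates, the value `b` of the fresh register selects the part of the test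
  -- state with committed bits `b`; summing these parts with the characters of `r` restores the
  -- phase.
  have h₂ : ∀ b : Fin n → Bool, (lift Sum.inl (Circuit.toMatrix P.had *
      Circuit.toMatrix (Circuit.inv P.test)) *ᵥ (Circuit.toMatrix (Circuit.copy
        (fun i : Fin n => (Sum.inl (.committed i) : ProverWire E n l P.aux ⊕ Fin n)) Sum.inr
          (by simp)) *ᵥ padZero (Fin n) (Circuit.toMatrix P.test *ᵥ committedState P.commit k y)))
      (Sum.elim (flipCommitted r p) b) = (P.attackOp *ᵥ fun p' =>
        if b = fun i => p' (.committed i) then P.testState k y p' else 0) (flipCommitted r p) := by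
    intro b
    rw [lift_mulVec Sum.inl_injective, Sum.elim_comp_inl, Circuit.toMatrix_inv]
    refine congrArg (fun g => (_ *ᵥ g) (flipCommitted r p)) (funext fun p' => ?_)
    rw [extend_inl, Circuit.copy_mulVec _ Sum.inr_injective, extend_inr, padZero_elim,
      Sum.elim_comp_inr]
    simp only [bxor_eq_false_iff]
    rfl
  rw [Finset.sum_congr rfl fun b _ => by rw [h₂ b]]
  simp only [mulVec, dotProduct, Finset.mul_sum]
  rw [Finset.sum_comm]
  refine Finset.sum_congr rfl fun p' _ => ?_
  rw [Finset.sum_eq_single fun i => p' (.committed i)]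
  · rw [if_pos rfl, phase]; ring
  · intro b _ hb; rw [if_neg hb]; simp
  · simp

theorem average_hadamardBehaviour : P.average.hadamardBehaviour = P.averaged := by
  funext k y b d
  change (∑ v : ProverWire E n l (P.aux + n) → Bool, if (fun i => v (.committed i)) = b ∧
    (fun i j => v (.extra i j)) = d then ‖(Circuit.toMatrix (Circuit.map P.split P.split.injective
      P.averagedHad) *ᵥ committedState (P.widen P.commit) k y) v‖ ^ 2 else 0) = _
  rw [average_committedState, Circuit.toMatrix_map, lift_equiv_mulVec]
  refine (sum_comp_equiv P.split fun v => if (fun i => v (.inl (.committed i))) = b ∧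
    (fun i j => v (.inl (.extra i j))) = d then
      ‖(Circuit.toMatrix P.averagedHad *ᵥ padZero (Fin n) (committedState P.commit k y)) v‖ ^ 2
      else 0).trans ?_
  rw [sum_elim, Finset.sum_comm, averaged, expect, Finset.sum_div]
  refine Finset.sum_congr rfl fun r _ => ?_
  rw [twisted, Finset.sum_div]
  -- For fixed `r`, the basis states before and after the addition of `r` to the committed qubits
  -- correspond bijectively.
  refine Fintype.sum_equiv (involutive_flipCommitted r).toPerm _ _ fun p => ?_
  have hf : (fun i => xor (flipCommitted r p (.committed i)) (r i)) =
      fun i => p (.committed i) := by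
    have h : (fun i => flipCommitted r p (.committed i)) = bxor (fun i => p (.committed i)) r :=
      extend_comp' committed_injective _ _
    funext i
    rw [congrFun h i]; simp [bxor]
  have he : (fun i j => flipCommitted r p (.extra i j)) = fun i j => p (.extra i j) := by
    funext i j
    exact Function.extend_apply' _ _ _ (by simp)
  rw [averagedHad_mulVec]
  simp only [Function.Involutive.coe_toPerm, hf, he, Sum.elim_inl]
  by_cases h : (fun i => p (.committed i)) = b ∧ (fun i j => p (.extra i j)) = d
  · rw [if_pos h]
    refine (if_pos h).trans ?_
    rw [norm_mul, mul_pow, norm_inv_sqrt_two_pow]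
    simp [div_eq_inv_mul]
  · rw [if_neg h, zero_div]
    exact if_neg h

end ProverAt
end Averaged

/-! ### Operators which fix the value of a qubit -/

section Fixes
variable {V W κ : Type} [Fintype V] [DecidableEq V] [Fintype W] [DecidableEq W]
  [Fintype κ] [DecidableEq κ]

/-- `M` is block diagonal with respect to the value of the qubit `q`. -/
def Fixes (q : W) (M : Matrix (W → Bool) (W → Bool) ℂ) : Prop :=
  ∀ v v', M v v' ≠ 0 → v q = v' q

theorem Fixes.mul {q : W} {M N : Matrix (W → Bool) (W → Bool) ℂ} (hM : Fixes q M)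
    (hN : Fixes q N) : Fixes q (M * N) := by
  intro v v' h
  rw [Matrix.mul_apply] at h
  obtain ⟨u, _, hu⟩ := Finset.exists_ne_zero_of_sum_ne_zero h
  exact (hM v u (left_ne_zero_of_mul hu)).trans (hN u v' (right_ne_zero_of_mul hu))

theorem Fixes.lift {q : W} {ι : V → W} (hq : ∀ a, ι a ≠ q)
    (M : Matrix (V → Bool) (V → Bool) ℂ) : Fixes q (lift ι M) := by
  intro v v' h
  rw [MeasurementProtocol.lift, Matrix.of_apply] at h
  rw [(ite_ne_right_iff.1 h).1, Function.extend_apply' _ _ _ fun ⟨a, ha⟩ => hq a ha]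

theorem Fixes.of_mulVec {q : W} {M : Matrix (W → Bool) (W → Bool) ℂ} {c : (W → Bool) → ℂ}
    {g : (W → Bool) → W → Bool} (hM : ∀ f z, (M *ᵥ f) z = c z * f (g z))
    (hg : ∀ z, g z q = z q) : Fixes q M := by
  intro v v' h
  have h₁ : M v v' = (M *ᵥ Pi.single v' 1) v := by rw [mulVec_single_one]; rfl
  rw [h₁, hM, Pi.single_apply] at h
  rw [← hg v]
  by_contra hne
  exact h (by rw [if_neg fun h' => hne (congrFun h' q), mul_zero])

theorem Fixes.copy {q : W} {src dst : κ → W} (h : ∀ a b, src a ≠ dst b)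
    (hd : Function.Injective dst) (hq : ∀ a, dst a ≠ q) :
    Fixes q (Circuit.toMatrix (Circuit.copy src dst h)) :=
  Fixes.of_mulVec (c := fun _ => 1) (fun f z => by rw [Circuit.copy_mulVec h hd, one_mul])
    fun z => Function.extend_apply' _ _ _ fun ⟨a, ha⟩ => hq a ha

theorem Fixes.hadamardOn {q : W} {s : Finset W} (hq : q ∉ s) : Fixes q (hadamardOn s) := by
  intro v v' h
  rw [MeasurementProtocol.hadamardOn, Matrix.of_apply] at h
  exact (ite_ne_right_iff.1 h).1 q hq

end Fixes

/-! ### Controlled phases -/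

section ControlledPhase
variable {W : Type} [Fintype W] [DecidableEq W] {n : ℕ}

/-- The controlled phase gate. -/
def Circuit.cz (c t : W) (h : c ≠ t) : Circuit W :=
  [.single t hadamardGate, .cnot c t h, .single t hadamardGate]

theorem Circuit.cz_mulVec (c t : W) (h : c ≠ t) (f : (W → Bool) → ℂ) (z : W → Bool) :
    (Circuit.toMatrix (Circuit.cz c t h) *ᵥ f) z = (if z c && z t then -1 else 1) * f z := by
  have hs := inv_sqrt_two_mul_self
  have h₀ : ∀ b, z t = b → Function.update z t b = z := by rintro b rfl; simp
  rw [Circuit.cz, Circuit.toMatrix_cons, Circuit.toMatrix_cons, Circuit.toMatrix_singleton,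
    ← mulVec_mulVec, ← mulVec_mulVec, Gate.single_mulVec]
  simp only [Gate.toMatrix_cnot, basisMap_mulVec (involutive_cnot c t h), Gate.single_mulVec,
    Function.update_self, Function.update_of_ne h, Function.update_idem, Fintype.sum_bool,
    hadamardGate, Matrix.of_apply]
  cases hc : z c <;> cases ht : z t <;> simp [div_eq_mul_inv, h₀ _ ht] <;>
    first
    | linear_combination (2 * f z) * hs
    | linear_combination (-2 * f z) * hs

/-- Controlled phase gates on pairs of qubits. -/
def Circuit.czs (c t : Fin n → W) (h : ∀ i, c i ≠ t i) : Circuit W :=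
  (List.finRange n).flatMap fun i => Circuit.cz (c i) (t i) (h i)

theorem Circuit.length_czs (c t : Fin n → W) (h : ∀ i, c i ≠ t i) :
    (Circuit.czs c t h).length = n * 3 := by
  simp [Circuit.czs, Circuit.cz, List.length_flatMap]

theorem Circuit.czs_mulVec (c t : Fin n → W) (h : ∀ i, c i ≠ t i) (f : (W → Bool) → ℂ)
    (z : W → Bool) :
    (Circuit.toMatrix (Circuit.czs c t h) *ᵥ f) z = chi (z ∘ c) (z ∘ t) * f z := by
  have key : ∀ (L : List (Fin n)) f, (Circuit.toMatrix (L.flatMap fun i =>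
      Circuit.cz (c i) (t i) (h i)) *ᵥ f) z =
        (L.map fun i => if z (c i) && z (t i) then (-1 : ℂ) else 1).prod * f z := by
    intro L
    induction L with
    | nil => intro f; simp [Circuit.toMatrix_nil]
    | cons i L ih =>
      intro f
      rw [List.flatMap_cons, Circuit.toMatrix_append, ← mulVec_mulVec, ih, Circuit.cz_mulVec,
        List.map_cons, List.prod_cons]
      ring
  rw [Circuit.czs, key, chi, ← List.prod_ofFn, List.ofFn_eq_map]
  rfl

end ControlledPhase

/-! ### Channels given by unitaries -/

section UnitaryChannel
variable {W : Type} [Fintype W] [DecidableEq W]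

theorem Impl.exists_circuit {s : ℕ} {U : Matrix (W → Bool) (W → Bool) ℂ} (h : Impl s U) :
    ∃ (a : ℕ) (C : Circuit (W ⊕ Fin a)), a ≤ s ∧ C.length ≤ s ∧
      ∀ f, Circuit.toMatrix C *ᵥ padZero (Fin a) f = padZero (Fin a) (U *ᵥ f) := by
  obtain ⟨A, _, _, C, h₁, h₂, h₃⟩ := h
  let e : W ⊕ A ≃ W ⊕ Fin (Fintype.card A) := Equiv.sumCongr (Equiv.refl W) (Fintype.equivFin A)
  have hp : ∀ f : (W → Bool) → ℂ,
      padZero (Fin (Fintype.card A)) f = fun z => padZero A f (z ∘ e) := by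
    intro f
    refine sum_ext fun z a => ?_
    have : Sum.elim z a ∘ e = Sum.elim z (a ∘ Fintype.equivFin A) := by
      funext q; rcases q with q | q <;> rfl
    rw [this, padZero_elim, padZero_elim]
    refine if_congr ?_ rfl rfl
    rw [← Equiv.eq_comp_symm]
    rfl
  refine ⟨Fintype.card A, Circuit.map e e.injective C, h₁, by rwa [Circuit.length_map],
    fun f => ?_⟩
  rw [hp, hp, Circuit.toMatrix_map, lift_equiv_mulVec, h₃]

/-- The ancillas return to zero, so the state is a product after the circuit and only one term of
the partial trace survives. -/
theorem channel_eq {a : ℕ} {C : Circuit (W ⊕ Fin a)} {U : Matrix (W → Bool) (W → Bool) ℂ}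
    (h : ∀ f, Circuit.toMatrix C *ᵥ padZero (Fin a) f = padZero (Fin a) (U *ᵥ f))
    (ρ : Matrix (W → Bool) (W → Bool) ℂ) : channel C ρ = U * ρ * Uᴴ := by
  let B : Matrix (W ⊕ Fin a → Bool) (W → Bool) ℂ :=
    Matrix.of fun u z => if u = Sum.elim z fun _ => false then 1 else 0
  have hB : ∀ f, B *ᵥ f = padZero (Fin a) f := by
    intro f
    refine sum_ext fun z e => ?_
    rw [padZero_elim, mulVec, dotProduct, Finset.sum_eq_single z]
    · simp [B, Sum.elim_eq_iff]
    · intro z' _ hz'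
      simp [B, Sum.elim_eq_iff, hz'.symm]
    · simp
  -- `B` is the isometry that appends zeros, and the hypothesis on the circuit is that it
  -- intertwines `U` with the circuit.
  have hCB : Circuit.toMatrix C * B = B * U := ext_iff_mulVec.2 fun f => by
    rw [← mulVec_mulVec, ← mulVec_mulVec, hB, hB, h]
  have hρ : (Matrix.of fun u u' : W ⊕ Fin a → Bool =>
      if (∀ e, u (.inr e) = false) ∧ (∀ e, u' (.inr e) = false) then
        ρ (fun i => u (.inl i)) (fun i => u' (.inl i)) else 0) = B * ρ * Bᴴ := by
    ext u u'
    have key : ∀ (g : (W → Bool) → ℂ) (u : W ⊕ Fin a → Bool), ∑ z, B u z * g z =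
        if ∀ e, u (.inr e) = false then g (fun i => u (.inl i)) else 0 := by
      intro g u
      have := congrFun (hB g) u
      rw [mulVec, dotProduct, padZero] at this
      rw [this]
      exact if_congr funext_iff rfl rfl
    have hreal : ∀ u z, star (B u z) = B u z := by
      intro u z; simp only [B, Matrix.of_apply]; split_ifs <;> simp
    simp only [Matrix.of_apply, Matrix.mul_apply (M := B * ρ), conjTranspose_apply, hreal]
    rw [Finset.sum_congr rfl fun z _ => mul_comm _ _, key, Matrix.mul_apply, key]
    split_ifs <;> simp_all
  ext v v'
  unfold channel
  simp only [hρ, Matrix.of_apply]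
  have hmul : Circuit.toMatrix C * (B * ρ * Bᴴ) * (Circuit.toMatrix C)ᴴ =
      B * (U * ρ * Uᴴ) * Bᴴ := by
    calc _ = (Circuit.toMatrix C * B) * ρ * (Circuit.toMatrix C * B)ᴴ := by
          rw [conjTranspose_mul]; simp only [Matrix.mul_assoc]
      _ = _ := by rw [hCB, conjTranspose_mul]; simp only [Matrix.mul_assoc]
  rw [hmul, Finset.sum_eq_single fun _ => false]
  · simp [Matrix.mul_apply, B, Sum.elim_eq_iff]
  · intro e _ he
    simp [Matrix.mul_apply, B, Sum.elim_eq_iff, he]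
  · simp

theorem conj_vecMulVec_apply (A : Matrix (W → Bool) (W → Bool) ℂ) (ψ : (W → Bool) → ℂ)
    (v : W → Bool) : ((A * Matrix.vecMulVec ψ (star ψ) * Aᴴ) v v).re = ‖(A *ᵥ ψ) v‖ ^ 2 := by
  rw [Matrix.mul_vecMulVec, Matrix.vecMulVec_mul, ← star_mulVec, Matrix.vecMulVec_apply,
    Pi.star_apply, Complex.star_def, Complex.mul_conj, Complex.ofReal_re, Complex.normSq_eq_norm_sq]

end UnitaryChannel

/-! ### Assignments of the registers -/

section Assign
variable {n N : ℕ} {Pr R Y K V : Type} [Fintype Pr] [DecidableEq Pr] [Fintype R] [DecidableEq R]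
  [Fintype Y] [DecidableEq Y] [Fintype K] [DecidableEq K] [Fintype V] [DecidableEq V]

/-- The assignment with given values of all the registers, the auxiliary qubits being labelled
by `V`. -/
def assign (e : V ≃ Fin N) (c : Fin n → Bool) (x : Fin n → Pr → Bool) (r : Fin n → R → Bool)
    (y : Fin n → Y → Bool) (k : Fin n → K → Bool) (p : V → Bool) : Wire n Pr R Y K N → Bool
  | .committed i => c i
  | .preimage i j => x i j
  | .extra i j => r i j
  | .image i j => y i j
  | .key i j => k i j
  | .aux j => p (e.symm j)

variable (e : V ≃ Fin N)

theorem exists_assign (v : Wire n Pr R Y K N → Bool) :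
    ∃ c x r y k p, v = assign e c x r y k p :=
  ⟨fun i => v (.committed i), fun i j => v (.preimage i j), fun i j => v (.extra i j),
    fun i j => v (.image i j), fun i j => v (.key i j), fun q => v (.aux (e q)), by
      funext q; cases q <;> simp [assign]⟩

theorem assign_inj (c c' : Fin n → Bool) (x x' : Fin n → Pr → Bool) (r r' : Fin n → R → Bool)
    (y y' : Fin n → Y → Bool) (k k' : Fin n → K → Bool) (p p' : V → Bool) :
    assign e c x r y k p = assign e c' x' r' y' k' p' ↔
      c = c' ∧ x = x' ∧ r = r' ∧ y = y' ∧ k = k' ∧ p = p' := by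
  constructor
  · intro h
    refine ⟨funext fun i => congrFun h (.committed i), ?_, ?_, ?_, ?_, ?_⟩
    · exact funext fun i => funext fun j => congrFun h (.preimage i j)
    · exact funext fun i => funext fun j => congrFun h (.extra i j)
    · exact funext fun i => funext fun j => congrFun h (.image i j)
    · exact funext fun i => funext fun j => congrFun h (.key i j)
    · funext q; simpa [assign] using congrFun h (.aux (e q))
  · rintro ⟨rfl, rfl, rfl, rfl, rfl, rfl⟩; rfl

theorem extend_eq_of {V W : Type} {ι : V → W} (hι : Function.Injective ι) {p : V → Bool}
    {z z' : W → Bool} (h₁ : ∀ a, z' (ι a) = p a) (h₂ : ∀ q, (∀ a, ι a ≠ q) → z' q = z q) :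
    Function.extend ι p z = z' := by
  funext q
  by_cases h : ∃ a, ι a = q
  · obtain ⟨a, rfl⟩ := h; rw [hι.extend_apply, h₁]
  · rw [Function.extend_apply' _ _ _ h, h₂ q fun a ha => h ⟨a, ha⟩]

/-- The auxiliary qubits. -/
def auxWire (n : ℕ) (Pr R Y K : Type) (e : V ≃ Fin N) : V → Wire n Pr R Y K N := fun q => .aux (e q)

/-- The preimage registers. -/
def preimageWire (R Y K : Type) (N : ℕ) : Fin n × Pr → Wire n Pr R Y K N :=
  fun a => .preimage a.1 a.2

/-- The commitment string registers. -/
def imageWire (Pr R K : Type) (N : ℕ) : Fin n × Y → Wire n Pr R Y K N := fun a => .image a.1 a.2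

/-- The key registers. -/
def keyWire (Pr R Y : Type) (N : ℕ) : Fin n × K → Wire n Pr R Y K N := fun a => .key a.1 a.2

/-- The further registers. -/
def extraWire (Pr Y K : Type) (N : ℕ) : Fin n × R → Wire n Pr R Y K N := fun a => .extra a.1 a.2

/-- The committed qubits. -/
def committedWire (n : ℕ) (Pr R Y K : Type) (N : ℕ) : Fin n → Wire n Pr R Y K N :=
  fun i => .committed i

theorem auxWire_injective : Function.Injective (auxWire n Pr R Y K e) := fun a b h => by
  simpa [auxWire] using h

theorem preimageWire_injective :
    Function.Injective (preimageWire R Y K N : Fin n × Pr → _) := fun a b h => by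
  simpa [preimageWire, Prod.ext_iff] using h

theorem imageWire_injective :
    Function.Injective (imageWire Pr R K N : Fin n × Y → _) := fun a b h => by
  simpa [imageWire, Prod.ext_iff] using h

theorem keyWire_injective :
    Function.Injective (keyWire Pr R Y N : Fin n × K → _) := fun a b h => by
  simpa [keyWire, Prod.ext_iff] using h

theorem committedWire_injective : Function.Injective (committedWire n Pr R Y K N) :=
  committed_injective

variable (c : Fin n → Bool) (x : Fin n → Pr → Bool) (r : Fin n → R → Bool)
    (y : Fin n → Y → Bool) (k : Fin n → K → Bool) (p : V → Bool)

theorem extend_aux (p' : V → Bool) :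
    Function.extend (auxWire n Pr R Y K e) p' (assign e c x r y k p) = assign e c x r y k p' := by
  refine extend_eq_of (auxWire_injective e) (fun q => by simp [assign, auxWire]) fun q hq => ?_
  cases q <;> try rfl
  rename_i j
  exact absurd (by simp [auxWire]) (hq (e.symm j))

theorem extend_committed (c' : Fin n → Bool) :
    Function.extend (committedWire n Pr R Y K N) c' (assign e c x r y k p) =
      assign e c' x r y k p := by
  refine extend_eq_of committed_injective (fun q => rfl) fun q hq => ?_
  cases q <;> try rfl
  exact absurd rfl (hq _)

theorem extend_preimage (t : Fin n × Pr → Bool) :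
    Function.extend (preimageWire R Y K N) t (assign e c x r y k p) =
      assign e c (fun i j => t (i, j)) r y k p := by
  refine extend_eq_of preimageWire_injective (fun q => rfl) fun q hq => ?_
  cases q <;> try rfl
  rename_i i j
  exact absurd rfl (hq (i, j))

theorem extend_image (t : Fin n × Y → Bool) :
    Function.extend (imageWire Pr R K N) t (assign e c x r y k p) =
      assign e c x r (fun i j => t (i, j)) k p := by
  refine extend_eq_of imageWire_injective (fun q => rfl) fun q hq => ?_
  cases q <;> try rfl
  rename_i i j
  exact absurd rfl (hq (i, j))

theorem assign_comp_aux : assign e c x r y k p ∘ auxWire n Pr R Y K e = p := by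
  funext q; simp [assign, auxWire]

theorem assign_comp_aux_comp {κ : Type} (g : κ → V) :
    assign e c x r y k p ∘ (auxWire n Pr R Y K e ∘ g) = p ∘ g := by
  rw [← Function.comp_assoc, assign_comp_aux]

theorem extend_aux_comp {κ : Type} {g : κ → V} (hg : Function.Injective g) (t : κ → Bool) :
    Function.extend (auxWire n Pr R Y K e ∘ g) t (assign e c x r y k p) =
      assign e c x r y k (Function.extend g t p) := by
  refine extend_eq_of ((auxWire_injective e).comp hg)
    (fun q => by simp [assign, auxWire, hg.extend_apply]) fun q hq => ?_
  cases q <;> try rfl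
  rename_i j
  simp only [assign]
  rw [Function.extend_apply']
  rintro ⟨a, ha⟩
  exact hq a (by simp [auxWire, ha])

end Assign

/-! ### Standard form of the averaged prover -/

section StandardForm
variable {D : Domains} {E : ExtendedTCF D} {n l : ℕ}

namespace ProverAt
variable (P : ProverAt E n l)

/-- Labels of the qubits of the prover. -/
abbrev label : ProverWire E n l P.aux ≃ Fin (Fintype.card (ProverWire E n l P.aux)) :=
  Fintype.equivFin _

/-- The qubits of the prover, as auxiliary qubits of the prover in standard form. -/
abbrev innerC : ProverWire E n l P.aux →
    CommitWire (D := D) n l (Fintype.card (ProverWire E n l P.aux)) := auxWire _ _ _ _ _ P.label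

/-- The qubits of the prover, as auxiliary qubits of the prover in standard form after the
application of `U_J`. -/
abbrev innerA : ProverWire E n l P.aux →
    AttackWire E n l (Fintype.card (ProverWire E n l P.aux)) := auxWire _ _ _ _ _ P.label

theorem innerC_injective : Function.Injective P.innerC := auxWire_injective _

theorem innerA_injective : Function.Injective P.innerA := auxWire_injective _

/-- The unitary `U₀`. -/
def standardU₀ : Circuit (CommitWire (D := D) n l (Fintype.card (ProverWire E n l P.aux))) :=
  Circuit.copy (keyWire _ _ _ _) (P.innerC ∘ keyWire _ _ _ _) nofun ++
  (Circuit.map P.innerC P.innerC_injective P.commit ++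
  (Circuit.copy (P.innerC ∘ imageWire _ _ _ _) (imageWire _ _ _ _) nofun ++
  (Circuit.map P.innerC P.innerC_injective P.test ++
  (Circuit.copy (P.innerC ∘ committedWire _ _ _ _ _ _) (committedWire _ _ _ _ _ _)
    (fun _ _ => nofun) ++
  Circuit.copy (P.innerC ∘ preimageWire _ _ _ _) (preimageWire _ _ _ _) nofun))))

theorem length_standardU₀ : P.standardU₀.length =
    n * Fintype.card (D.encKey.W l) + (P.commit.length + (n * Fintype.card (D.encY.W l) +
      (P.test.length + (n + n * Fintype.card (D.encX.W l))))) := by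
  simp only [standardU₀, List.length_append, Circuit.length_copy, Circuit.length_map,
    Fintype.card_prod, Fintype.card_fin]

/-- The key registers are only sources of CNOT gates: the prover runs on a private copy of the keys.
-/
theorem standardU₀_keyControlled (i : Fin n) (j : D.encKey.W l) :
    Fixes (.key i j) (Circuit.toMatrix P.standardU₀) := by
  simp only [standardU₀, Circuit.toMatrix_append, Circuit.toMatrix_map]
  have h₁ : ∀ a, P.innerC a ≠ .key i j := nofun
  exact (((((Fixes.copy _ preimageWire_injective fun _ h => by cases h).mul
    (Fixes.copy _ committedWire_injective fun _ h => by cases h)).mul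
    (Fixes.lift h₁ _)).mul (Fixes.copy _ imageWire_injective nofun)).mul
    (Fixes.lift h₁ _)).mul (Fixes.copy _ (P.innerC_injective.comp keyWire_injective) nofun)

theorem initial_eq {Pr R : Type} [Fintype Pr] [DecidableEq Pr] [Fintype R] [DecidableEq R]
    {a : ℕ} (k : Fin n → D.Key l) :
    (initial k : Wire n Pr R (D.encY.W l) (D.encKey.W l) a → Bool) =
      Function.extend (keyWire _ _ _ _) (fun q => D.encKey.enc l (k q.1) q.2)
        fun _ => false := by
  refine (extend_eq_of keyWire_injective (fun q => rfl) fun q hq => ?_).symm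
  cases q <;> try rfl
  rename_i i j
  exact absurd rfl (hq (i, j))

theorem lift_innerC_mulVec (M : Matrix (ProverWire E n l P.aux → Bool) _ ℂ)
    (f : (CommitWire (D := D) n l (Fintype.card (ProverWire E n l P.aux)) → Bool) → ℂ)
    (c x r y' k' p) :
    (lift P.innerC M *ᵥ f) (assign P.label c x r y' k' p) =
      (M *ᵥ fun p => f (assign P.label c x r y' k' p)) p := by
  rw [lift_mulVec P.innerC_injective, assign_comp_aux]
  simp only [extend_aux]

theorem lift_innerA_mulVec (M : Matrix (ProverWire E n l P.aux → Bool) _ ℂ)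
    (f : (AttackWire E n l (Fintype.card (ProverWire E n l P.aux)) → Bool) → ℂ)
    (c x r y' k' p) :
    (lift P.innerA M *ᵥ f) (assign P.label c x r y' k' p) =
      (M *ᵥ fun p => f (assign P.label c x r y' k' p)) p := by
  rw [lift_mulVec P.innerA_injective, assign_comp_aux]
  simp only [extend_aux]

theorem mulVec_ite {α : Type} [Fintype α] (M : Matrix α α ℂ) (q : Prop) [Decidable q]
    (f : α → ℂ) (p : α) :
    (M *ᵥ fun p => if q then f p else 0) p = if q then (M *ᵥ f) p else 0 := by
  split_ifs
  · rfl
  · exact congrFun (mulVec_zero M) p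

/-- The private assignment `p` determines all outer registers except the commitment strings. These
are copied out before `test` is applied, so fixing the outer value `y` projects the private state at
the same moment as the measurement of the original prover. -/
theorem standardU₀_committedState (k : Fin n → D.Key l) (y : Fin n → D.encY.W l → Bool)
    (c : Fin n → Bool) (x : Fin n → D.encX.W l → Bool) (r : Fin n → Empty → Bool)
    (y' : Fin n → D.encY.W l → Bool) (k' : Fin n → D.encKey.W l → Bool)
    (p : ProverWire E n l P.aux → Bool) :
    committedState P.standardU₀ k y (assign P.label c x r y' k' p) =
      if y' = y ∧ k' = (fun i => D.encKey.enc l (k i)) ∧ c = (fun i => p (.committed i)) ∧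
        x = (fun i j => p (.preimage i j)) then P.testState k y p else 0 := by
  have hi : (initial k : CommitWire (D := D) n l (Fintype.card (ProverWire E n l P.aux)) → Bool) =
      assign P.label (fun _ => false) (fun _ _ => false) r (fun _ _ => false)
        (fun i => D.encKey.enc l (k i)) fun _ => false := by
    funext q
    cases q <;> try rfl
    rename_i i j
    exact j.elim
  have h₀ : ∀ (c : Fin n → Bool) (x : Fin n → D.encX.W l → Bool)
      (y' : Fin n → D.encY.W l → Bool) (p : ProverWire E n l P.aux → Bool),
      (Circuit.toMatrix (Circuit.copy (keyWire _ _ _ _) (P.innerC ∘ keyWire _ _ _ _)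
        nofun) *ᵥ Pi.single (initial k) 1) (assign P.label c x r y' k' p) =
      if c = (fun _ => false) ∧ x = (fun _ _ => false) ∧ y' = (fun _ _ => false) ∧
        k' = (fun i => D.encKey.enc l (k i)) then
          (Pi.single (initial k) (1 : ℂ) : (ProverWire E n l P.aux → Bool) → ℂ) p else 0 := by
    intro c x y' p
    rw [Circuit.copy_mulVec _ (P.innerC_injective.comp keyWire_injective),
      extend_aux_comp _ _ _ _ _ _ _ keyWire_injective, assign_comp_aux_comp, hi]
    simp only [Pi.single_apply, assign_inj, true_and]
    rw [initial_eq]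
    have hk : assign P.label c x r y' k' p ∘ keyWire _ _ _ _ = fun q => k' q.1 q.2 := rfl
    simp only [hk, extend_bxor_eq_false_iff keyWire_injective]
    by_cases h : k' = fun i => D.encKey.enc l (k i)
    · subst h; split_ifs <;> simp_all
    · simp [h]
  have h₁ : (fun i j => (assign P.label c x r y' k' p) (.image i j)) = y' := rfl
  have hx : ∀ (c : Fin n → Bool) (x : Fin n → D.encX.W l → Bool)
      (y' : Fin n → D.encY.W l → Bool) (p : ProverWire E n l P.aux → Bool),
      (fun i j => bxor (assign P.label c x r y' k' p ∘ preimageWire _ _ _ _)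
        (assign P.label c x r y' k' p ∘ (P.innerC ∘ preimageWire _ _ _ _)) (i, j)) =
        fun i => bxor (x i) fun j => p (.preimage i j) := by
    intro c x y' p
    funext i j
    simp [bxor, assign, auxWire, preimageWire]
  have hc : ∀ (c : Fin n → Bool) (x : Fin n → D.encX.W l → Bool)
      (y' : Fin n → D.encY.W l → Bool) (p : ProverWire E n l P.aux → Bool),
      (bxor (assign P.label c x r y' k' p ∘ committedWire _ _ _ _ _ _)
        (assign P.label c x r y' k' p ∘ (P.innerC ∘ committedWire _ _ _ _ _ _))) =
        bxor c fun i => p (.committed i) := by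
    intro c x y' p
    funext i
    simp [bxor, assign, auxWire, committedWire]
  have hy : ∀ (c : Fin n → Bool) (x : Fin n → D.encX.W l → Bool)
      (y' : Fin n → D.encY.W l → Bool) (p : ProverWire E n l P.aux → Bool),
      (fun i j => bxor (assign P.label c x r y' k' p ∘ imageWire _ _ _ _)
        (assign P.label c x r y' k' p ∘ (P.innerC ∘ imageWire _ _ _ _)) (i, j)) =
        fun i => bxor (y' i) fun j => p (.image i j) := by
    intro c x y' p
    funext i j
    simp [bxor, assign, auxWire, imageWire]
  have hz : ∀ {κ : Type} [Fintype κ] [DecidableEq κ] (y z : Fin n → κ → Bool),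
      ((fun i => bxor (y i) (z i)) = fun _ _ => false) ↔ y = z := by
    intro κ _ _ y z
    rw [funext_iff, funext_iff]
    exact forall_congr' fun i => bxor_eq_false_iff _ _
  rw [committedState_eq, h₁]
  simp only [standardU₀, Circuit.toMatrix_append, ← mulVec_mulVec, Circuit.toMatrix_map]
  rw [Circuit.copy_mulVec _ preimageWire_injective, extend_preimage, hx,
    Circuit.copy_mulVec _ committedWire_injective, extend_committed, hc, lift_innerC_mulVec]
  simp only [Circuit.copy_mulVec _ imageWire_injective, extend_image, hy, lift_innerC_mulVec, h₀,
    mulVec_ite, hz, bxor_eq_false_iff]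
  by_cases h : k' = (fun i => D.encKey.enc l (k i)) ∧ c = (fun i => p (.committed i)) ∧
    x = (fun i j => p (.preimage i j))
  · obtain ⟨hk, h₂, h₃⟩ := h
    simp only [hk, ← h₂, ← h₃, true_and, and_true]
    refine if_ctx_congr Iff.rfl (fun h => ?_) fun _ => rfl
    rw [testState]
    congr 1
    funext p'
    rw [committedState_eq, h]
    exact if_congr eq_comm rfl rfl
  · have : ∀ q : Prop, ¬ (c = (fun i => p (.committed i)) ∧
        x = (fun i j => p (.preimage i j)) ∧ q ∧ k' = fun i => D.encKey.enc l (k i)) := by tauto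
    simp only [this, if_false]
    exact (if_congr Iff.rfl (congrFun (mulVec_zero _) p) rfl).trans
      ((ite_self _).trans (if_neg fun h' => h h'.2).symm)

end ProverAt
end StandardForm

/-! ### Attacks that preserve the values of given qubits -/

section UnitaryChannel
variable {W : Type} [Fintype W] [DecidableEq W] {a : ℕ} {C : Circuit (W ⊕ Fin a)}
  {U : Matrix (W → Bool) (W → Bool) ℂ}

/-- A unitary that is block diagonal in the values of these qubits commutes with each projection
onto a value, and hence so does conjugation by it. -/
theorem channel_diagonal {n : ℕ}
    (hC : ∀ f, Circuit.toMatrix C *ᵥ padZero (Fin a) f = padZero (Fin a) (U *ᵥ f))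
    {c : Fin n → W} (hU : ∀ i, Fixes (c i) U) (m : Fin n → Bool)
    (ρ : Matrix (W → Bool) (W → Bool) ℂ) {B : Matrix (W → Bool) (W → Bool) ℂ}
    (hB : B = Matrix.diagonal fun v => if (fun i => v (c i)) = m then 1 else 0) :
    channel C (B * ρ * B) = B * channel C ρ * B := by
  have hp : U * B = B * U := by
    ext v v'
    rw [hB, Matrix.mul_diagonal, Matrix.diagonal_mul]
    by_cases h : U v v' = 0
    · rw [h]; simp
    · have : (fun i => v (c i)) = fun i => v' (c i) := funext fun i => hU i v v' h
      rw [this, mul_comm]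
  have hp' : Bᴴ = B := by
    rw [hB, diagonal_conjTranspose]
    congr 1
    funext v
    rw [Pi.star_apply]
    split_ifs <;> simp
  have hp'' : B * Uᴴ = Uᴴ * B := by
    have := congrArg conjTranspose hp
    rw [conjTranspose_mul, conjTranspose_mul, hp'] at this
    exact this
  rw [channel_eq hC, channel_eq hC]
  calc _ = (U * B) * ρ * (B * Uᴴ) := by simp only [Matrix.mul_assoc]
    _ = _ := by rw [hp, hp'']; simp only [Matrix.mul_assoc]

theorem conj_channel_apply
    (hC : ∀ f, Circuit.toMatrix C *ᵥ padZero (Fin a) f = padZero (Fin a) (U *ᵥ f))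
    (B : Matrix (W → Bool) (W → Bool) ℂ) (ψ : (W → Bool) → ℂ) (v : W → Bool) :
    ((B * channel C (Matrix.vecMulVec ψ (star ψ)) * Bᴴ) v v).re =
      ‖(B *ᵥ (U *ᵥ ψ)) v‖ ^ 2 := by
  rw [channel_eq hC, mulVec_mulVec, ← conj_vecMulVec_apply, conjTranspose_mul]
  simp only [Matrix.mul_assoc]

end UnitaryChannel

/-! ### The attack of the trivial prover -/

section Attack
variable {D : Domains} {E : ExtendedTCF D} {n l : ℕ}

theorem BitEncoding.dec_enc {α : ℕ → Type} (e : BitEncoding α) (l : ℕ) (a : α l) :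
    e.dec l (e.enc l a) = some a := by
  have h : ∃ b, e.enc l b = e.enc l a := ⟨a, rfl⟩
  rw [BitEncoding.dec, dif_pos h, e.inj l h.choose_spec]

theorem BitEncoding.enc_of_dec {α : ℕ → Type} (e : BitEncoding α) {l : ℕ} {z : e.W l → Bool}
    {a : α l} (h : e.dec l z = some a) : e.enc l a = z := by
  unfold BitEncoding.dec at h
  split_ifs at h with h'
  rw [← Option.some.inj h]; exact h'.choose_spec

theorem Jbits_enc (x : D.X l) : Jbits E l (D.encX.enc l x) = E.F.J l x := by
  simp [Jbits, BitEncoding.dec_enc]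

theorem JinvBits_J (x : D.X l) : JinvBits E l (E.F.J l x) = D.encX.enc l x := by
  have h : ∃ x', E.F.J l x' = E.F.J l x := ⟨x, rfl⟩
  rw [JinvBits, dif_pos h, E.F.J_inj l h.choose_spec]

/-- Componentwise application of a function. -/
def arrayMap {n : ℕ} {I O : Type} (F : (I → Bool) → O → Bool) (x : Fin n × I → Bool) :
    Fin n × O → Bool := fun q => F (fun j => x (q.1, j)) q.2

theorem Comp.arrayMap {I O : Type} [Fintype I] [DecidableEq I] [Fintype O] [DecidableEq O] {s : ℕ}
    {F : (I → Bool) → O → Bool} (hF : Comp s F) :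
    Comp (n * Fintype.card O * (6 * Fintype.card I + 2 * s + 1 + Fintype.card O))
      (arrayMap (n := n) F) := by
  have := Comp.pi (O := Fin n × O) fun q =>
    Comp.comp (Comp.bit q.2) (Comp.comp hF (Comp.wire (I := Fin n × I) fun j => (q.1, j)))
  refine Comp.mono this ?_
  rw [Fintype.card_prod, Fintype.card_fin]
  exact Nat.mul_le_mul_left _ (by omega)

theorem chi_comm (r b : Fin n → Bool) : chi r b = chi b r := by
  simp only [chi, Bool.and_comm]

theorem chi_bxor (r r' b : Fin n → Bool) : chi r b * chi r' b = chi (bxor r r') b := by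
  rw [chi, chi, chi, ← Finset.prod_mul_distrib]
  refine Finset.prod_congr rfl fun i _ => ?_
  cases hr : r i <;> cases hr' : r' i <;> cases hb : b i <;> simp [bxor, hr, hr']

namespace ProverAt
variable (P : ProverAt E n l)

theorem preimage_oracle_injective : Function.Injective (Sum.elim
    (P.innerA ∘ preimageWire _ _ _ _) (preimageWire _ _ _ _) :
      (Fin n × D.encX.W l) ⊕ (Fin n × Fin (E.F.w l)) → AttackWire E n l _) := by
  rintro (a | a) (b | b) h
  · exact congrArg _ (preimageWire_injective (P.innerA_injective h))
  · cases h
  · cases h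
  · exact congrArg _ (preimageWire_injective h)

/-- The unitary of the attack in standard form. -/
def standardAttack (F : (D.encX.W l → Bool) → Bits (E.F.w l)) :
    Matrix (AttackWire E n l (Fintype.card (ProverWire E n l P.aux)) → Bool)
      (AttackWire E n l (Fintype.card (ProverWire E n l P.aux)) → Bool) ℂ :=
  hadamardOn (Finset.univ.image (preimageWire _ _ _ _)) *
  (Circuit.toMatrix (Circuit.czs (committedWire _ _ _ _ _ _)
    (P.innerA ∘ committedWire _ _ _ _ _ _) nofun) *
  (Circuit.toMatrix (Circuit.copy (P.innerA ∘ extraWire _ _ _ _) (preimageWire _ _ _ _) nofun) *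
  (lift P.innerA P.attackOp *
  lift (Sum.elim (P.innerA ∘ preimageWire _ _ _ _) (preimageWire _ _ _ _))
    (oracle (arrayMap F)))))

theorem impl_standardAttack {F : (D.encX.W l → Bool) → Bits (E.F.w l)} {s : ℕ}
    (hF : Comp s (arrayMap (n := n) F)) :
    Impl (n * E.F.w l + (n * 3 + (n * E.F.w l + (P.test.length + P.had.length + s))))
      (P.standardAttack F) := by
  refine Impl.mul ?_ (Impl.mul ?_ (Impl.mul ?_ (Impl.mul ?_ (hF.lift P.preimage_oracle_injective))))
  · rw [← Circuit.toMatrix_hadamard_toList]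
    refine (Impl.circuit _).mono ?_
    rw [Circuit.length_hadamard, Finset.card_image_of_injective _ preimageWire_injective]
    simp
  · refine (Impl.circuit _).mono ?_
    rw [Circuit.length_czs]
  · refine (Impl.circuit _).mono ?_
    rw [Circuit.length_copy, Fintype.card_prod, Fintype.card_fin, Fintype.card_fin]
  · refine Impl.lift P.innerA_injective ?_
    rw [attackOp, ← Circuit.toMatrix_inv, ← Circuit.toMatrix_append]
    refine (Impl.circuit _).mono ?_
    rw [List.length_append, Circuit.length_inv]

/-- Of the five factors only the controlled phases involve the outer committed qubits, and they are
diagonal. This is what makes the prover trivial. -/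
theorem standardAttack_fixes (F : (D.encX.W l → Bool) → Bits (E.F.w l)) (i : Fin n) :
    Fixes (.committed i) (P.standardAttack F) := by
  refine Fixes.mul (Fixes.hadamardOn ?_) (Fixes.mul ?_ (Fixes.mul ?_ (Fixes.mul ?_ ?_)))
  · simp [preimageWire]
  · exact Fixes.of_mulVec (Circuit.czs_mulVec _ _ _) fun z => rfl
  · exact Fixes.copy _ preimageWire_injective fun _ h => by cases h
  · exact Fixes.lift nofun _
  · refine Fixes.lift ?_ _
    rintro (a | a) h <;> cases h

/-- All preimages in the final state of the test round are encodings. -/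
def ValidAt (k : Fin n → D.Key l) : Prop := ∀ y p, P.testState k y p ≠ 0 →
  ∀ i, ∃ x : D.X l, D.encX.enc l x = fun j => p (.preimage i j)

/-- A prover in standard form with the given attack. -/
def standardForm (anc : ℕ)
    (S : Circuit (AttackWire E n l (Fintype.card (ProverWire E n l P.aux)) ⊕ Fin anc)) :
    StandardFormAt E n l where
  aux := Fintype.card (ProverWire E n l P.aux)
  U₀ := P.standardU₀
  anc := anc
  S := S

/-- On an encoding, `U_J` leaves zeros in place of `x`, and `F` agrees with `J`; neither is known
for other strings, so the hypothesis that all preimages are encodings is essential here. -/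
theorem isometryJ_committedState {k : Fin n → D.Key l} (hk : P.ValidAt k)
    {F : (D.encX.W l → Bool) → Bits (E.F.w l)} (hF : ∀ x, F (D.encX.enc l x) = E.F.J l x)
    (y : Fin n → D.encY.W l → Bool)
    (c : Fin n → Bool) (x : Fin n → Bits (E.F.w l)) (r : Fin n → D.encX.W l → Bool)
    (y' : Fin n → D.encY.W l → Bool) (k' : Fin n → D.encKey.W l → Bool)
    (p : ProverWire E n l P.aux → Bool) :
    (isometryJ E l _ *ᵥ committedState P.standardU₀ k y) (assign P.label c x r y' k' p) =
      if (y' = y ∧ k' = (fun i => D.encKey.enc l (k i)) ∧ r = fun _ _ => false) ∧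
        c = (fun i => p (.committed i)) ∧
        x = (fun i => F fun j => p (.preimage i j)) then P.testState k y p else 0 := by
  have key : ∀ (p' : ProverWire E n l P.aux → Bool), P.testState k y p' ≠ 0 →
      mapJ E l (assign P.label (fun i => p' (.committed i)) (fun i j => p' (.preimage i j))
        (fun _ => Empty.elim) y (fun i => D.encKey.enc l (k i)) p') =
      assign P.label (fun i => p' (.committed i)) (fun i => F fun j => p' (.preimage i j))
        (fun _ _ => false) y (fun i => D.encKey.enc l (k i)) p' := by
    intro p' hp'
    funext q
    cases q <;> try rfl
    all_goals
      rename_i i j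
      obtain ⟨x, hx⟩ := hk y p' hp' i
      simp only [mapJ, assign, ← hx, hF, Jbits_enc, JinvBits_J]
    have := congrFun hx j
    simp [← this]
  have hterm : ∀ c' x' r' y'' k'' p',
      isometryJ E l _ (assign P.label c x r y' k' p) (assign P.label c' x' r' y'' k'' p') *
        committedState P.standardU₀ k y (assign P.label c' x' r' y'' k'' p') ≠ 0 →
      P.testState k y p' ≠ 0 ∧ p' = p ∧ y'' = y ∧ k'' = (fun i => D.encKey.enc l (k i)) ∧
        c' = (fun i => p (.committed i)) ∧ x' = (fun i j => p (.preimage i j)) := by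
    intro c' x' r' y'' k'' p' hne
    rw [standardU₀_committedState] at hne
    obtain ⟨h₁, h₂⟩ := ite_ne_right_iff.1 (right_ne_zero_of_mul hne)
    have h₃ := (ite_ne_right_iff.1 (left_ne_zero_of_mul hne)).1
    have h₄ : p' = p := by
      funext q
      simpa [mapJ, assign] using (congrFun h₃ (.aux (P.label q))).symm
    subst h₄
    exact ⟨h₂, rfl, h₁.1, h₁.2.1, h₁.2.2.1, h₁.2.2.2⟩
  -- The auxiliary register is left alone by `U_J` and determines the other registers, so only one
  -- basis state contributes.
  rw [mulVec, dotProduct, Finset.sum_eq_single (assign P.label (fun i => p (.committed i))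
    (fun i j => p (.preimage i j)) (fun _ => Empty.elim) y (fun i => D.encKey.enc l (k i)) p)]
  · by_cases hp : P.testState k y p = 0
    · rw [standardU₀_committedState, hp]; simp
    · rw [standardU₀_committedState, if_pos ⟨rfl, rfl, rfl, rfl⟩, isometryJ, Matrix.of_apply,
        key p hp]
      simp only [assign_inj, ite_mul, one_mul, zero_mul]
      refine if_congr ?_ rfl rfl
      tauto
  · intro u _ hu
    obtain ⟨c', x', r', y'', k'', p', rfl⟩ := exists_assign P.label u
    by_contra hne
    obtain ⟨_, rfl, rfl, rfl, rfl, rfl⟩ := hterm _ _ _ _ _ _ hne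
    refine hu ?_
    congr 1
    funext i j
    exact j.elim
  · simp

/-- The oracle cancels `J(x)` against its private copy, so the preimage registers are zero and can
receive `d`; the Hadamard gates of the attack on them cancel those of the final measurement. On the
committed qubits the controlled phases contribute the character of the private answer, the
measurement that of `c`, and the product is the phase `Z^r` with `r` the sum of `c` and the private
answer. -/
theorem standardAttack_mulVec {k : Fin n → D.Key l} (hk : P.ValidAt k)
    {F : (D.encX.W l → Bool) → Bits (E.F.w l)} (hF : ∀ x, F (D.encX.enc l x) = E.F.J l x)
    (y : Fin n → D.encY.W l → Bool)
    (c : Fin n → Bool) (x : Fin n → Bits (E.F.w l)) (r : Fin n → D.encX.W l → Bool)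
    (y' : Fin n → D.encY.W l → Bool) (k' : Fin n → D.encKey.W l → Bool)
    (p : ProverWire E n l P.aux → Bool) :
    (hadamardOn (Finset.univ.image (committedWire _ _ _ _ _ _)) *ᵥ
      (hadamardOn (Finset.univ.image (preimageWire _ _ _ _)) *ᵥ (P.standardAttack F *ᵥ
        (isometryJ E l _ *ᵥ committedState P.standardU₀ k y)))) (assign P.label c x r y' k' p) =
      if (y' = y ∧ k' = (fun i => D.encKey.enc l (k i)) ∧ r = fun _ _ => false) ∧
        x = (fun i j => p (.extra i j)) then (Real.sqrt 2 : ℂ)⁻¹ ^ n *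
          (P.attackOp *ᵥ phase (bxor c fun i => p (.committed i)) (P.testState k y)) p
      else 0 := by
  have hz : ∀ {κ : Type} [Fintype κ] [DecidableEq κ] (y z : Fin n → κ → Bool),
      ((fun i => bxor (y i) (z i)) = fun _ _ => false) ↔ y = z := by
    intro κ _ _ y z
    rw [funext_iff, funext_iff]
    exact forall_congr' fun i => bxor_eq_false_iff _ _
  have hz' : ∀ {κ : Type} [Fintype κ] [DecidableEq κ] (y z : Fin n → κ → Bool),
      ((fun i => bxor (y i) (z i)) = z) ↔ y = fun _ _ => false := by
    intro κ _ _ y z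
    rw [funext_iff, funext_iff]
    refine forall_congr' fun i => ?_
    rw [← bxor_eq_false_iff, bxor_bxor_self]
  have hx : ∀ (c : Fin n → Bool) (x : Fin n → Bits (E.F.w l))
      (p : ProverWire E n l P.aux → Bool),
      (fun i j => bxor (assign P.label c x r y' k' p ∘ preimageWire _ _ _ _)
        (assign P.label c x r y' k' p ∘ (P.innerA ∘ extraWire _ _ _ _)) (i, j)) =
        fun i => bxor (x i) fun j => p (.extra i j) := by
    intro c x p
    funext i j
    simp [bxor, assign, auxWire, preimageWire, extraWire]
  have hJ : ∀ (c : Fin n → Bool) (x : Fin n → Bits (E.F.w l))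
      (p : ProverWire E n l P.aux → Bool),
      (fun i j => bxor (assign P.label c x r y' k' p ∘ preimageWire _ _ _ _)
        (arrayMap F (assign P.label c x r y' k' p ∘ (P.innerA ∘ preimageWire _ _ _ _))) (i, j)) =
        fun i => bxor (x i) (F fun j => p (.preimage i j)) := by
    intro c x p
    funext i j
    simp [bxor, assign, auxWire, preimageWire, arrayMap, Function.comp_def]
  have hc : ∀ (c : Fin n → Bool) (x : Fin n → Bits (E.F.w l))
      (p : ProverWire E n l P.aux → Bool),
      assign P.label c x r y' k' p ∘ committedWire _ _ _ _ _ _ = c := fun c x p => rfl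
  have hc' : ∀ (c : Fin n → Bool) (x : Fin n → Bits (E.F.w l))
      (p : ProverWire E n l P.aux → Bool),
      assign P.label c x r y' k' p ∘ (P.innerA ∘ committedWire _ _ _ _ _ _) =
        fun i => p (.committed i) := by
    intro c x p
    funext i
    simp [assign, auxWire, committedWire]
  rw [hadamardOn_mulVec committedWire_injective]
  simp only [standardAttack, mulVec_mulVec, ← Matrix.mul_assoc, hadamardOn_mul_self,
    Matrix.one_mul, extend_committed, hc]
  simp only [Matrix.mul_assoc, ← mulVec_mulVec, Circuit.czs_mulVec, hc, hc',
    Circuit.copy_mulVec _ preimageWire_injective, extend_preimage, hx, lift_innerA_mulVec,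
    lift_oracle_mulVec P.preimage_oracle_injective, hJ, P.isometryJ_committedState hk hF,
    hz', hz]
  by_cases h : (y' = y ∧ k' = (fun i => D.encKey.enc l (k i)) ∧ r = fun _ _ => false) ∧
    x = (fun i j => p (.extra i j))
  · rw [if_pos h]
    congr 1
    obtain ⟨h₁, h₂⟩ := h
    simp only [h₁, h₂, true_and, and_true, mulVec, dotProduct, Finset.mul_sum]
    -- For each private state before the attack only one value `b` of the outer committed qubits
    -- occurs, the one copied from it.
    rw [Finset.sum_comm]
    refine Finset.sum_congr rfl fun p' _ => ?_
    rw [Finset.sum_eq_single fun i => p' (.committed i)]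
    · rw [if_pos rfl, phase, ← chi_bxor, chi_comm (fun i => p (.committed i))]
      ring
    · intro b _ hb
      rw [if_neg hb]; simp
    · simp
  · rw [if_neg h]
    have : ∀ q : Prop, ¬ ((y' = y ∧ k' = (fun i => D.encKey.enc l (k i)) ∧ r = fun _ _ => false) ∧
        q ∧ x = (fun i j => p (.extra i j))) := fun q hq => h ⟨hq.1, hq.2.2⟩
    simp only [this, if_false]
    have h₀ : (P.attackOp *ᵥ fun _ => (0 : ℂ)) p = 0 := congrFun (mulVec_zero _) p
    simp only [h₀, mul_zero, Finset.sum_const_zero]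

/-- The outer registers hold copies, so the basis states with nonzero amplitude correspond to the
private assignments. -/
theorem standardForm_testBehaviour (anc : ℕ)
    (S : Circuit (AttackWire E n l (Fintype.card (ProverWire E n l P.aux)) ⊕ Fin anc)) :
    (P.standardForm anc S).testBehaviour = P.testBehaviour := by
  funext k y b x
  let g : (ProverWire E n l P.aux → Bool) →
      CommitWire (D := D) n l (Fintype.card (ProverWire E n l P.aux)) → Bool := fun p =>
    assign P.label (fun i => p (.committed i)) (fun i j => p (.preimage i j))
      (fun _ => Empty.elim) y (fun i => D.encKey.enc l (k i)) p
  refine (Fintype.sum_of_injective g ?_ _ _ ?_ ?_).symm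
  · intro p p' h
    exact ((assign_inj _ _ _ _ _ _ _ _ _ _ _ _ _).1 h).2.2.2.2.2
  · intro v hv
    obtain ⟨c, x', r, y', k', p, rfl⟩ := exists_assign P.label v
    change (if _ then ‖committedState P.standardU₀ k y _‖ ^ 2 else 0) = 0
    rw [standardU₀_committedState]
    by_cases h : y' = y ∧ k' = (fun i => D.encKey.enc l (k i)) ∧
        c = (fun i => p (.committed i)) ∧ x' = (fun i j => p (.preimage i j))
    swap
    · simp only [h, if_false, norm_zero]; simp
    · obtain ⟨rfl, rfl, rfl, rfl⟩ := h
      refine absurd ⟨p, ?_⟩ hv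
      simp only [g]
      congr 1
      funext i j
      exact j.elim
  · intro p
    change _ = if _ then ‖committedState P.standardU₀ k y (g p)‖ ^ 2 else 0
    rw [standardU₀_committedState]
    simp only [and_self, if_true]
    rfl

theorem standardForm_commutes {anc : ℕ}
    {S : Circuit (AttackWire E n l (Fintype.card (ProverWire E n l P.aux)) ⊕ Fin anc)}
    {F : (D.encX.W l → Bool) → Bits (E.F.w l)}
    (hS : ∀ f, Circuit.toMatrix S *ᵥ padZero (Fin anc) f =
      padZero (Fin anc) (P.standardAttack F *ᵥ f)) : (P.standardForm anc S).Commutes := by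
  exact fun m ρ => channel_diagonal hS (P.standardAttack_fixes F) m ρ rfl

theorem measured_eq (anc : ℕ)
    (S : Circuit (AttackWire E n l (Fintype.card (ProverWire E n l P.aux)) ⊕ Fin anc)) :
    (P.standardForm anc S).measured = Finset.univ.image (committedWire _ _ _ _ _ _) ∪
      Finset.univ.image (preimageWire _ _ _ _) := by
  ext q
  simp only [StandardFormAt.measured, Finset.mem_filter, Finset.mem_univ, true_and,
    Finset.mem_union, Finset.mem_image, committedWire, preimageWire, Prod.exists]
  simp only [eq_comm]

/-- For a fixed answer `b`, the final private state determines `r`; the double sum over `r` and the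
final state in the averaged behaviour collapses to the single sum of the standard form, and the
factor 2^-n is the squared norm of the Hadamard coefficient. -/
theorem standardForm_hadamardBehaviour {anc : ℕ}
    {S : Circuit (AttackWire E n l (Fintype.card (ProverWire E n l P.aux)) ⊕ Fin anc)}
    {F : (D.encX.W l → Bool) → Bits (E.F.w l)} (hF : ∀ x, F (D.encX.enc l x) = E.F.J l x)
    (hS : ∀ f, Circuit.toMatrix S *ᵥ padZero (Fin anc) f =
      padZero (Fin anc) (P.standardAttack F *ᵥ f)) {k : Fin n → D.Key l} (hk : P.ValidAt k)
    (y : Fin n → D.encY.W l → Bool) (b : Fin n → Bool) (d : Fin n → Bits (E.F.w l)) :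
    (P.standardForm anc S).hadamardBehaviour k y b d = P.averaged k y b d := by
  have hdis : Disjoint (Finset.univ.image (committedWire n (Fin (E.F.w l)) (D.encX.W l)
      (D.encY.W l) (D.encKey.W l) (Fintype.card (ProverWire E n l P.aux))))
      (Finset.univ.image (preimageWire _ _ _ _)) := by
    rw [Finset.disjoint_left]
    simp [committedWire, preimageWire]
  have h₁ : (P.standardForm anc S).hadamardBehaviour k y b d =
      ∑ v : AttackWire E n l (Fintype.card (ProverWire E n l P.aux)) → Bool,
        if (fun i => v (.committed i)) = b ∧ (fun i j => v (.preimage i j)) = d then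
          ‖(hadamardOn (Finset.univ.image (committedWire _ _ _ _ _ _)) *ᵥ
      (hadamardOn (Finset.univ.image (preimageWire _ _ _ _)) *ᵥ (P.standardAttack F *ᵥ
        (isometryJ E l _ *ᵥ committedState P.standardU₀ k y)))) v‖ ^ 2 else 0 := by
    refine Finset.sum_congr rfl fun v _ => ?_
    refine if_congr Iff.rfl ?_ rfl
    rw [measured_eq, mulVec_mulVec _ (hadamardOn _), ← hadamardOn_union hdis]
    exact conj_channel_apply hS _ _ v
  rw [h₁]
  let g : (ProverWire E n l P.aux → Bool) →
      AttackWire E n l (Fintype.card (ProverWire E n l P.aux)) → Bool := fun p =>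
    assign P.label b (fun i j => p (.extra i j))
      (fun _ _ => false) y (fun i => D.encKey.enc l (k i)) p
  rw [← Fintype.sum_of_injective g (f := fun p => if (fun i j => p (.extra i j)) = d then
    ((2 : ℝ) ^ n)⁻¹ * ‖(P.attackOp *ᵥ phase (bxor b fun i => p (.committed i))
      (P.testState k y)) p‖ ^ 2 else 0)]
  · rw [averaged, expect]
    simp only [twisted]
    rw [Finset.sum_comm, Finset.sum_div]
    refine Finset.sum_congr rfl fun p _ => ?_
    -- Only this `r` turns the private answer into `b`.
    rw [Finset.sum_eq_single (bxor b fun i => p (.committed i))]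
    · have : (fun i => xor (p (.committed i)) ((bxor b fun i => p (.committed i)) i)) = b := by
        funext i
        simp [bxor, Bool.xor_comm (b i)]
      simp only [this, true_and]
      split_ifs
      · simp [div_eq_inv_mul]
      · simp
    · intro r _ hr
      rw [if_neg]
      rintro ⟨h, _⟩
      refine hr ?_
      rw [← h]
      funext i
      simp [bxor, Bool.xor_comm (p _)]
    · simp
  · intro p p' h
    exact ((assign_inj _ _ _ _ _ _ _ _ _ _ _ _ _).1 h).2.2.2.2.2
  · intro v hv
    obtain ⟨c, x', r, y', k', p, rfl⟩ := exists_assign P.label v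
    rw [P.standardAttack_mulVec hk hF, ite_eq_right_iff]
    rintro ⟨rfl, rfl⟩
    rw [if_neg]
    · simp
    · rintro ⟨⟨rfl, rfl, rfl⟩, h⟩
      exact hv ⟨p, by rw [h]; rfl⟩
  · intro p
    rw [P.standardAttack_mulVec hk hF]
    simp only [and_self, if_true, norm_mul, mul_pow, norm_inv_sqrt_two_pow]
    refine if_congr ?_ rfl rfl
    exact ⟨fun h => ⟨rfl, h⟩, fun h => h.2⟩

end ProverAt
end Attack

/-! ### Polynomial bounds -/

theorem PolyBounded.mono {f g : ℕ → ℕ} (h : PolyBounded g) (hfg : ∀ l, f l ≤ g l) :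
    PolyBounded f :=
  h.imp fun _ hp l => (hfg l).trans (hp l)

theorem PolyBounded.const (c : ℕ) : PolyBounded fun _ => c :=
  ⟨Polynomial.C c, fun l => by simp⟩

theorem PolyBounded.add {f g : ℕ → ℕ} (hf : PolyBounded f) (hg : PolyBounded g) :
    PolyBounded fun l => f l + g l := by
  obtain ⟨p, hp⟩ := hf
  obtain ⟨q, hq⟩ := hg
  exact ⟨p + q, fun l => by rw [Polynomial.eval_add]; exact Nat.add_le_add (hp l) (hq l)⟩

theorem PolyBounded.mul {f g : ℕ → ℕ} (hf : PolyBounded f) (hg : PolyBounded g) :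
    PolyBounded fun l => f l * g l := by
  obtain ⟨p, hp⟩ := hf
  obtain ⟨q, hq⟩ := hg
  exact ⟨p * q, fun l => by rw [Polynomial.eval_mul]; exact Nat.mul_le_mul (hp l) (hq l)⟩

theorem EfficientlyComputes.exists_comp {α I O : ℕ → Type}
    [∀ l, Fintype (I l)] [∀ l, DecidableEq (I l)] [∀ l, Fintype (O l)] [∀ l, DecidableEq (O l)]
    {inp : ∀ l, α l → I l → Bool} {out : ∀ l, α l → O l → Bool}
    (h : EfficientlyComputes inp out) (hO : PolyBounded fun l => Fintype.card (O l)) :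
    ∃ s, PolyBounded s ∧ ∃ F : ∀ l, (I l → Bool) → O l → Bool,
      ∀ l, Comp (s l) (F l) ∧ ∀ a, F l (inp l a) = out l a := by
  obtain ⟨A, hA, hp⟩ := h
  choose F h₁ h₂ using fun l => (A.alg l).exists_comp (hA l)
  exact ⟨_, ((PolyBounded.const 2).mul A.poly).add ((PolyBounded.const 2).mul hO), F,
    fun l => ⟨h₁ l, fun a => h₂ l _ _ (hp l a)⟩⟩

theorem card_wire (n : ℕ) (Pr R Y K : Type) [Fintype Pr] [DecidableEq Pr] [Fintype R]
    [DecidableEq R] [Fintype Y] [DecidableEq Y] [Fintype K] [DecidableEq K] (a : ℕ) :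
    Fintype.card (Wire n Pr R Y K a) = n + n * Fintype.card Pr + n * Fintype.card R +
      n * Fintype.card Y + n * Fintype.card K + a := by
  let e : Wire n Pr R Y K a ≃
      ((((Fin n ⊕ Fin n × Pr) ⊕ Fin n × R) ⊕ Fin n × Y) ⊕ Fin n × K) ⊕ Fin a :=
    { toFun := fun
        | .committed i => .inl (.inl (.inl (.inl (.inl i))))
        | .preimage i j => .inl (.inl (.inl (.inl (.inr (i, j)))))
        | .extra i j => .inl (.inl (.inl (.inr (i, j))))
        | .image i j => .inl (.inl (.inr (i, j)))
        | .key i j => .inl (.inr (i, j))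
        | .aux j => .inr j
      invFun := fun
        | .inl (.inl (.inl (.inl (.inl i)))) => .committed i
        | .inl (.inl (.inl (.inl (.inr q)))) => .preimage q.1 q.2
        | .inl (.inl (.inl (.inr q))) => .extra q.1 q.2
        | .inl (.inl (.inr q)) => .image q.1 q.2
        | .inl (.inr q) => .key q.1 q.2
        | .inr j => .aux j
      left_inv := fun q => by cases q <;> rfl
      right_inv := fun q => by rcases q with (((((q | q) | q) | q) | q) | q) <;> rfl }
  rw [Fintype.card_congr e]
  simp

/-! ### The trivial prover -/

section Trivial
variable {D : Domains} {E : ExtendedTCF D}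

theorem ProverAt.validAt_of_accept {n l : ℕ} {P : ProverAt E n l} {h : Fin n → Bool}
    (hP : acceptProb E P.testBehaviour h = 1) (ω : Fin n → Coins E l) :
    P.ValidAt fun i => sampleKey (h i) (ω i) := by
  intro y p hp i
  have := ProverAt.testCheck_of_accept hP ω y p hp i
  unfold testCheck at this
  split at this
  · rename_i x y' hx hy'
    exact ⟨x, D.encX.enc_of_dec hx⟩
  · simp at this

theorem ProverAt.card_proverWire {n l : ℕ} (P : ProverAt E n l) :
    Fintype.card (ProverWire E n l P.aux) = n + n * Fintype.card (D.encX.W l) + n * E.F.w l +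
      n * Fintype.card (D.encY.W l) + n * Fintype.card (D.encKey.W l) + P.aux := by
  rw [card_wire, Fintype.card_fin]

namespace Prover
variable {n : ℕ → ℕ}

theorem poly_aux (P : Prover E n) : PolyBounded fun l => (P.at_ l).aux :=
  P.poly.mono fun l => by omega

theorem poly_commit (P : Prover E n) : PolyBounded fun l => (P.at_ l).commit.length :=
  P.poly.mono fun l => by omega

theorem poly_test (P : Prover E n) : PolyBounded fun l => (P.at_ l).test.length :=
  P.poly.mono fun l => by omega

theorem poly_had (P : Prover E n) : PolyBounded fun l => (P.at_ l).had.length :=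
  P.poly.mono fun l => by omega

/-- The prover with the averaged Hadamard round behaviour. -/
def average (P : Prover E n) (hn : PolyBounded n) : Prover E n where
  at_ l := (P.at_ l).average
  poly := by
    refine ((((P.poly_aux.add hn).add P.poly_commit).add P.poly_test).add
      ((P.poly_test.add (hn.add ((P.poly_test.add P.poly_had).add (hn.add hn)))))).mono fun l => ?_
    have h₁ : (P.at_ l).average.aux = (P.at_ l).aux + n l := rfl
    have h₂ : (P.at_ l).average.commit.length = (P.at_ l).commit.length := by
      simp [ProverAt.average, ProverAt.widen, Circuit.length_map]
    have h₃ : (P.at_ l).average.test.length = (P.at_ l).test.length := by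
      simp [ProverAt.average, ProverAt.widen, Circuit.length_map]
    have h₄ : (P.at_ l).average.had.length = (P.at_ l).test.length + (n l +
        (((P.at_ l).test.length + (P.at_ l).had.length) + (n l + n l))) := by
      simp only [ProverAt.average, ProverAt.averagedHad, Circuit.length_map, List.length_append,
        Circuit.length_copy, Circuit.length_hadamard, Circuit.length_inv, Fintype.card_fin,
        Finset.card_image_of_injective _ Sum.inr_injective, Finset.card_univ]
    simp only [h₁, h₂, h₃, h₄]
    exact le_rfl

theorem exists_standardForm (P : Prover E n) (hn : PolyBounded n) :
    ∃ (F : ∀ l, (D.encX.W l → Bool) → Bits (E.F.w l)) (Q : StandardForm E n),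
      (∀ l x, F l (D.encX.enc l x) = E.F.J l x) ∧ ∀ l, ∃ a C,
        Q.at_ l = (P.at_ l).standardForm a C ∧ ∀ f, Circuit.toMatrix C *ᵥ padZero (Fin a) f =
          padZero (Fin a) ((P.at_ l).standardAttack (F l) *ᵥ f) := by
  obtain ⟨s, hs, F, hF⟩ := E.F.J_eff.exists_comp (E.F.w_poly.mono fun l => by simp)
  choose a C h₁ h₂ h₃ using fun l => (((P.at_ l).impl_standardAttack
    (Comp.arrayMap (hF l).1)).exists_circuit)
  have hw := E.F.w_poly
  have hX := D.encX.poly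
  have hY := D.encY.poly
  have hK := D.encKey.poly
  have hT : PolyBounded fun l => n l * E.F.w l + (n l * 3 + (n l * E.F.w l + ((P.at_ l).test.length
      + (P.at_ l).had.length + n l * Fintype.card (Fin (E.F.w l)) *
        (6 * Fintype.card (D.encX.W l) + 2 * s l + 1 + Fintype.card (Fin (E.F.w l)))))) := by
    simp only [Fintype.card_fin]
    exact (hn.mul hw).add ((hn.mul (.const 3)).add ((hn.mul hw).add ((P.poly_test.add
      P.poly_had).add ((hn.mul hw).mul (((((PolyBounded.const 6).mul hX).add
        ((PolyBounded.const 2).mul hs)).add (.const 1)).add hw)))))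
  have hB : PolyBounded fun l => Fintype.card (ProverWire E (n l) l (P.at_ l).aux) := by
    simp only [ProverAt.card_proverWire]
    exact ((((hn.add (hn.mul hX)).add (hn.mul hw)).add (hn.mul hY)).add (hn.mul hK)).add
      P.poly_aux
  have hU : PolyBounded fun l => (P.at_ l).standardU₀.length := by
    simp only [ProverAt.length_standardU₀]
    exact (hn.mul hK).add (P.poly_commit.add ((hn.mul hY).add (P.poly_test.add
      (hn.add (hn.mul hX)))))
  refine ⟨F, ⟨fun l => (P.at_ l).standardForm (a l) (C l),
    ((hB.add hU).add (hT.mono h₁)).add (hT.mono h₂), fun l => ?_⟩, fun l => (hF l).2,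
    fun l => ⟨a l, C l, rfl, h₃ l⟩⟩
  rintro v v' ⟨i, j, hne⟩
  by_contra h
  exact hne ((P.at_ l).standardU₀_keyControlled i j v v' h)

/-- The test behaviours agree for all keys. The Hadamard behaviours are compared only for keys under
which all preimages are encodings, and perfectness provides this for every key that the verifier can
send. -/
theorem average_isTrivial {P : Prover E n} (hn : PolyBounded n) (hP : P.IsPerfect) :
    (P.average hn).IsTrivial := by
  have h₁ : ∀ l, ((P.average hn).at_ l).testBehaviour = (P.at_ l).testBehaviour := fun l =>
    ProverAt.average_testBehaviour _
  have h₂ : ∀ l, ((P.average hn).at_ l).hadamardBehaviour = (P.at_ l).averaged := fun l =>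
    ProverAt.average_hadamardBehaviour _
  obtain ⟨F, Q, hF, hQ⟩ := P.exists_standardForm hn
  have h₃ : ∀ l, (Q.at_ l).testBehaviour = (P.at_ l).testBehaviour := by
    intro l
    obtain ⟨a, C, h, hC⟩ := hQ l
    rw [h, ProverAt.standardForm_testBehaviour]
  have h₄ : ∀ l k, (P.at_ l).ValidAt k → ∀ y b d,
      (Q.at_ l).hadamardBehaviour k y b d = (P.at_ l).averaged k y b d := by
    intro l k hk y b d
    obtain ⟨a, C, h, hC⟩ := hQ l
    rw [h]
    exact ProverAt.standardForm_hadamardBehaviour _ (hF l) hC hk y b d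
  have h₅ : ∀ l, (Q.at_ l).Commutes := by
    intro l
    obtain ⟨a, C, h, hC⟩ := hQ l
    rw [h]
    exact (P.at_ l).standardForm_commutes hC
  refine ⟨fun l h => ?_, Q, fun l h => ⟨?_, ?_⟩, h₅⟩
  · exact (congrArg (fun b => acceptProb E b h) (h₁ l)).trans (hP l h)
  · exact congrArg (fun b => acceptProb E b h) ((h₁ l).trans (h₃ l).symm)
  · have h₆ : resultDist (P.at_ l).averaged h = resultDist (Q.at_ l).hadamardBehaviour h := by
      refine funext fun m => ?_
      rw [resultDist, resultDist]
      refine congrArg expect (funext fun ω => ?_)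
      refine Finset.sum_congr rfl fun y _ => Finset.sum_congr rfl fun b _ =>
        Finset.sum_congr rfl fun d _ => ?_
      rw [h₄ l _ (ProverAt.validAt_of_accept (hP l h) ω)]
    exact (congrArg (fun b => resultDist b h) (h₂ l)).trans h₆

end Prover
end Trivial

/-! ### Probabilities of algorithms -/

section QAlg
variable {I O : Type} [Fintype I] [DecidableEq I] [Fintype O] [DecidableEq O]

theorem QAlg.finalState_eq (A : QAlg I O) (x : I → Bool) :
    A.finalState x = Circuit.toMatrix A.circ *ᵥ Pi.single (Sum.elim x fun _ => false) 1 := by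
  rw [mulVec_single_one]; rfl

theorem QAlg.prob_nonneg (A : QAlg I O) (x : I → Bool) (z : O → Bool) : 0 ≤ A.prob x z :=
  Finset.sum_nonneg fun v _ => by split_ifs <;> positivity

theorem QAlg.sum_prob_mul (A : QAlg I O) (x : I → Bool) (G : (O → Bool) → ℝ) :
    ∑ z, A.prob x z * G z =
      ∑ v, ‖A.finalState x v‖ ^ 2 * G fun o => v (.inr (.inl o)) := by
  simp only [QAlg.prob, Finset.sum_mul]
  rw [Finset.sum_comm]
  refine Finset.sum_congr rfl fun v _ => ?_
  rw [Finset.sum_eq_single fun o => v (.inr (.inl o))]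
  · rw [if_pos rfl]
  · intro z _ hz; rw [if_neg hz.symm, zero_mul]
  · simp

theorem QAlg.sum_norm_finalState (A : QAlg I O) (x : I → Bool) :
    ∑ v, ‖A.finalState x v‖ ^ 2 = 1 := by
  rw [QAlg.finalState_eq, (Circuit.isUnitary A.circ).norm_mulVec, Finset.sum_eq_single
    (Sum.elim x fun _ => false)]
  · simp
  · intro v _ hv; simp [hv]
  · simp

theorem QAlg.sum_prob (A : QAlg I O) (x : I → Bool) : ∑ z, A.prob x z = 1 := by
  have := A.sum_prob_mul x fun _ => 1
  simpa [A.sum_norm_finalState x] using this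

theorem QAlg.probMem_nonneg (A : QAlg I O) (x : I → Bool) (S : Set (O → Bool)) :
    0 ≤ A.probMem x S :=
  Finset.sum_nonneg fun z _ => by split_ifs <;> simp [A.prob_nonneg]

theorem QAlg.probMem_le_one (A : QAlg I O) (x : I → Bool) (S : Set (O → Bool)) :
    A.probMem x S ≤ 1 := by
  rw [← A.sum_prob x]
  exact Finset.sum_le_sum fun z _ => by split_ifs <;> simp [A.prob_nonneg]

theorem sum_bit (G : (Unit → Bool) → ℝ) :
    ∑ z, G z = G (fun _ => true) + G (fun _ => false) := by
  rw [← Equiv.sum_comp (Equiv.funUnique Unit Bool).symm, Fintype.sum_bool]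
  rfl

theorem QAlg.prob_true (A : QAlg I Unit) (x : I → Bool) :
    A.prob x (fun _ => true) = 1 - A.prob x fun _ => false := by
  have := A.sum_prob x
  rw [sum_bit] at this
  linarith

end QAlg

/-! ### Negligible functions -/

theorem Negligible.mono {μ ν : ℕ → ℝ} (h : Negligible μ) (hν : ∀ l, |ν l| ≤ |μ l|) :
    Negligible ν :=
  Asymptotics.SuperpolynomialDecay.trans_abs_le h hν

theorem Negligible.add {μ ν : ℕ → ℝ} (h : Negligible μ) (h' : Negligible ν) :
    Negligible fun l => μ l + ν l :=
  Asymptotics.SuperpolynomialDecay.add h h'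

theorem Negligible.const_mul {μ : ℕ → ℝ} (h : Negligible μ) (c : ℝ) :
    Negligible fun l => c * μ l :=
  Asymptotics.SuperpolynomialDecay.const_mul h c

theorem Negligible.poly_mul {μ : ℕ → ℝ} (h : Negligible μ) {n : ℕ → ℕ} (hn : PolyBounded n) :
    Negligible fun l => (n l : ℝ) * μ l := by
  obtain ⟨p, hp⟩ := hn
  refine Negligible.mono (Asymptotics.SuperpolynomialDecay.polynomial_mul h
    (p.map (Nat.castRingHom ℝ))) fun l => ?_
  rw [abs_mul, abs_mul]
  refine mul_le_mul_of_nonneg_right ?_ (abs_nonneg _)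
  rw [Nat.abs_cast]
  refine le_trans ?_ (le_abs_self _)
  have : ((p.eval l : ℕ) : ℝ) = (p.map (Nat.castRingHom ℝ)).eval (l : ℝ) := by
    rw [Polynomial.eval_natCast_map]; rfl
  rw [← this]
  exact_mod_cast hp l

/-- λ^k √μ = √(λ^(2k) μ), so decay against the exponent 2k suffices. No sign of μ is needed. -/
theorem Negligible.sqrt {μ : ℕ → ℝ} (h : Negligible μ) : Negligible fun l => Real.sqrt (μ l) := by
  intro k
  have h₁ := (Real.continuous_sqrt.tendsto 0).comp (h (2 * k))
  rw [Real.sqrt_zero] at h₁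
  refine h₁.congr fun l => ?_
  simp only [Function.comp_apply]
  rw [Real.sqrt_mul (by positivity), mul_comm 2 k, pow_mul, Real.sqrt_sq (by positivity)]

/-! ### The adaptive hardcore bit for all circuits of bounded size -/

section Hardcore
variable {D : Domains} (F : NTCF D)

/-- The registers of an attacker against the adaptive hardcore bit. -/
abbrev NTCF.GuessWire (l : ℕ) : Type := Unit ⊕ (D.encX.W l ⊕ (Fin (F.w l) ⊕ Unit))

/-- The sets `H_k` (for `c = false`) and its companion (for `c = true`). -/
def NTCF.guessSet (l : ℕ) (k : D.Key l) (c : Bool) : Set (F.GuessWire l → Bool) :=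
  {z | ∃ b x₀ x₁ d, (x₀, x₁) ∈ F.R l k ∧ d ∈ F.G l k false x₀ ∩ F.G l k true x₁ ∧
    z = Sum.elim (encBit b) (Sum.elim (D.encX.enc l (if b then x₁ else x₀))
      (Sum.elim d (encBit (xor c (dot d (bxor (F.J l x₀) (F.J l x₁)))))))}

/-- The advantage of an attacker against the adaptive hardcore bit. -/
def NTCF.advantage (l : ℕ) (A : QAlg (D.encKey.W l) (F.GuessWire l)) : ℝ :=
  expect (fun ω => A.probMem (D.encKey.enc l (F.gen l ω).1) (F.guessSet l (F.gen l ω).1 false)) -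
    expect fun ω => A.probMem (D.encKey.enc l (F.gen l ω).1) (F.guessSet l (F.gen l ω).1 true)

theorem NTCF.abs_advantage_le (l : ℕ) (A : QAlg (D.encKey.W l) (F.GuessWire l)) :
    |F.advantage l A| ≤ 1 := by
  rw [advantage, ← expect_sub]
  refine abs_expect_le fun ω => abs_le.2 ⟨?_, ?_⟩
  · linarith [A.probMem_nonneg (D.encKey.enc l (F.gen l ω).1) (F.guessSet l (F.gen l ω).1 false),
      A.probMem_le_one (D.encKey.enc l (F.gen l ω).1) (F.guessSet l (F.gen l ω).1 true)]
  · linarith [A.probMem_nonneg (D.encKey.enc l (F.gen l ω).1) (F.guessSet l (F.gen l ω).1 true),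
      A.probMem_le_one (D.encKey.enc l (F.gen l ω).1) (F.guessSet l (F.gen l ω).1 false)]

/-- The advantage of all attackers of bounded size is bounded by one negligible function. -/
theorem NTCF.hardcore_uniform {s : ℕ → ℕ} (hs : PolyBounded s) :
    ∃ μ, Negligible μ ∧ ∀ l, ∀ A : QAlg (D.encKey.W l) (F.GuessWire l),
      A.anc + A.circ.length ≤ s l → |F.advantage l A| ≤ μ l := by
  -- For each `l` an attacker within a factor 2 of the supremum is chosen, which avoids asking
  -- whether the supremum is attained over a continuum of gates. These choices form one nonuniform
  -- attacker, to which the hardcore property applies.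
  have hmax : ∀ l, ∃ A : QAlg (D.encKey.W l) (F.GuessWire l), A.anc + A.circ.length ≤ s l ∧
      ∀ A' : QAlg (D.encKey.W l) (F.GuessWire l), A'.anc + A'.circ.length ≤ s l →
        |F.advantage l A'| ≤ 2 * |F.advantage l A| := by
    intro l
    let S : Set ℝ := {a | ∃ A : QAlg (D.encKey.W l) (F.GuessWire l),
      A.anc + A.circ.length ≤ s l ∧ |F.advantage l A| = a}
    have hb : BddAbove S := ⟨1, by rintro _ ⟨A, _, rfl⟩; exact F.abs_advantage_le l A⟩
    have hne : S.Nonempty := ⟨_, ⟨0, []⟩, Nat.zero_le _, rfl⟩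
    obtain ⟨_, ⟨A₀, hA₀, rfl⟩⟩ := id hne
    -- A supremum equal to zero does not exceed its half, but then any attacker will do.
    rcases (abs_nonneg (F.advantage l A₀)).trans (le_csSup hb ⟨A₀, hA₀, rfl⟩) |>.eq_or_lt with h | h
    · refine ⟨A₀, hA₀, fun A' hA' => (le_csSup hb ⟨A', hA', rfl⟩).trans ?_⟩
      rw [← h]; positivity
    · obtain ⟨_, ⟨A, hA, rfl⟩, hlt⟩ := exists_lt_of_lt_csSup hne (half_lt_self h)
      refine ⟨A, hA, fun A' hA' => (le_csSup hb ⟨A', hA', rfl⟩).trans ?_⟩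
      linarith
  choose A hA hmax using hmax
  obtain ⟨μ, hμ, h⟩ := F.hardcore ⟨A, hs.mono hA⟩
  exact ⟨fun l => 2 * μ l, hμ.const_mul 2, fun l A' hA' => (hmax l A' hA').trans
    (mul_le_mul_of_nonneg_left (h l) zero_le_two)⟩

end Hardcore

/-! ### Resampling of one coordinate -/

section Resample
variable {n : ℕ} {α : Type} [Fintype α] [Nonempty α]

/-- Exchanging `ω j` with the new sample `u` is an involution of the pairs `(ω, u)`. This permits
all coins other than the j-th to be fixed when the hardcore property is applied to the j-th key. -/
theorem expect_resample (j : Fin n) (F : (Fin n → α) → ℝ) :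
    expect F = expect fun ω => expect fun u => F (Function.update ω j u) := by
  let e : ((Fin n → α) × α) ≃ ((Fin n → α) × α) :=
    { toFun := fun a => (Function.update a.1 j a.2, a.1 j)
      invFun := fun a => (Function.update a.1 j a.2, a.1 j)
      left_inv := fun a => by simp
      right_inv := fun a => by simp }
  have h : ∑ ω, ∑ u, F (Function.update ω j u) = Fintype.card α * ∑ ω, F ω := by
    rw [← Fintype.sum_prod_type']
    refine (Equiv.sum_comp e fun a => F a.1).trans ?_
    rw [Fintype.sum_prod_type]
    simp [Finset.mul_sum]
  have hc : (Fintype.card α : ℝ) ≠ 0 := by simp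
  simp only [expect, ← Finset.sum_div, h]
  field_simp

theorem expect_prod {β : Type} [Fintype β] (F : α × β → ℝ) :
    expect F = expect fun b => expect fun a => F (a, b) := by
  simp only [expect, Fintype.sum_prod_type, ← Finset.sum_div, Fintype.card_prod, Nat.cast_mul]
  rw [Finset.sum_comm, div_div]

theorem expect_bool (F : Bool → ℝ) : expect F = (F false + F true) / 2 := by
  simp [expect, add_comm]

end Resample

/-! ### Stored bits -/

section Stored
variable {n : ℕ}

/-- The average of `f` over the stored bit. -/
def storedAvg (o : Option Bool) (f : Bool → ℝ) : ℝ :=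
  match o with
  | some e => f e
  | none => (f false + f true) / 2

/-- A known bit and its negation give both values once, and an unknown bit gives the average twice.
For this reason the interference terms do not involve the stored bit. -/
theorem storedAvg_add_not (o : Option Bool) (f : Bool → ℝ) :
    storedAvg o f + storedAvg (o.map not) f = f false + f true := by
  rcases o with _ | (_ | _) <;> simp [storedAvg, add_comm]

theorem storedAvg_eq_expect (o : Option Bool) (f : Bool → ℝ) :
    storedAvg o f = expect fun u => f (o.getD u) := by
  rcases o with _ | e <;> simp [storedAvg, expect_bool]

theorem storedProb_eq_expect (o : Option Bool) (m : Bool) :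
    storedProb o m = expect fun u => if m = o.getD u then 1 else 0 := by
  rcases o with _ | e
  · rw [expect_bool]; cases m <;> simp [storedProb]
  · rw [expect_bool]; simp [storedProb]

/-- The verifier may draw a random bit for every coordinate in advance and use it only where
decoding fails. The bits `ρ` then become constants of the attacker. -/
theorem prod_storedProb (o : Fin n → Option Bool) (m : Fin n → Bool) :
    ∏ i, storedProb (o i) (m i) =
      expect fun ρ : Fin n → Bool => if m = (fun i => (o i).getD (ρ i)) then 1 else 0 := by
  simp only [storedProb_eq_expect]
  have h : ∀ ρ : Fin n → Bool, (if m = (fun i => (o i).getD (ρ i)) then (1 : ℝ) else 0) =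
      ∏ i, if m i = (o i).getD (ρ i) then 1 else 0 := by
    intro ρ
    rw [Finset.prod_ite_zero]
    simp [funext_iff]
  simp only [h, expect]
  rw [Finset.prod_div_distrib, Finset.prod_univ_sum, Fintype.piFinset_univ]
  simp

theorem sum_storedProb (o : Fin n → Option Bool) (a : (Fin n → Bool) → ℝ) :
    ∑ m, (∏ i, storedProb (o i) (m i)) * a m =
      expect fun ρ : Fin n → Bool => a fun i => (o i).getD (ρ i) := by
  simp only [prod_storedProb, ← expect_mul_const, ← expect_sum]
  congr 1
  funext ρ
  simp

theorem sum_storedProb_update (o : Fin n → Option Bool) (a : (Fin n → Bool) → ℝ) (j : Fin n) :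
    ∑ m, (∏ i, storedProb (o i) (m i)) * a m = expect fun ρ : Fin n → Bool =>
      storedAvg (o j) fun c => a (Function.update (fun i => (o i).getD (ρ i)) j c) := by
  rw [sum_storedProb, expect_resample j]
  congr 1
  funext ρ
  rw [storedAvg_eq_expect]
  congr 1
  funext u
  congr 1
  funext i
  by_cases h : i = j
  · subst h; simp
  · simp [h]

end Stored

/-! ### Families of functions computed by circuits of polynomial size -/

section UniformComp
variable {α I O Q : ℕ → Type} [∀ l, Fintype (I l)] [∀ l, DecidableEq (I l)] [∀ l, Fintype (O l)]
  [∀ l, DecidableEq (O l)] [∀ l, Fintype (Q l)] [∀ l, DecidableEq (Q l)]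

/-- The functions `F l a` are computed by circuits the size of which is bounded by a polynomial
in `l`. -/
def UniformComp (F : ∀ l, α l → (I l → Bool) → O l → Bool) : Prop :=
  ∃ s, PolyBounded s ∧ ∀ l a, Comp (s l) (F l a)

namespace UniformComp

theorem of_comp {s : ℕ → ℕ} (hs : PolyBounded s) {F : ∀ l, (I l → Bool) → O l → Bool}
    (h : ∀ l, Comp (s l) (F l)) : UniformComp (α := α) fun l _ => F l :=
  ⟨s, hs, fun l _ => h l⟩

theorem comp {G : ∀ l, α l → (O l → Bool) → Q l → Bool}
    {F : ∀ l, α l → (I l → Bool) → O l → Bool} (hG : UniformComp G) (hF : UniformComp F)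
    (hO : PolyBounded fun l => Fintype.card (O l)) :
    UniformComp fun l a x => G l a (F l a x) := by
  obtain ⟨s, hs, h⟩ := hG
  obtain ⟨s', hs', h'⟩ := hF
  exact ⟨_, ((hs'.add hs).add hs').add hO, fun l a => (h l a).comp (h' l a)⟩

theorem prod {F : ∀ l, α l → (I l → Bool) → O l → Bool}
    {G : ∀ l, α l → (I l → Bool) → Q l → Bool} (hF : UniformComp F) (hG : UniformComp G) :
    UniformComp fun l a x => Sum.elim (F l a x) (G l a x) := by
  obtain ⟨s, hs, h⟩ := hF
  obtain ⟨s', hs', h'⟩ := hG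
  exact ⟨_, hs.add hs', fun l a => (h l a).prod (h' l a)⟩

theorem xor {F G : ∀ l, α l → (I l → Bool) → O l → Bool} (hF : UniformComp F)
    (hG : UniformComp G) : UniformComp fun l a x => bxor (F l a x) (G l a x) := by
  obtain ⟨s, hs, h⟩ := hF
  obtain ⟨s', hs', h'⟩ := hG
  exact ⟨_, hs.add hs', fun l a => (h l a).xor (h' l a)⟩

theorem wire (g : ∀ l, α l → O l → I l) (hO : PolyBounded fun l => Fintype.card (O l)) :
    UniformComp fun l a x o => x (g l a o) :=
  ⟨_, hO, fun l a => Comp.wire (g l a)⟩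

theorem bit (g : ∀ l, α l → I l) : UniformComp fun l a x (_ : Unit) => x (g l a) :=
  ⟨_, .const 1, fun l a => Comp.bit (g l a)⟩

theorem consts (c : ∀ l, α l → O l → Bool) (hO : PolyBounded fun l => Fintype.card (O l)) :
    UniformComp fun l a (_ : I l → Bool) o => c l a o :=
  ⟨_, hO, fun l a => Comp.consts (c l a)⟩

theorem const (c : ∀ l, α l → Bool) : UniformComp fun l a (_ : I l → Bool) (_ : Unit) => c l a :=
  ⟨_, .const 1, fun l a => Comp.const (c l a)⟩

theorem and {f g : ∀ l, α l → (I l → Bool) → Unit → Bool} (hf : UniformComp f)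
    (hg : UniformComp g) : UniformComp fun l a x (_ : Unit) => f l a x () && g l a x () := by
  obtain ⟨s, hs, h⟩ := hf
  obtain ⟨s', hs', h'⟩ := hg
  exact ⟨_, ((PolyBounded.const 2).mul (hs.add hs')).add (.const 3),
    fun l a => Comp.and (h l a) (h' l a)⟩

theorem cond {c f g : ∀ l, α l → (I l → Bool) → Unit → Bool} (hc : UniformComp c)
    (hf : UniformComp f) (hg : UniformComp g) :
    UniformComp fun l a x (_ : Unit) => if c l a x () then f l a x () else g l a x () := by
  obtain ⟨s, hs, h⟩ := hf
  obtain ⟨s', hs', h'⟩ := hg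
  obtain ⟨s'', hs'', h''⟩ := hc
  exact ⟨_, (((PolyBounded.const 2).mul (hs''.add (hs.add hs'))).add (.const 3)).add hs',
    fun l a => Comp.cond (h'' l a) (h l a) (h' l a)⟩

theorem dot {n : ℕ → ℕ} {F G : ∀ l, α l → (I l → Bool) → Fin (n l) → Bool} (hF : UniformComp F)
    (hG : UniformComp G) (hn : PolyBounded n) :
    UniformComp fun l a x (_ : Unit) => MeasurementProtocol.dot (F l a x) (G l a x) := by
  obtain ⟨s, hs, h⟩ := hF
  obtain ⟨s', hs', h'⟩ := hG
  exact ⟨_, ((PolyBounded.const 2).mul (hs.add hs')).add ((PolyBounded.const 9).mul hn),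
    fun l a => Comp.dot (h l a) (h' l a)⟩

end UniformComp
end UniformComp

/-! ### The verifier -/

section Decode
variable {D : Domains} {E : ExtendedTCF D} {l : ℕ}

/-- `y` encodes an image of the claw `(x₀, x₁)`. -/
def ClawAt (ω : Coins E l) (y : D.encY.W l → Bool) (x₀ x₁ : D.X l) : Prop :=
  (x₀, x₁) ∈ E.F.R l (E.F.gen l ω.1).1 ∧ ∃ y', D.encY.dec l y = some y' ∧
    E.F.inv l (E.F.gen l ω.1).2 false y' = some x₀ ∧
    E.F.inv l (E.F.gen l ω.1).2 true y' = some x₁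

/-- `y` encodes an image of `(b, x)` under the injective function. -/
def ImageAt (ω : Coins E l) (y : D.encY.W l → Bool) (b : Bool) (x : D.X l) : Prop :=
  ∃ y', D.encY.dec l y = some y' ∧ E.G.inv l (E.G.gen l ω.2).2 y' = some (b, x)

/-- An accepted `y` lies in the support of `f'` at `(b, x)`, and the perfect matching supplies the
partner of `x`; the inversion property then gives both preimages. -/
theorem exists_clawAt {ω : Coins E l} {y : D.encY.W l → Bool} {b : Bool} {x : D.encX.W l → Bool}
    (h : testCheck true ω y b x = true) :
    ∃ x₀ x₁, ClawAt ω y x₀ x₁ ∧ x = D.encX.enc l (if b then x₁ else x₀) := by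
  unfold testCheck at h
  split at h
  · rename_i x' y' hx hy
    rw [if_pos rfl, E.F.chk_iff l _ (E.F.gen_mem l ω.1)] at h
    have hR := E.F.R_perfect l _ (E.F.gen_mem l ω.1)
    rw [← D.encX.enc_of_dec hx]
    cases b
    · obtain ⟨x₁, hx₁, _⟩ := hR.1 x'
      exact ⟨x', x₁, ⟨hx₁, y', hy, E.F.inv_correct_false l ω.1 x' x₁ hx₁ y' h⟩, rfl⟩
    · obtain ⟨x₀, hx₀, _⟩ := hR.2 x'
      have := E.F.inv_correct_true l ω.1 x₀ x' hx₀ y' h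
      exact ⟨x₀, x', ⟨hx₀, y', hy, this.2, this.1⟩, rfl⟩
  · simp at h

/-- For an injective key the inverse returns the bit as well, so an accepted answer has the
committed bit determined by `y`. -/
theorem exists_imageAt {ω : Coins E l} {y : D.encY.W l → Bool} {b : Bool}
    {x : D.encX.W l → Bool} (h : testCheck false ω y b x = true) : ∃ x', ImageAt ω y b x' := by
  unfold testCheck at h
  split at h
  · rename_i x' y' hx hy
    rw [if_neg Bool.false_ne_true, E.G.chk_iff l _ (E.G.gen_mem l ω.2)] at h
    exact ⟨x', y', hy, E.G.inv_correct l ω.2 b x' y' h⟩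
  · simp at h

theorem ClawAt.unique {ω : Coins E l} {y : D.encY.W l → Bool} {x₀ x₁ x₀' x₁' : D.X l}
    (h : ClawAt ω y x₀ x₁) (h' : ClawAt ω y x₀' x₁') : x₀ = x₀' ∧ x₁ = x₁' := by
  obtain ⟨_, z, hz, h₀, h₁⟩ := h
  obtain ⟨_, z', hz', h₀', h₁'⟩ := h'
  rw [hz] at hz'
  obtain rfl := Option.some.inj hz'
  rw [h₀] at h₀'
  rw [h₁] at h₁'
  exact ⟨Option.some.inj h₀', Option.some.inj h₁'⟩

open Classical in
theorem ClawAt.decode {ω : Coins E l} {y : D.encY.W l → Bool} {x₀ x₁ : D.X l}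
    (h : ClawAt ω y x₀ x₁) (b : Bool) (d : Bits (E.F.w l)) :
    MeasurementProtocol.decode true ω y b d =
      if d ∈ E.F.G l (E.F.gen l ω.1).1 false x₀ ∩ E.F.G l (E.F.gen l ω.1).1 true x₁ then
        some (Bool.xor b (dot d (bxor (E.F.J l x₀) (E.F.J l x₁)))) else none := by
  obtain ⟨_, y', hy, h₀, h₁⟩ := h
  simp only [MeasurementProtocol.decode, hy, h₀, h₁, if_true, Bool.and_eq_true, E.F.memG_iff,
    Set.mem_inter_iff]

theorem ImageAt.decode {ω : Coins E l} {y : D.encY.W l → Bool} {b : Bool} {x : D.X l}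
    (h : ImageAt ω y b x) (b' : Bool) (d : Bits (E.F.w l)) :
    MeasurementProtocol.decode false ω y b' d = some b := by
  obtain ⟨y', hy, h₀⟩ := h
  simp [MeasurementProtocol.decode, hy, h₀]

/-- The verifier can compute the inverses of `y`. -/
def Decodable (h : Bool) (ω : Coins E l) (y : D.encY.W l → Bool) : Prop :=
  if h then ∃ x₀ x₁, ClawAt ω y x₀ x₁ else ∃ b x, ImageAt ω y b x

theorem decodable_of_testCheck {h : Bool} {ω : Coins E l} {y : D.encY.W l → Bool} {b : Bool}
    {x : D.encX.W l → Bool} (hc : testCheck h ω y b x = true) : Decodable h ω y := by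
  cases h
  · obtain ⟨x', h'⟩ := exists_imageAt hc
    exact ⟨b, x', h'⟩
  · obtain ⟨x₀, x₁, h', _⟩ := exists_clawAt hc
    exact ⟨x₀, x₁, h'⟩

end Decode

/-! ### Circuits for the decoding of the verifier -/

section DecodeComp
variable {D : Domains} (E : ExtendedTCF D)

/-- The measurement results of the verifier, as functions of the messages of the prover, are
computed by circuits of polynomial size. -/
theorem exists_comp_decode :
    ∃ F : ∀ l, (Bool × Coins E l × Bool) →
        (D.encY.W l ⊕ (Unit ⊕ Fin (E.F.w l)) → Bool) → Unit → Bool,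
      UniformComp F ∧ ∀ l h (ω : Coins E l) u y b d, Decodable h ω y →
        F l (h, ω, u) (Sum.elim y (Sum.elim b d)) () = (decode h ω y (b ()) d).getD u := by
  have hw : PolyBounded fun l => Fintype.card (Fin (E.F.w l)) := E.F.w_poly.mono fun l => by simp
  have hX := D.encX.poly
  have hY := D.encY.poly
  have hTF := E.F.encT.poly
  have hTG := E.G.encT.poly
  have h₁ : PolyBounded fun l => Fintype.card Unit := .const 1
  have hXo : PolyBounded fun l => Fintype.card (Option (D.encX.W l)) :=
    (hX.add (.const 1)).mono fun l => by simp
  have hXo' : PolyBounded fun l => Fintype.card (Option (Unit ⊕ D.encX.W l)) :=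
    (hX.add (.const 2)).mono fun l => by simp; omega
  obtain ⟨s₁, hs₁, F₁, hF₁⟩ := E.F.inv_eff.exists_comp hXo
  obtain ⟨s₂, hs₂, F₂, hF₂⟩ := E.G.inv_eff.exists_comp hXo'
  obtain ⟨s₃, hs₃, F₃, hF₃⟩ := E.F.memG_eff.exists_comp h₁
  obtain ⟨s₄, hs₄, F₄, hF₄⟩ := E.F.J_eff.exists_comp hw
  let α : ℕ → Type := fun l => Bool × Coins E l × Bool
  let I : ℕ → Type := fun l => D.encY.W l ⊕ (Unit ⊕ Fin (E.F.w l))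
  let t : ∀ l, α l → E.F.T l := fun l a => (E.F.gen l a.2.1.1).2
  let k : ∀ l, α l → D.Key l := fun l a => (E.F.gen l a.2.1.1).1
  let t' : ∀ l, α l → E.G.T l := fun l a => (E.G.gen l a.2.1.2).2
  -- The bits of the preimage are read without testing the flag at `none`, so they are right only
  -- when the inverse exists. Hence the restriction to decodable `y`.
  let X : Bool → ∀ l, α l → (I l → Bool) → D.encX.W l → Bool := fun c l a z j =>
    F₁ l (Sum.elim (E.F.encT.enc l (t l a)) (Sum.elim (encBit c) fun j => z (.inl j))) (some j)
  let G : Bool → ∀ l, α l → (I l → Bool) → Unit → Bool := fun c l a z =>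
    F₃ l (Sum.elim (D.encKey.enc l (k l a)) (Sum.elim (E.F.encT.enc l (t l a))
      (Sum.elim (encBit c) (Sum.elim (X c l a z) fun j => z (.inr (.inr j))))))
  let B : ∀ l, α l → (I l → Bool) → Unit → Bool := fun l a z _ =>
    F₂ l (Sum.elim (E.G.encT.enc l (t' l a)) fun j => z (.inl j)) (some (.inl ()))
  let M : ∀ l, α l → (I l → Bool) → Unit → Bool := fun l a z =>
    bxor (fun _ => z (.inr (.inl ()))) fun _ => dot (fun j => z (.inr (.inr j)))
      (bxor (F₄ l (X false l a z)) (F₄ l (X true l a z)))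
  -- The coins, and with them key and trapdoor, are constants of the circuit; only the messages of
  -- the prover are inputs. A string `d` outside the good sets leads to the predrawn bit.
  refine ⟨fun l a z _ => if a.1 then if (G false l a z () && G true l a z ()) then M l a z ()
    else a.2.2 else B l a z (), ?_, ?_⟩
  · have cK : UniformComp fun l (a : α l) (_ : I l → Bool) => D.encKey.enc l (k l a) :=
      UniformComp.consts (fun l a => D.encKey.enc l (k l a)) D.encKey.poly
    have cT : UniformComp fun l (a : α l) (_ : I l → Bool) => E.F.encT.enc l (t l a) :=
      UniformComp.consts (fun l a => E.F.encT.enc l (t l a)) hTF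
    have cT' : UniformComp fun l (a : α l) (_ : I l → Bool) => E.G.encT.enc l (t' l a) :=
      UniformComp.consts (fun l a => E.G.encT.enc l (t' l a)) hTG
    have cB : ∀ c, UniformComp fun l (_ : α l) (_ : I l → Bool) => encBit c := fun c =>
      UniformComp.consts (fun l a => encBit c) h₁
    have wY : UniformComp fun l (_ : α l) (z : I l → Bool) (j : D.encY.W l) => z (.inl j) :=
      UniformComp.wire (α := α) (I := I) (O := D.encY.W) (fun _ _ j => Sum.inl j) hY
    have wD : UniformComp fun l (_ : α l) (z : I l → Bool) (j : Fin (E.F.w l)) =>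
        z (.inr (.inr j)) := UniformComp.wire (α := α) (I := I) (O := fun l => Fin (E.F.w l))
          (fun _ _ j => Sum.inr (Sum.inr j)) hw
    have hX' : ∀ c, UniformComp (X c) := fun c =>
      (UniformComp.wire (α := α) (I := fun l => Option (D.encX.W l)) (O := D.encX.W)
        (fun _ _ j => some j) hX).comp
        ((UniformComp.of_comp hs₁ fun l => (hF₁ l).1).comp
          (cT.prod ((cB c).prod wY))
          ((hTF.add ((PolyBounded.const 1).add hY)).mono fun l => by simp)) hXo
    have hG₁ : ∀ c, UniformComp fun l (a : α l) (z : I l → Bool) =>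
        Sum.elim (D.encKey.enc l (k l a)) (Sum.elim (E.F.encT.enc l (t l a))
          (Sum.elim (encBit c) (Sum.elim (X c l a z) fun j => z (.inr (.inr j))))) := fun c =>
      cK.prod (cT.prod ((cB c).prod ((hX' c).prod wD)))
    have hI : PolyBounded fun l => Fintype.card (D.encKey.W l ⊕ (E.F.encT.W l ⊕
        (Unit ⊕ (D.encX.W l ⊕ Fin (E.F.w l))))) :=
      (D.encKey.poly.add (hTF.add ((PolyBounded.const 1).add (hX.add hw)))).mono fun l => by
        simp only [Fintype.card_sum, Fintype.card_unit]; exact le_rfl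
    have hG' : ∀ c, UniformComp (G c) := fun c =>
      UniformComp.comp (UniformComp.of_comp (α := α) hs₃ fun l => (hF₃ l).1) (hG₁ c) hI
    have hB₁ : UniformComp fun l (a : α l) (z : I l → Bool) =>
        Sum.elim (E.G.encT.enc l (t' l a)) fun j => z (.inl j) := cT'.prod wY
    have hIB : PolyBounded fun l => Fintype.card (E.G.encT.W l ⊕ D.encY.W l) :=
      (hTG.add hY).mono fun l => by simp only [Fintype.card_sum]; exact le_rfl
    have hB₂ := UniformComp.comp (UniformComp.of_comp (α := α) hs₂ fun l => (hF₂ l).1) hB₁ hIB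
    have hbit : UniformComp fun l (_ : α l) (z : Option (Unit ⊕ D.encX.W l) → Bool) (_ : Unit) =>
        z (some (Sum.inl ())) := UniformComp.bit (α := α) fun _ _ => some (Sum.inl ())
    have hB' := UniformComp.comp hbit hB₂ hXo'
    have hJ : ∀ c, UniformComp fun l (a : α l) (z : I l → Bool) => F₄ l (X c l a z) := fun c =>
      UniformComp.comp (UniformComp.of_comp (α := α) hs₄ fun l => (hF₄ l).1) (hX' c) hX
    have hb : UniformComp fun l (_ : α l) (z : I l → Bool) (_ : Unit) => z (.inr (.inl ())) :=
      UniformComp.bit (α := α) (I := I) fun _ _ => Sum.inr (Sum.inl ())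
    have hM' : UniformComp M := hb.xor (UniformComp.dot wD ((hJ false).xor (hJ true)) E.F.w_poly)
    have hc : UniformComp fun l (a : α l) (_ : I l → Bool) (_ : Unit) => a.1 :=
      UniformComp.const (α := α) fun _ a => a.1
    have hu : UniformComp fun l (a : α l) (_ : I l → Bool) (_ : Unit) => a.2.2 :=
      UniformComp.const (α := α) fun _ a => a.2.2
    have e₁ := (hG' false).and (hG' true)
    have e₂ := e₁.cond hM' hu
    have e₄ := hc.cond e₂ hB'
    exact e₄
  · intro l h ω u y b d hd
    cases h
    · obtain ⟨c, x, hI⟩ := hd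
      obtain ⟨y', hy, hi⟩ := id hI
      rw [hI.decode, Option.getD_some]
      change B l (false, ω, u) _ () = c
      have := (hF₂ l).2 ((E.G.gen l ω.2).2, y')
      simp only [hi] at this
      simp only [B, t']
      rw [← D.encY.enc_of_dec hy]
      exact (congrFun this _).trans rfl
    · obtain ⟨x₀, x₁, hc⟩ := hd
      obtain ⟨_, y', hy, h₀, h₁⟩ := hc
      have hX₀ : X false l (true, ω, u) (Sum.elim y (Sum.elim b d)) = D.encX.enc l x₀ := by
        have := (hF₁ l).2 ((E.F.gen l ω.1).2, false, y')
        simp only [h₀] at this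
        funext j
        rw [← D.encY.enc_of_dec hy]
        exact congrFun this (some j)
      have hX₁ : X true l (true, ω, u) (Sum.elim y (Sum.elim b d)) = D.encX.enc l x₁ := by
        have := (hF₁ l).2 ((E.F.gen l ω.1).2, true, y')
        simp only [h₁] at this
        funext j
        rw [← D.encY.enc_of_dec hy]
        exact congrFun this (some j)
      have hG₀ : G false l (true, ω, u) (Sum.elim y (Sum.elim b d)) () =
          E.F.memG l (E.F.gen l ω.1).1 (E.F.gen l ω.1).2 false x₀ d := by
        simp only [G, hX₀]
        exact congrFun ((hF₃ l).2 ((E.F.gen l ω.1).1, (E.F.gen l ω.1).2, false, x₀, d)) ()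
      have hG₁ : G true l (true, ω, u) (Sum.elim y (Sum.elim b d)) () =
          E.F.memG l (E.F.gen l ω.1).1 (E.F.gen l ω.1).2 true x₁ d := by
        simp only [G, hX₁]
        exact congrFun ((hF₃ l).2 ((E.F.gen l ω.1).1, (E.F.gen l ω.1).2, true, x₁, d)) ()
      simp only [hG₀, hG₁, M, hX₀, hX₁, (hF₄ l).2, decode, hy, h₀, h₁, if_true]
      split_ifs <;> rfl

end DecodeComp

/-! ### Phase gates -/

section Phase
variable {W : Type} [Fintype W] [DecidableEq W]

/-- The gate `Z`. -/
def zGate : Matrix.unitaryGroup Bool ℂ :=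
  ⟨Matrix.diagonal fun b => if b then -1 else 1, by
    rw [Matrix.mem_unitaryGroup_iff, star_eq_conjTranspose, diagonal_conjTranspose,
      diagonal_mul_diagonal, ← diagonal_one]
    congr 1
    funext b
    cases b <;> simp⟩

theorem zGate_mulVec (q : W) (f : (W → Bool) → ℂ) (z : W → Bool) :
    ((Gate.single q zGate).toMatrix *ᵥ f) z = (if z q then -1 else 1) * f z := by
  rw [Gate.single_mulVec, Fintype.sum_bool]
  have h : ∀ b, z q = b → Function.update z q b = z := by rintro b rfl; simp
  cases hq : z q <;> simp [zGate, h _ hq]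

/-- The operator `Z^r`. -/
def Circuit.phases {n : ℕ} (c : Fin n → W) (r : Fin n → Bool) : Circuit W :=
  (List.finRange n).flatMap fun i => if r i then [.single (c i) zGate] else []

theorem Circuit.length_phases {n : ℕ} (c : Fin n → W) (r : Fin n → Bool) :
    (Circuit.phases c r).length ≤ n := by
  rw [Circuit.phases, List.length_flatMap]
  calc _ ≤ ((List.finRange n).map fun _ => 1).sum := by
        refine List.sum_le_sum fun i _ => ?_
        split_ifs <;> simp
    _ = n := by simp

theorem Circuit.phases_mulVec {n : ℕ} (c : Fin n → W) (r : Fin n → Bool) (f : (W → Bool) → ℂ)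
    (z : W → Bool) :
    (Circuit.toMatrix (Circuit.phases c r) *ᵥ f) z = chi r (z ∘ c) * f z := by
  have key : ∀ (L : List (Fin n)) f, (Circuit.toMatrix (L.flatMap fun i =>
      if r i then [Gate.single (c i) zGate] else []) *ᵥ f) z =
        (L.map fun i => if r i && z (c i) then (-1 : ℂ) else 1).prod * f z := by
    intro L
    induction L with
    | nil => intro f; simp [Circuit.toMatrix_nil]
    | cons i L ih =>
      intro f
      rw [List.flatMap_cons, Circuit.toMatrix_append, ← mulVec_mulVec, ih, List.map_cons,
        List.prod_cons]
      cases hr : r i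
      · simp [Circuit.toMatrix_nil]
      · rw [if_pos rfl, Circuit.toMatrix_singleton, zGate_mulVec, Bool.true_and]
        ring
  rw [Circuit.phases, key, chi, ← List.prod_ofFn, List.ofFn_eq_map]
  rfl

end Phase

/-! ### Running an algorithm on measurement results -/

section Run
variable {Pw Rec I : Type} [Fintype Pw] [DecidableEq Pw] [Fintype Rec] [DecidableEq Rec]
  [Fintype I] [DecidableEq I]

/-- The qubits of an attacker: those of the prover, a record, and those of an algorithm. -/
abbrev RunWire (Pw Rec I : Type) (a : ℕ) : Type := Pw ⊕ (Rec ⊕ (I ⊕ (Unit ⊕ Fin a)))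

/-- A state in which the qubits of the algorithm are zero. -/
def runState {a : ℕ} (φ : (Rec → Bool) → (Pw → Bool) → ℂ) : (RunWire Pw Rec I a → Bool) → ℂ :=
  fun v => if (fun e => v (.inr (.inr e))) = fun _ => false then
    φ (fun s => v (.inr (.inl s))) fun p => v (.inl p) else 0

theorem runState_elim {a : ℕ} (φ : (Rec → Bool) → (Pw → Bool) → ℂ) (p s)
    (e : I ⊕ (Unit ⊕ Fin a) → Bool) : runState φ (Sum.elim p (Sum.elim s e)) =
      if e = fun _ => false then φ s p else 0 := rfl

theorem inputWire_injective {a : ℕ} : Function.Injective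
    (Sum.elim (Sum.elim Sum.inl (Sum.inr ∘ Sum.inl)) (Sum.inr ∘ Sum.inr ∘ Sum.inl) :
      (Pw ⊕ Rec) ⊕ I → RunWire Pw Rec I a) := by
  rintro ((a | a) | a) ((b | b) | b) h <;> simp_all

theorem algWire_injective {a : ℕ} : Function.Injective
    (Sum.inr ∘ Sum.inr : I ⊕ (Unit ⊕ Fin a) → RunWire Pw Rec I a) :=
  Sum.inr_injective.comp Sum.inr_injective

/-- Computation of the input of the algorithm. -/
def inputOp {a : ℕ} (F : (Pw ⊕ Rec → Bool) → I → Bool) :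
    Matrix (RunWire Pw Rec I a → Bool) (RunWire Pw Rec I a → Bool) ℂ :=
  lift (Sum.elim (Sum.elim Sum.inl (Sum.inr ∘ Sum.inl)) (Sum.inr ∘ Sum.inr ∘ Sum.inl)) (oracle F)

theorem inputOp_mulVec {a : ℕ} (F : (Pw ⊕ Rec → Bool) → I → Bool)
    (f : (RunWire Pw Rec I a → Bool) → ℂ) (p s i) (t : Unit ⊕ Fin a → Bool) :
    (inputOp F *ᵥ f) (Sum.elim p (Sum.elim s (Sum.elim i t))) =
      f (Sum.elim p (Sum.elim s (Sum.elim (bxor i (F (Sum.elim p s))) t))) := by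
  rw [inputOp, lift_oracle_mulVec inputWire_injective,
    extend_inr_comp (Sum.inr_injective.comp Sum.inl_injective), extend_inr_comp Sum.inl_injective,
    extend_inl]
  have h₁ : Sum.elim p (Sum.elim s (Sum.elim i t)) ∘ Sum.elim Sum.inl (Sum.inr ∘ Sum.inl) =
      Sum.elim p s := by
    funext q; rcases q with q | q <;> rfl
  rw [h₁]
  rfl

theorem lift_algWire_mulVec {a : ℕ} (M : Matrix (I ⊕ (Unit ⊕ Fin a) → Bool) _ ℂ)
    (f : (RunWire Pw Rec I a → Bool) → ℂ) (p s e) :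
    (lift (Sum.inr ∘ Sum.inr) M *ᵥ f) (Sum.elim p (Sum.elim s e)) =
      (M *ᵥ fun e => f (Sum.elim p (Sum.elim s e))) e := by
  rw [lift_mulVec algWire_injective]
  simp only [extend_inr_comp Sum.inr_injective, extend_inr]
  rfl

theorem lift_inl_mulVec {V A : Type} [Fintype V] [DecidableEq V] [Fintype A] [DecidableEq A]
    (M : Matrix (V → Bool) (V → Bool) ℂ) (f : (V ⊕ A → Bool) → ℂ) (p s) :
    (lift Sum.inl M *ᵥ f) (Sum.elim p s) = (M *ᵥ fun p => f (Sum.elim p s)) p := by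
  rw [lift_mulVec Sum.inl_injective]
  simp only [extend_inl]
  rfl

variable (A : QAlg I Unit) (F : (Pw ⊕ Rec → Bool) → I → Bool)
  (N : Matrix (Pw → Bool) (Pw → Bool) ℂ) (φ : (Rec → Bool) → (Pw → Bool) → ℂ)

/-- The unitary which applies `N` and runs the algorithm. -/
def runOp : Matrix (RunWire Pw Rec I A.anc → Bool) (RunWire Pw Rec I A.anc → Bool) ℂ :=
  lift (Sum.inr ∘ Sum.inr) (Circuit.toMatrix A.circ) * (inputOp F * lift Sum.inl N)

/-- The phase kickback of the algorithm. -/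
def kickback : Circuit (I ⊕ (Unit ⊕ Fin A.anc)) :=
  A.circ ++ (.single (.inr (.inl ())) zGate :: Circuit.inv A.circ)

/-- The unitary which applies `N`, a phase depending on the result of the algorithm, and the
inverse of `N`. -/
def reflectOp : Matrix (RunWire Pw Rec I A.anc → Bool) (RunWire Pw Rec I A.anc → Bool) ℂ :=
  lift Sum.inl Nᴴ * (inputOp F * (lift (Sum.inr ∘ Sum.inr) (Circuit.toMatrix (kickback A)) *
    (inputOp F * lift Sum.inl N)))

theorem elim_bxor_eq_false_iff {a : Type} (i m : I → Bool) (t : a → Bool) :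
    (Sum.elim (bxor i m) t = fun _ => false) ↔ Sum.elim i t = Sum.elim m fun _ => false := by
  rw [elim_eq_const, Sum.elim_eq_iff]
  exact and_congr_left' (bxor_eq_false_iff i m)

theorem inputOp_runState {a : ℕ} (p s) (e : I ⊕ (Unit ⊕ Fin a) → Bool) :
    ((inputOp F * lift Sum.inl N) *ᵥ runState φ) (Sum.elim p (Sum.elim s e)) =
      (N *ᵥ φ s) p * (Pi.single (Sum.elim (F (Sum.elim p s)) fun _ => false) (1 : ℂ) :
        (I ⊕ (Unit ⊕ Fin a) → Bool) → ℂ) e := by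
  have h : e = Sum.elim (e ∘ Sum.inl) (e ∘ Sum.inr) := (Sum.elim_comp_inl_inr e).symm
  rw [h, ← mulVec_mulVec, inputOp_mulVec, lift_inl_mulVec]
  simp only [runState_elim, elim_bxor_eq_false_iff]
  rw [ProverAt.mulVec_ite, Pi.single_apply]
  split_ifs <;> simp

theorem mulVec_const_mul {α : Type} [Fintype α] (M : Matrix α α ℂ) (c : ℂ) (f : α → ℂ) (x : α) :
    (M *ᵥ fun y => c * f y) x = c * (M *ᵥ f) x :=
  congrFun (mulVec_smul M c f) x

theorem runOp_mulVec (p s) (e : I ⊕ (Unit ⊕ Fin A.anc) → Bool) :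
    (runOp A F N *ᵥ runState φ) (Sum.elim p (Sum.elim s e)) =
      (N *ᵥ φ s) p * A.finalState (F (Sum.elim p s)) e := by
  rw [runOp, ← mulVec_mulVec, lift_algWire_mulVec]
  simp only [inputOp_runState]
  rw [mulVec_const_mul, QAlg.finalState_eq]

theorem reflectOp_mulVec (p s i) (t : Unit ⊕ Fin A.anc → Bool) :
    (reflectOp A F N *ᵥ runState φ) (Sum.elim p (Sum.elim s (Sum.elim i t))) =
      (Nᴴ *ᵥ fun p => (N *ᵥ φ s) p * Circuit.toMatrix (kickback A)
        (Sum.elim (bxor i (F (Sum.elim p s))) t)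
        (Sum.elim (F (Sum.elim p s)) fun _ => false)) p := by
  rw [reflectOp, ← mulVec_mulVec, ← mulVec_mulVec, ← mulVec_mulVec, lift_inl_mulVec]
  simp only [inputOp_mulVec, lift_algWire_mulVec, inputOp_runState, mulVec_const_mul]
  simp only [mulVec_single_one]
  rfl

/-- The entry is the expectation of Z on the output qubit of the algorithm, the probability of 0
minus that of 1. -/
theorem kickback_apply (m : I → Bool) :
    Circuit.toMatrix (kickback A) (Sum.elim m fun _ => false) (Sum.elim m fun _ => false) =
      ((2 * A.prob m (fun _ => false) - 1 : ℝ) : ℂ) := by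
  have h₁ := A.sum_prob_mul m fun z => if z () then -1 else 1
  have h₂ : (2 * A.prob m (fun _ => false) - 1 : ℝ) =
      ∑ v, ‖A.finalState m v‖ ^ 2 * if v (.inr (.inl ())) then -1 else 1 := by
    rw [← h₁, sum_bit, A.prob_true]
    simp
    ring
  rw [h₂, kickback, Circuit.toMatrix_append, Circuit.toMatrix_cons, Circuit.toMatrix_inv]
  have h₃ : ∀ (M : Matrix (I ⊕ (Unit ⊕ Fin A.anc) → Bool) (I ⊕ (Unit ⊕ Fin A.anc) → Bool) ℂ) x y,
      M x y = (M *ᵥ Pi.single y 1) x := fun M x y => by rw [mulVec_single_one]; rfl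
  refine (h₃ _ _ _).trans ?_
  rw [← mulVec_mulVec, ← mulVec_mulVec, ← A.finalState_eq, mulVec, dotProduct,
    Complex.ofReal_sum]
  refine Finset.sum_congr rfl fun v _ => ?_
  rw [zGate_mulVec, conjTranspose_apply]
  change star (A.finalState m v) * _ = _
  rw [mul_left_comm, Complex.star_def, Complex.conj_mul']
  push_cast
  split_ifs <;> simp

/-- On the component in which the qubits of the algorithm return to zero, the reflection multiplies
by the bias of the verdict between `N` and its inverse. Thus a probabilistic verdict acts as a
weight on amplitudes. -/
theorem reflectOp_mulVec_zero (p s) :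
    (reflectOp A F N *ᵥ runState φ) (Sum.elim p (Sum.elim s fun _ => false)) =
      (Nᴴ *ᵥ fun p => (N *ᵥ φ s) p *
        ((2 * A.prob (F (Sum.elim p s)) (fun _ => false) - 1 : ℝ) : ℂ)) p := by
  have h : (fun _ => false : I ⊕ (Unit ⊕ Fin A.anc) → Bool) =
      Sum.elim (fun _ => false) fun _ => false := ((elim_eq_const _ _ _).2 ⟨rfl, rfl⟩).symm
  rw [h, reflectOp_mulVec]
  simp only [bxor_comm' (fun _ => false), bxor_false, kickback_apply]

theorem reflectOp_mulVec_eq_zero {s : Rec → Bool} (hs : ∀ p, φ s p = 0) (p)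
    (e : I ⊕ (Unit ⊕ Fin A.anc) → Bool) :
    (reflectOp A F N *ᵥ runState φ) (Sum.elim p (Sum.elim s e)) = 0 := by
  have h : e = Sum.elim (e ∘ Sum.inl) (e ∘ Sum.inr) := (Sum.elim_comp_inl_inr e).symm
  have h₁ : φ s = 0 := funext hs
  rw [h, reflectOp_mulVec]
  simp only [h₁, mulVec_zero, Pi.zero_apply, zero_mul]
  exact congrFun (mulVec_zero _) p

theorem IsUnitary.reflectOp {N : Matrix (Pw → Bool) (Pw → Bool) ℂ} (hN : IsUnitary N) :
    IsUnitary (reflectOp A F N) := by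
  have h : IsUnitary (inputOp F : Matrix (RunWire Pw Rec I A.anc → Bool) _ ℂ) :=
    (IsUnitary.basisMap (involutive_xorMap F)).lift inputWire_injective
  exact (hN.conjTranspose.lift Sum.inl_injective).mul
    (h.mul (((Circuit.isUnitary _).lift algWire_injective).mul
      (h.mul (hN.lift Sum.inl_injective))))

theorem impl_runOp {s s' : ℕ} (hN : Impl s N) (hF : Comp s' F) :
    Impl (A.circ.length + (s' + s)) (runOp A F N) :=
  ((Impl.circuit _).lift algWire_injective).mul
    ((hF.lift inputWire_injective).mul (hN.lift Sum.inl_injective))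

theorem impl_reflectOp {s s' : ℕ} (hN : Impl s N) (hN' : Impl s Nᴴ) (hF : Comp s' F) :
    Impl (s + (s' + (A.circ.length + (1 + A.circ.length) + (s' + s)))) (reflectOp A F N) := by
  refine (hN'.lift Sum.inl_injective).mul ((hF.lift inputWire_injective).mul
    (Impl.mul (Impl.lift algWire_injective ?_)
      ((hF.lift inputWire_injective).mul (hN.lift Sum.inl_injective))))
  refine (Impl.circuit _).mono ?_
  simp only [kickback, List.length_append, List.length_cons, Circuit.length_inv]
  omega

end Run

/-! ### Simulation of the test round -/

section Simulation
variable {D : Domains} {E : ExtendedTCF D} {n l : ℕ}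

theorem extend_bxor_eq_extend_iff {V W : Type} [Fintype V] [DecidableEq V] [Fintype W]
    [DecidableEq W] {i : V → W} (hi : Function.Injective i) (x t : V → Bool) (p : W → Bool) :
    Function.extend i (bxor (p ∘ i) x) p = Function.extend i t (fun _ => false) ↔
      p = Function.extend i (bxor t x) fun _ => false := by
  constructor
  · intro h
    have h₁ : bxor (p ∘ i) x = t := by
      rw [← extend_comp' hi (bxor (p ∘ i) x) p, h, extend_comp' hi]
    rw [← h₁, bxor_bxor_self, ← extend_extend' hi (p ∘ i) t, ← h, extend_extend' hi,
      extend_self' hi]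
  · rintro rfl
    rw [extend_comp' hi, bxor_bxor_self, extend_extend' hi]

/-- The record of the attacker: the commitment strings, and the values of one committed qubit and
its preimage register. -/
abbrev RecWire (D : Domains) (n l : ℕ) : Type :=
  (Fin n × D.encY.W l) ⊕ (Unit ⊕ D.encX.W l)

/-- The `j`-th committed qubit and preimage register. -/
def answerWire (E : ExtendedTCF D) (n l aux : ℕ) (j : Fin n) :
    Unit ⊕ D.encX.W l → ProverWire E n l aux :=
  Sum.elim (fun _ => .committed j) fun x => .preimage j x

namespace ProverAt
variable (P : ProverAt E n l) (j : Fin n) (a : ℕ)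

/-- The wires of the attacker. -/
abbrev AttackerWire : Type := RunWire (ProverWire E n l P.aux) (RecWire D n l) (Fin n) a

/-- The register of the `j`-th key. -/
def guessKeyWire : D.encKey.W l → P.AttackerWire a := fun q => .inl (.key j q)

theorem guessKeyWire_injective : Function.Injective (P.guessKeyWire j a) := fun q q' h => by
  simpa [guessKeyWire] using h

theorem keyConst_injective : Function.Injective (Sum.elim Empty.elim
    (keyWire (D.encX.W l) (Fin (E.F.w l)) (D.encY.W l) P.aux) :
      Empty ⊕ (Fin n × D.encKey.W l) → _) := by
  rintro (q | q) (q' | q') h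
  · exact q.elim
  · exact q.elim
  · exact q'.elim
  · exact congrArg _ (keyWire_injective h)

/-- The simulation of the test round, given the keys other than the `j`-th one. -/
def simulateOp (k : Fin n → D.Key l) :
    Matrix (P.AttackerWire a → Bool) (P.AttackerWire a → Bool) ℂ :=
  Circuit.toMatrix (Circuit.copy (W := P.AttackerWire a) (Sum.inl ∘ answerWire E n l P.aux j)
    (Sum.inr ∘ Sum.inl ∘ Sum.inr) nofun) *
  (lift Sum.inl (Circuit.toMatrix P.test) *
  (Circuit.toMatrix (Circuit.copy (W := P.AttackerWire a) (Sum.inl ∘ imageWire _ _ _ _)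
    (Sum.inr ∘ Sum.inl ∘ Sum.inl) nofun) *
  (lift Sum.inl (Circuit.toMatrix P.commit) *
  lift Sum.inl (lift (Sum.elim Empty.elim (keyWire _ _ _ _)) (oracle
    fun _ q => if q.1 = j then false else D.encKey.enc l (k q.1) q.2)))))

theorem impl_simulateOp (k : Fin n → D.Key l) :
    Impl (1 + Fintype.card (D.encX.W l) + (P.test.length + (n * Fintype.card (D.encY.W l) +
      (P.commit.length + n * Fintype.card (D.encKey.W l))))) (P.simulateOp j a k) := by
  refine Impl.mul ?_ (Impl.mul ((Impl.circuit _).lift Sum.inl_injective) (Impl.mul ?_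
    (Impl.mul ((Impl.circuit _).lift Sum.inl_injective) ?_)))
  · refine (Impl.circuit _).mono ?_
    rw [Circuit.length_copy]; simp
  · refine (Impl.circuit _).mono ?_
    rw [Circuit.length_copy]; simp
  · refine Impl.lift Sum.inl_injective (Impl.mono ((Comp.consts _).lift P.keyConst_injective) ?_)
    simp

/-- The state of the prover and the record after the simulation of the test round. -/
def recordState (k : Fin n → D.Key l) (s : RecWire D n l → Bool)
    (p : ProverWire E n l P.aux → Bool) : ℂ :=
  if s ∘ Sum.inr = p ∘ answerWire E n l P.aux j then
    P.testState k (fun i q => s (.inl (i, q))) p else 0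

/-- The j-th key register carries the input of the attacker and the other keys are added as
constants, so `k'` matters only off `j`. Copying `y` before `test` and the j-th answer after it
implements the two measurements in deferred form. -/
theorem simulateOp_mulVec {k k' : Fin n → D.Key l} (hk : ∀ i, i ≠ j → k' i = k i) :
    P.simulateOp j a k' *ᵥ Pi.single (Function.extend (P.guessKeyWire j a)
      (D.encKey.enc l (k j)) fun _ => false) 1 = runState (P.recordState j k) := by
  have hkey : ∀ p q, (lift Sum.inl (lift (Sum.elim Empty.elim
      (keyWire (D.encX.W l) (Fin (E.F.w l)) (D.encY.W l) P.aux)) (oracle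
        fun _ q => if q.1 = j then false else D.encKey.enc l (k' q.1) q.2)) *ᵥ
      Pi.single (Function.extend (P.guessKeyWire j a)
        (D.encKey.enc l (k j)) fun _ => false) 1) (Sum.elim p q) =
      if q = fun _ => false then
        (Pi.single (initial k) (1 : ℂ) : (ProverWire E n l P.aux → Bool) → ℂ) p else 0 := by
    intro p q
    have h₁ : Function.extend (P.guessKeyWire j a) (D.encKey.enc l (k j)) (fun _ => false) =
        Sum.elim (Function.extend (fun q => .key j q) (D.encKey.enc l (k j)) fun _ => false)
          fun _ => false := by
      rw [← extend_inl_comp (fun q q' h => by simpa using h), elim_eq_const _ _ _ |>.2 ⟨rfl, rfl⟩]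
      rfl
    have h₂ : ∀ p : ProverWire E n l P.aux → Bool,
        (Function.extend (keyWire _ _ _ _) (bxor (p ∘ keyWire _ _ _ _) fun q =>
          if q.1 = j then false else D.encKey.enc l (k' q.1) q.2) p =
          Function.extend (fun q => .key j q) (D.encKey.enc l (k j)) fun _ => false) ↔
        p = initial k := by
      intro p
      have h₃ : Function.extend (fun q => (.key j q : ProverWire E n l P.aux))
          (D.encKey.enc l (k j)) (fun _ => false) = Function.extend (keyWire _ _ _ _)
            (fun q => if q.1 = j then D.encKey.enc l (k j) q.2 else false) fun _ => false := by
        symm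
        refine extend_eq_of keyWire_injective ?_ ?_
        · rintro ⟨i, q⟩
          simp only [keyWire]
          split_ifs with h
          · subst h
            exact Function.Injective.extend_apply (fun q q' h => by simpa using h) _ _ q
          · rw [Function.extend_apply']
            rintro ⟨q', hq'⟩
            injection hq' with h₁
            exact h h₁.symm
        · intro q hq
          rw [Function.extend_apply']
          rintro ⟨q', rfl⟩
          exact hq (j, q') rfl
      rw [h₃, extend_bxor_eq_extend_iff keyWire_injective, initial_eq]
      refine iff_of_eq (congrArg (p = ·) (congrArg (fun t => Function.extend _ t _) ?_))
      funext ⟨i, q⟩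
      by_cases h : i = j
      · subst h; simp [bxor]
      · simp [bxor, h, hk i h]
    rw [lift_inl_mulVec, lift_oracle_mulVec P.keyConst_injective, h₁]
    simp only [Pi.single_apply, Sum.elim_eq_iff, h₂]
    split_ifs <;> simp_all
  refine sum_ext₃ fun p s e => ?_
  have hs : s = Sum.elim (s ∘ Sum.inl) (s ∘ Sum.inr) := (Sum.elim_comp_inl_inr s).symm
  rw [hs, simulateOp]
  simp only [← mulVec_mulVec]
  have hd₁ : Function.Injective (Sum.inr ∘ Sum.inl ∘ Sum.inr :
      Unit ⊕ D.encX.W l → P.AttackerWire a) :=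
    Sum.inr_injective.comp (Sum.inl_injective.comp Sum.inr_injective)
  have hd₂ : Function.Injective (Sum.inr ∘ Sum.inl ∘ Sum.inl :
      Fin n × D.encY.W l → P.AttackerWire a) :=
    Sum.inr_injective.comp (Sum.inl_injective.comp Sum.inl_injective)
  have c₁ : ∀ (f : (P.AttackerWire a → Bool) → ℂ) p y t e,
      (Circuit.toMatrix (Circuit.copy (W := P.AttackerWire a) (Sum.inl ∘ answerWire E n l P.aux j)
        (Sum.inr ∘ Sum.inl ∘ Sum.inr) nofun) *ᵥ f) (Sum.elim p (Sum.elim (Sum.elim y t) e)) =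
      f (Sum.elim p (Sum.elim (Sum.elim y (bxor t (p ∘ answerWire E n l P.aux j))) e)) := by
    intro f p y t e
    rw [Circuit.copy_mulVec _ hd₁, extend_inr_comp (Sum.inl_injective.comp Sum.inr_injective),
      extend_inl_comp Sum.inr_injective, extend_inr]
    rfl
  have c₂ : ∀ (f : (P.AttackerWire a → Bool) → ℂ) p y t e,
      (Circuit.toMatrix (Circuit.copy (W := P.AttackerWire a) (Sum.inl ∘ imageWire _ _ _ _)
        (Sum.inr ∘ Sum.inl ∘ Sum.inl) nofun) *ᵥ f) (Sum.elim p (Sum.elim (Sum.elim y t) e)) =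
      f (Sum.elim p (Sum.elim (Sum.elim (bxor y (p ∘ imageWire _ _ _ _)) t) e)) := by
    intro f p y t e
    rw [Circuit.copy_mulVec _ hd₂, extend_inr_comp (Sum.inl_injective.comp Sum.inl_injective),
      extend_inl_comp Sum.inl_injective, extend_inl]
    rfl
  rw [c₁]
  simp only [lift_inl_mulVec, c₂, hkey, mulVec_ite, elim_eq_const, bxor_eq_false_iff]
  rw [runState_elim, recordState]
  have ha : Sum.elim (s ∘ Sum.inl) (s ∘ Sum.inr) ∘ Sum.inr = s ∘ Sum.inr := rfl
  rw [ha]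
  by_cases he : (e = fun _ => false) ∧ s ∘ Sum.inr = p ∘ answerWire E n l P.aux j
  · simp only [he.1, he.2, and_true, if_true]
    rw [testState]
    congr 1
    funext p'
    rw [committedState_eq]
    refine if_congr ?_ rfl rfl
    simp only [funext_iff, Prod.forall]
    exact forall₂_congr fun i q => eq_comm
  · have h₀ : ∀ q : Prop, ¬ ((q ∧ s ∘ Sum.inr = p ∘ answerWire E n l P.aux j) ∧
        e = fun _ => false) := fun q h => he ⟨h.2, h.1.2⟩
    simp only [h₀, if_false]
    refine (congrFun (mulVec_zero _) p).trans ?_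
    rw [← ite_and, if_neg he]
    rfl

end ProverAt
end Simulation

/-! ### Signs -/

section Sign
variable {n : ℕ}

/-- `(-1)^b`. -/
def bitSign (b : Bool) : ℝ := if b then -1 else 1

theorem bitSign_dot (d z : Bits n) : bitSign (dot d z) = ∏ i, bitSign (d i && z i) := by
  simp only [bitSign, Bool.and_eq_true]
  rw [Finset.prod_ite, Finset.prod_const, Finset.prod_const_one, mul_one, dot]
  rcases Nat.even_or_odd (Finset.univ.filter fun i => d i = true ∧ z i = true).card with h | h
  · rw [h.neg_one_pow, if_neg]
    simp [Nat.even_iff.1 h]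
  · rw [h.neg_one_pow, if_pos]
    simp [Nat.odd_iff.1 h]

theorem bitSign_mul (a b : Bool) : bitSign a * bitSign b = if a = b then 1 else -1 := by
  cases a <;> cases b <;> simp [bitSign]

/-- Orthogonality of characters: the sum factors over the coordinates, and a coordinate in which `a`
and `b` differ contributes zero. -/
theorem sum_bitSign_dot (a b : Bits n) :
    ∑ d : Bits n, (if dot d a = dot d b then (1 : ℝ) else -1) = if a = b then 2 ^ n else 0 := by
  simp only [← bitSign_mul, bitSign_dot, ← Finset.prod_mul_distrib]
  have h := Finset.prod_univ_sum (fun _ : Fin n => (Finset.univ : Finset Bool))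
    fun i c => bitSign (c && a i) * bitSign (c && b i)
  rw [Fintype.piFinset_univ] at h
  rw [← h]
  have h₁ : ∀ i, ∑ c, bitSign (c && a i) * bitSign (c && b i) = if a i = b i then 2 else 0 := by
    intro i
    rw [Fintype.sum_bool]
    cases a i <;> cases b i <;> simp [bitSign] <;> norm_num
  simp only [h₁, Finset.prod_ite_zero]
  simp [funext_iff]

end Sign

/-! ### The score of a guess of the hardcore bit -/

section Guess
variable {D : Domains} (F : NTCF D) {l : ℕ}

open Classical in
/-- The contribution of a guess to the advantage. -/
def NTCF.guessSign (l : ℕ) (k : D.Key l) (z : F.GuessWire l → Bool) : ℝ :=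
  (if z ∈ F.guessSet l k false then 1 else 0) - if z ∈ F.guessSet l k true then 1 else 0

/-- One preimage determines the other through the matching and encodings are injective, so a string
encodes a guess about one claw only. -/
theorem NTCF.mem_guessSet {k : D.Key l} (hk : k ∈ F.K l) {x₀ x₁ : D.X l} (hx : (x₀, x₁) ∈ F.R l k)
    (b : Bool) (d : Bits (F.w l)) (s c : Bool) :
    Sum.elim (fun _ => b) (Sum.elim (D.encX.enc l (if b then x₁ else x₀))
      (Sum.elim d fun _ => s)) ∈ F.guessSet l k c ↔
    d ∈ F.G l k false x₀ ∩ F.G l k true x₁ ∧ s = xor c (dot d (bxor (F.J l x₀) (F.J l x₁))) := by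
  constructor
  · rintro ⟨b', x₀', x₁', d', hx', hd', h⟩
    simp only [Sum.elim_eq_iff] at h
    obtain ⟨hb, hxe, rfl, hs⟩ := h
    obtain rfl : b = b' := congrFun hb ()
    have hxe := D.encX.inj l hxe
    have h : x₀ = x₀' ∧ x₁ = x₁' := by
      cases b
      · obtain rfl : x₀ = x₀' := hxe
        exact ⟨rfl, ((F.R_perfect l k hk).1 x₀).unique hx hx'⟩
      · obtain rfl : x₁ = x₁' := hxe
        exact ⟨((F.R_perfect l k hk).2 x₁).unique hx hx', rfl⟩
    obtain ⟨rfl, rfl⟩ := h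
    exact ⟨hd', congrFun hs ()⟩
  · rintro ⟨hd, rfl⟩
    exact ⟨b, x₀, x₁, d, hx, hd, rfl⟩

open Classical in
theorem NTCF.guessSign_eq {k : D.Key l} (hk : k ∈ F.K l) {x₀ x₁ : D.X l}
    (hx : (x₀, x₁) ∈ F.R l k) (b : Bool) (d : Bits (F.w l)) (s : Bool) :
    F.guessSign l k (Sum.elim (fun _ => b) (Sum.elim (D.encX.enc l (if b then x₁ else x₀))
      (Sum.elim d fun _ => s))) =
    if d ∈ F.G l k false x₀ ∩ F.G l k true x₁ then
      if s = dot d (bxor (F.J l x₀) (F.J l x₁)) then 1 else -1 else 0 := by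
  simp only [guessSign, F.mem_guessSet hk hx]
  by_cases hd : d ∈ F.G l k false x₀ ∩ F.G l k true x₁
  · simp only [hd, true_and]
    cases s <;> cases dot d (bxor (F.J l x₀) (F.J l x₁)) <;> simp
  · simp [hd]

theorem NTCF.advantage_eq {W : Type} [Fintype W] [DecidableEq W]
    {A : QAlg (D.encKey.W l) (F.GuessWire l)}
    {amp : Bits (F.coins l) → (W → Bool) → ℂ} {G : (W → Bool) → F.GuessWire l → Bool}
    (h : ∀ u z, A.prob (D.encKey.enc l (F.gen l u).1) z =
      ∑ v, if G v = z then ‖amp u v‖ ^ 2 else 0) :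
    F.advantage l A = expect fun u => ∑ v, ‖amp u v‖ ^ 2 * F.guessSign l (F.gen l u).1 (G v) := by
  classical
  have key : ∀ u (S : Set (F.GuessWire l → Bool)),
      A.probMem (D.encKey.enc l (F.gen l u).1) S =
        ∑ v, ‖amp u v‖ ^ 2 * if G v ∈ S then 1 else 0 := by
    intro u S
    simp only [QAlg.probMem, h]
    have : ∀ z, (if z ∈ S then ∑ v, (if G v = z then ‖amp u v‖ ^ 2 else 0) else 0) =
        ∑ v, if G v = z then (if z ∈ S then ‖amp u v‖ ^ 2 else 0) else 0 := by
      intro z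
      split_ifs <;> simp
    rw [Finset.sum_congr rfl fun z _ => this z, Finset.sum_comm]
    refine Finset.sum_congr rfl fun v _ => ?_
    rw [Finset.sum_eq_single (G v)]
    · simp
    · intro z _ hz; rw [if_neg hz.symm]
    · simp
  rw [advantage, ← expect_sub]
  congr 1
  funext u
  rw [key, key, ← Finset.sum_sub_distrib]
  refine Finset.sum_congr rfl fun v _ => ?_
  rw [guessSign]
  convert (mul_sub _ _ _).symm

open Classical in
/-- The average over `d` of the contribution of a guess of the form `(b, x, d, d · (z ⊕ z'))`. -/
theorem NTCF.sum_guessSign_ge {k : D.Key l} (hk : k ∈ F.K l) {x₀ x₁ : D.X l}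
    (hx : (x₀, x₁) ∈ F.R l k) (b : Bool) (z : Bits (F.w l)) {μ : ℝ}
    (hμ : ∀ b x, ((F.G l k b x)ᶜ.ncard : ℝ) / 2 ^ F.w l ≤ μ) :
    (if z = F.J l (if b then x₀ else x₁) then 1 else 0) - 2 * μ ≤
    expect fun d : Bits (F.w l) => F.guessSign l k (Sum.elim (fun _ => b)
      (Sum.elim (D.encX.enc l (if b then x₁ else x₀))
        (Sum.elim d fun _ => dot d (bxor (F.J l (if b then x₁ else x₀)) z)))) := by
  set B : Set (Bits (F.w l)) := F.G l k false x₀ ∩ F.G l k true x₁ with hB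
  set t : Bits (F.w l) := bxor (F.J l (if b then x₁ else x₀)) z
  set t' : Bits (F.w l) := bxor (F.J l x₀) (F.J l x₁)
  have ht : t = t' ↔ z = F.J l (if b then x₀ else x₁) := by
    constructor
    · intro h
      have h₁ := congrArg (fun v => bxor v (F.J l (if b then x₁ else x₀))) h
      simp only [t, t'] at h₁
      rw [bxor_comm' (F.J l _) z, bxor_bxor_self] at h₁
      rw [h₁]
      cases b
      · simp only [Bool.false_eq_true, if_false]
        rw [bxor_comm' (F.J l x₀) (F.J l x₁), bxor_bxor_self]
      · simp only [if_true]
        exact bxor_bxor_self _ _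
    · intro h
      simp only [t, t', h]
      cases b
      · rfl
      · exact bxor_comm' _ _
  simp only [F.guessSign_eq hk hx]
  -- Outside the good sets the score is 0 in place of ±1, which costs at most 1 for each of the two
  -- sets that does not contain `d`.
  have h₁ : ∀ d : Bits (F.w l), (if dot d t = dot d t' then (1 : ℝ) else -1) -
      ((if d ∈ (F.G l k false x₀)ᶜ then 1 else 0) + if d ∈ (F.G l k true x₁)ᶜ then 1 else 0) ≤
      if d ∈ B then if dot d t = dot d t' then 1 else -1 else 0 := by
    intro d
    by_cases h₀ : d ∈ F.G l k false x₀ <;> by_cases h₁ : d ∈ F.G l k true x₁ <;>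
      by_cases h₂ : dot d t = dot d t' <;>
      simp only [hB, Set.mem_inter_iff, Set.mem_compl_iff, h₀, h₁, h₂, and_self, and_true, and_false,
        if_true, if_false, not_true_eq_false, not_false_eq_true] <;> norm_num
  have h₂ := expect_mono h₁
  rw [expect_sub, expect_add] at h₂
  have hc : (Fintype.card (Bits (F.w l)) : ℝ) = 2 ^ F.w l := by simp
  have h₃ : ∀ b x, expect (fun d : Bits (F.w l) => if d ∈ (F.G l k b x)ᶜ then (1 : ℝ) else 0) ≤ μ := by
    intro b x
    refine le_trans (le_of_eq ?_) (hμ b x)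
    rw [expect, hc, Finset.sum_boole, Set.ncard_eq_toFinset_card']
    congr 3
    ext d
    simp
  -- A correct partner makes every guess right, and a wrong one is right exactly as often as wrong
  -- when `d` is uniform.
  have h₄ : expect (fun d : Bits (F.w l) => if dot d t = dot d t' then (1 : ℝ) else -1) =
      if z = F.J l (if b then x₀ else x₁) then 1 else 0 := by
    rw [expect, sum_bitSign_dot, hc]
    by_cases hz : z = F.J l (if b then x₀ else x₁)
    · rw [if_pos hz, if_pos (ht.2 hz)]
      exact div_self (by positivity)
    · rw [if_neg hz, if_neg fun h => hz (ht.1 h), zero_div]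
  rw [h₄] at h₂
  linarith [h₃ false x₀, h₃ true x₁]

end Guess

/-! ### The parts of a state -/

section Restrict
variable {W : Type} [Fintype W] [DecidableEq W]

/-- The part of a state in which the qubit `q` has the value `b`. -/
def restrict (q : W) (b : Bool) (f : (W → Bool) → ℂ) : (W → Bool) → ℂ :=
  fun v => if v q = b then f v else 0

theorem restrict_add_restrict (q : W) (f : (W → Bool) → ℂ) :
    restrict q false f + restrict q true f = f := by
  funext v
  cases h : v q <;> simp [restrict, h]

theorem restrict_sub_restrict (q : W) (f : (W → Bool) → ℂ) :
    restrict q false f - restrict q true f = fun v => (if v q then -1 else 1) * f v := by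
  funext v
  cases h : v q <;> simp [restrict, h]

theorem restrict_zero (q : W) (b : Bool) : restrict q b 0 = 0 := by
  funext v
  simp [restrict]

theorem ip_restrict (q : W) (f g : (W → Bool) → ℂ) :
    ip (restrict q false f) (restrict q true g) = 0 :=
  Finset.sum_eq_zero fun v _ => by cases h : v q <;> simp [restrict, h]

theorem sum_norm_restrict_le (q : W) (b : Bool) (f : (W → Bool) → ℂ) :
    ∑ v, ‖restrict q b f v‖ ^ 2 ≤ ∑ v, ‖f v‖ ^ 2 := by
  refine Finset.sum_le_sum fun v _ => ?_
  unfold restrict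
  split_ifs
  · exact le_rfl
  · simp

end Restrict

/-! ### Phases on the committed qubits before the attack -/

section Twist
variable {D : Domains} {E : ExtendedTCF D} {n l : ℕ}

/-- One more Z changes the sign of the branch in which the j-th committed qubit is 1. -/
theorem phase_update {aux : ℕ} (r : Fin n → Bool) (j : Fin n) (hj : r j = false)
    (f : (ProverWire E n l aux → Bool) → ℂ) :
    phase (Function.update r j true) f =
      phase r (restrict (.committed j) false f - restrict (.committed j) true f) := by
  rw [restrict_sub_restrict]
  funext v
  rw [phase, phase, chi_update r _ j hj]
  ring

namespace ProverAt
variable (P : ProverAt E n l)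

/-- The attack preceded by `Z^r` on the committed qubits. -/
def twistOp (r : Fin n → Bool) :
    Matrix (ProverWire E n l P.aux → Bool) (ProverWire E n l P.aux → Bool) ℂ :=
  P.attackOp * Circuit.toMatrix (Circuit.phases (fun i => .committed i) r)

theorem twistOp_mulVec (r : Fin n → Bool) (f : (ProverWire E n l P.aux → Bool) → ℂ) :
    P.twistOp r *ᵥ f = P.attackOp *ᵥ phase r f := by
  rw [twistOp, ← mulVec_mulVec]
  congr 1
  funext v
  rw [Circuit.phases_mulVec]
  rfl

theorem isUnitary_twistOp (r : Fin n → Bool) : IsUnitary (P.twistOp r) :=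
  P.isUnitary_attackOp.mul (Circuit.isUnitary _)

theorem impl_twistOp (r : Fin n → Bool) :
    Impl (n + P.test.length + P.had.length) (P.twistOp r) := by
  have h : P.twistOp r = Circuit.toMatrix (Circuit.phases (fun i => .committed i) r ++
      (Circuit.inv P.test ++ P.had)) := by
    rw [Circuit.toMatrix_append, Circuit.toMatrix_append, Circuit.toMatrix_inv]
    rfl
  rw [h]
  refine (Impl.circuit _).mono ?_
  have := Circuit.length_phases (fun i => (.committed i : ProverWire E n l P.aux)) r
  simp only [List.length_append, Circuit.length_inv]
  omega

theorem impl_twistOp_conjTranspose (r : Fin n → Bool) :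
    Impl (n + P.test.length + P.had.length) (P.twistOp r)ᴴ := by
  have h : (P.twistOp r)ᴴ = Circuit.toMatrix (Circuit.inv (Circuit.phases
      (fun i => .committed i) r ++ (Circuit.inv P.test ++ P.had))) := by
    rw [Circuit.toMatrix_inv, Circuit.toMatrix_append, Circuit.toMatrix_append,
      Circuit.toMatrix_inv]
    rfl
  rw [h]
  refine (Impl.circuit _).mono ?_
  have := Circuit.length_phases (fun i => (.committed i : ProverWire E n l P.aux)) r
  simp only [List.length_append, Circuit.length_inv]
  omega

end ProverAt
end Twist

/-! ### The input of the distinguisher -/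

section Input
variable {D : Domains} {E : ExtendedTCF D} {n l aux : ℕ}
  (F : (Bool × Coins E l × Bool) → (D.encY.W l ⊕ (Unit ⊕ Fin (E.F.w l)) → Bool) → Unit → Bool)
  (h r ρ : Fin n → Bool) (ω : Fin n → Coins E l) (j : Fin n) (adapt c : Bool)

/-- The bits stored by the verifier, the `j`-th one being replaced by `c`, or by the sum of `c` and
the `j`-th answer bit if `adapt` is set. -/
def inputBits (v : ProverWire E n l aux ⊕ RecWire D n l → Bool) (i : Fin n) : Bool :=
  if i = j then xor c (if adapt then v (.inl (.committed j)) else false)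
  else F (h i, ω i, ρ i) (Sum.elim (fun q => v (.inr (.inl (i, q))))
    (Sum.elim (fun _ => xor (v (.inl (.committed i))) (r i)) fun q => v (.inl (.extra i q)))) ()

/-- The size of a circuit for `inputBits`. -/
def inputSize (E : ExtendedTCF D) (n l s : ℕ) : ℕ :=
  n * ((Fintype.card (D.encY.W l) + (2 + E.F.w l) + s + (Fintype.card (D.encY.W l) +
    (2 + E.F.w l)) + (Fintype.card (D.encY.W l) + (1 + E.F.w l))) + 2)

theorem comp_inputBits {s : ℕ} (hF : ∀ a, Comp s (F a)) :
    Comp (inputSize E n l s) (inputBits (aux := aux) F h r ρ ω j adapt c) := by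
  have key : ∀ i : Fin n, Comp ((Fintype.card (D.encY.W l) + (2 + E.F.w l) + s +
      (Fintype.card (D.encY.W l) + (2 + E.F.w l)) + (Fintype.card (D.encY.W l) + (1 + E.F.w l))) +
        2) fun (v : ProverWire E n l aux ⊕ RecWire D n l → Bool) (_ : Unit) =>
          inputBits F h r ρ ω j adapt c v i := by
    intro i
    by_cases hi : i = j
    · simp only [inputBits, if_pos hi]
      cases adapt
      · refine Comp.mono (Comp.const (xor c false)) (by omega)
      · refine Comp.mono (Comp.xor (Comp.const c) (Comp.bit _)) (by omega)
    · simp only [inputBits, if_neg hi]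
      have h₁ : Comp (Fintype.card (D.encY.W l)) fun (v : ProverWire E n l aux ⊕ RecWire D n l → Bool)
          q => v (.inr (.inl (i, q))) := Comp.wire _
      have h₂ : Comp (1 + 1) fun (v : ProverWire E n l aux ⊕ RecWire D n l → Bool) (_ : Unit) =>
          xor (v (.inl (.committed i))) (r i) := Comp.xor (Comp.bit _) (Comp.const (r i))
      have h₃ : Comp (Fintype.card (Fin (E.F.w l)))
          fun (v : ProverWire E n l aux ⊕ RecWire D n l → Bool) q => v (.inl (.extra i q)) :=
        Comp.wire _
      have h₄ := h₁.prod (h₂.prod h₃)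
      have h₅ := Comp.comp (hF (h i, ω i, ρ i)) h₄
      have h₆ : Fintype.card (D.encY.W l ⊕ (Unit ⊕ Fin (E.F.w l))) =
        Fintype.card (D.encY.W l) + (1 + E.F.w l) := by simp
      rw [h₆, Fintype.card_fin] at h₅
      refine h₅.mono ?_
      omega
  have h₁ := Comp.pi (F := fun i v (_ : Unit) => inputBits F h r ρ ω j adapt c v i) key
  rwa [Fintype.card_fin] at h₁

end Input

/-! ### Attackers against the adaptive hardcore bit -/

section Attacker
variable {D : Domains} {E : ExtendedTCF D} {n l : ℕ}

/-- The values in the record. -/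
def recordOf (y : Fin n → D.encY.W l → Bool) (b : Bool) (x : D.encX.W l → Bool) :
    RecWire D n l → Bool :=
  Sum.elim (fun q => y q.1 q.2) (Sum.elim (fun _ => b) x)

theorem sum_runWire {Pw Rec I : Type} [Fintype Pw] [DecidableEq Pw] [Fintype Rec]
    [DecidableEq Rec] [Fintype I] [DecidableEq I] {a : ℕ}
    (g : (RunWire Pw Rec I a → Bool) → ℝ) :
    ∑ v, g v = ∑ s, ∑ p, ∑ e, g (Sum.elim p (Sum.elim s e)) := by
  rw [sum_elim, Finset.sum_congr rfl fun p _ => sum_elim _, Finset.sum_comm]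

theorem sum_record (g : (RecWire D n l → Bool) → ℝ) :
    ∑ s, g s = ∑ y, ∑ b, ∑ x, g (recordOf y b x) := by
  rw [sum_elim, ← Equiv.sum_comp (Equiv.curry (Fin n) (D.encY.W l) Bool).symm]
  refine Finset.sum_congr rfl fun y _ => ?_
  rw [sum_elim, ← Equiv.sum_comp (Equiv.funUnique Unit Bool).symm]
  rfl

/-- The keys after the coins of the `j`-th run of the generators have been replaced. -/
def keysAt (h : Fin n → Bool) (ω : Fin n → Coins E l) (j : Fin n) (g : Bits (E.G.coins l))
    (u : Bits (E.F.coins l)) : Fin n → D.Key l :=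
  fun i => sampleKey (h i) (Function.update ω j (u, g) i)

namespace ProverAt
variable (P : ProverAt E n l) (j : Fin n)

theorem recordState_recordOf (k : Fin n → D.Key l) (y : Fin n → D.encY.W l → Bool) (b : Bool)
    (x : D.encX.W l → Bool) (p : ProverWire E n l P.aux → Bool) :
    P.recordState j k (recordOf y b x) p =
      if p (.committed j) = b ∧ (fun q => p (.preimage j q)) = x then P.testState k y p else 0 := by
  rw [recordState]
  refine if_congr ?_ rfl rfl
  have : p ∘ answerWire E n l P.aux j =
      Sum.elim (fun _ => p (.committed j)) fun q => p (.preimage j q) := by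
    funext q; rcases q with q | q <;> rfl
  rw [this]
  change Sum.elim (fun _ => b) x = _ ↔ _
  rw [Sum.elim_eq_iff, eq_comm (a := x)]
  refine and_congr_left' ⟨fun h => (congrFun h ()).symm, fun h => by rw [h]⟩

/-- Summation over the records, if the commitment strings and the value of the committed qubit
determine that of the preimage register. -/
theorem sum_recordState {k : Fin n → D.Key l}
    {x : (Fin n → D.encY.W l → Bool) → Bool → D.encX.W l → Bool}
    (hx : ∀ y p, P.testState k y p ≠ 0 → (fun q => p (.preimage j q)) = x y (p (.committed j)))
    {g : (RecWire D n l → Bool) → ((ProverWire E n l P.aux → Bool) → ℂ) → ℝ}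
    (hg : ∀ s, g s 0 = 0) :
    ∑ s, g s (P.recordState j k s) =
      ∑ y, ∑ b, g (recordOf y b (x y b)) (restrict (.committed j) b (P.testState k y)) := by
  rw [sum_record]
  refine Finset.sum_congr rfl fun y _ => Finset.sum_congr rfl fun b _ => ?_
  have h : ∀ x', P.recordState j k (recordOf y b x') =
      if x' = x y b then restrict (.committed j) b (P.testState k y) else 0 := by
    intro x'
    funext p
    rw [recordState_recordOf]
    by_cases hp : P.testState k y p = 0
    · split_ifs <;> simp [hp, restrict]
    · rw [hx y p hp]
      by_cases hb : p (.committed j) = b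
      · subst hb
        by_cases hx' : x' = x y (p (.committed j))
        · subst hx'
          simp [restrict]
        · rw [if_neg hx', if_neg fun h' => hx' h'.2.symm]; rfl
      · rw [if_neg fun h' => hb h'.1]
        split_ifs
        · simp [restrict, hb]
        · rfl
  rw [Finset.sum_eq_single (x y b)]
  · rw [h, if_pos rfl]
  · intro x' _ hx'
    rw [h, if_neg hx', hg]
  · simp

/-- The size of an attacker which applies, after the simulation of the test round, a unitary and a
function with circuits of sizes `s` and `s'`. -/
def attackerSize (a s s' : ℕ) : ℕ :=
  2 * (s + (1 + Fintype.card (D.encX.W l) + (P.test.length + (n * Fintype.card (D.encY.W l) +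
    (P.commit.length + n * Fintype.card (D.encKey.W l))))) + s' + Fintype.card (D.encKey.W l)) +
      Fintype.card (P.AttackerWire a)

/-- Since `h j` selects the claw-free generator, the challenge key takes the place of the j-th key,
and the circuit contains the other keys as constants. The challenge coins `u` enter the final state
through the key alone. -/
theorem exists_attacker {h : Fin n → Bool} (hj : h j = true) (ω : Fin n → Coins E l)
    (g : Bits (E.G.coins l)) {a s s' : ℕ} {U : Matrix (P.AttackerWire a → Bool) _ ℂ}
    (hU : Impl s U) {G : (P.AttackerWire a → Bool) → E.F.GuessWire l → Bool} (hG : Comp s' G) :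
    ∃ A : QAlg (D.encKey.W l) (E.F.GuessWire l), A.anc + A.circ.length ≤
      P.attackerSize a s s' ∧
      E.F.advantage l A = expect fun u => ∑ v,
        ‖(U *ᵥ runState (P.recordState j (keysAt h ω j g u))) v‖ ^ 2 *
          E.F.guessSign l (E.F.gen l u).1 (G v) := by
  obtain ⟨A, hA, hp⟩ := exists_qalg (P.guessKeyWire_injective j a)
    (hU.mul (P.impl_simulateOp j a fun i => sampleKey (h i) (ω i))) hG
  refine ⟨A, hA, E.F.advantage_eq fun u z => ?_⟩
  rw [hp]
  have hk : keysAt h ω j g u j = (E.F.gen l u).1 := by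
    simp [keysAt, sampleKey, hj]
  have := P.simulateOp_mulVec j a (k := keysAt h ω j g u) (k' := fun i => sampleKey (h i) (ω i))
    fun i hi => by simp [keysAt, hi]
  rw [hk] at this
  rw [← mulVec_mulVec, this]

end ProverAt
end Attacker

/-! ### The terms bounded by the adaptive hardcore bit -/

theorem ip_mulVec_left {W : Type} [Fintype W] [DecidableEq W]
    (M : Matrix (W → Bool) (W → Bool) ℂ) (f g : (W → Bool) → ℂ) :
    ip (M *ᵥ f) g = ip f (Mᴴ *ᵥ g) := by
  have h : ∀ f g : (W → Bool) → ℂ, ip f g = star f ⬝ᵥ g := fun f g => rfl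
  rw [h, h, star_mulVec, dotProduct_mulVec]

theorem QAlg.sum_norm_mul {I : Type} [Fintype I] [DecidableEq I] (A : QAlg I Unit) (a : ℂ)
    (x : I → Bool) (g : Bool → ℝ) :
    ∑ e, ‖a * A.finalState x e‖ ^ 2 * g (e (.inr (.inl ()))) =
      ‖a‖ ^ 2 * ((1 - A.prob x fun _ => false) * g true + (A.prob x fun _ => false) * g false) := by
  have h := A.sum_prob_mul x fun z => g (z ())
  rw [sum_bit, A.prob_true] at h
  rw [h, Finset.mul_sum]
  refine Finset.sum_congr rfl fun e _ => ?_
  rw [norm_mul, mul_pow, mul_assoc]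

section Terms
variable {D : Domains} {E : ExtendedTCF D} {n l : ℕ} (P : ProverAt E n l) (A : QAlg (Fin n) Unit)
  (F : (Bool × Coins E l × Bool) → (D.encY.W l ⊕ (Unit ⊕ Fin (E.F.w l)) → Bool) → Unit → Bool)
  (h r ρ : Fin n → Bool) (j : Fin n)

/-- The bits stored by the verifier, if `ρ` are the random bits. -/
def storedBits {aux : ℕ} (ω : Fin n → Coins E l) (y : Fin n → D.encY.W l → Bool)
    (p : ProverWire E n l aux → Bool) : Fin n → Bool := fun i =>
  (decode (h i) (ω i) (y i) (xor (p (.committed i)) (r i)) fun q => p (.extra i q)).getD (ρ i)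

/-- The `j`-th measurement result. -/
def resultAt {aux : ℕ} (ω : Fin n → Coins E l) (y : Fin n → D.encY.W l → Bool)
    (p : ProverWire E n l aux → Bool) : Option Bool :=
  decode true (ω j) (y j) (p (.committed j)) fun q => p (.extra j q)

/-- The probability that the distinguisher returns `0` if the `j`-th stored bit is `c`. -/
def verdict {aux : ℕ} (ω : Fin n → Coins E l) (y : Fin n → D.encY.W l → Bool)
    (p : ProverWire E n l aux → Bool) (c : Bool) : ℝ :=
  A.prob (Function.update (storedBits h r ρ ω y p) j c) fun _ => false

/-- The keys sent by the verifier. -/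
def keysOf (ω : Fin n → Coins E l) : Fin n → D.Key l := fun i => sampleKey (h i) (ω i)

/-- The final state, if the `j`-th committed qubit has the value `b` in the test round. -/
def branch (ω : Fin n → Coins E l) (y : Fin n → D.encY.W l → Bool) (b : Bool) :
    (ProverWire E n l P.aux → Bool) → ℂ :=
  P.twistOp r *ᵥ restrict (.committed j) b (P.testState (keysOf h ω) y)

/-- The part of the change of the distinguishing probability which is diagonal in the value of the
`j`-th committed qubit. -/
def diagTerm (ω : Fin n → Coins E l) : ℝ :=
  ∑ y, ∑ b, ∑ p, ‖branch P h r j ω y b p‖ ^ 2 *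
    (storedAvg (resultAt j ω y p) (verdict A h r ρ j ω y p) -
      storedAvg ((resultAt j ω y p).map not) (verdict A h r ρ j ω y p))

/-- The interference of the two values of the `j`-th committed qubit, weighted by the verdict. -/
def crossTerm (c : Bool) (ω : Fin n → Coins E l) : ℝ :=
  ∑ y, (ip (branch P h r j ω y false) fun p => branch P h r j ω y true p *
    ((2 * verdict A h r ρ j ω y p c - 1 : ℝ) : ℂ)).re

variable {P h j}

/-- All accepted answers with the same `y` belong to the same claw, so the preimage register is a
function of `y` and the committed bit. Where the state vanishes the value is arbitrary. -/
theorem exists_claws (hP : acceptProb E P.testBehaviour h = 1) (hj : h j = true)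
    (ω : Fin n → Coins E l) :
    ∃ x : (Fin n → D.encY.W l → Bool) → Bool → D.encX.W l → Bool, ∀ y,
      (∀ p, P.testState (keysOf h ω) y p ≠ 0 →
        (fun q => p (.preimage j q)) = x y (p (.committed j))) ∧
      (P.testState (keysOf h ω) y = 0 ∨ (∀ i, Decodable (h i) (ω i) (y i)) ∧
        ∃ x₀ x₁, ClawAt (ω j) (y j) x₀ x₁ ∧
          ∀ b, x y b = D.encX.enc l (if b then x₁ else x₀)) := by
  have key : ∀ y, ∃ x : Bool → D.encX.W l → Bool,
      (∀ p, P.testState (keysOf h ω) y p ≠ 0 →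
        (fun q => p (.preimage j q)) = x (p (.committed j))) ∧
      (P.testState (keysOf h ω) y = 0 ∨ (∀ i, Decodable (h i) (ω i) (y i)) ∧
        ∃ x₀ x₁, ClawAt (ω j) (y j) x₀ x₁ ∧
          ∀ b, x b = D.encX.enc l (if b then x₁ else x₀)) := by
    intro y
    by_cases hy : P.testState (keysOf h ω) y = 0
    · exact ⟨fun _ _ => false, fun p hp => absurd (congrFun hy p) hp, Or.inl hy⟩
    · obtain ⟨p, hp⟩ := Function.ne_iff.1 hy
      have hc := ProverAt.testCheck_of_accept hP ω y
      have hcj : ∀ p, P.testState (keysOf h ω) y p ≠ 0 → _ := fun p hp => hc p hp j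
      rw [hj] at hcj
      obtain ⟨x₀, x₁, hcl, _⟩ := exists_clawAt (hcj p hp)
      refine ⟨fun b => D.encX.enc l (if b then x₁ else x₀), fun p' hp' => ?_,
        Or.inr ⟨fun i => decodable_of_testCheck (hc p hp i), x₀, x₁, hcl, fun b => rfl⟩⟩
      obtain ⟨x₀', x₁', hcl', hx'⟩ := exists_clawAt (hcj p' hp')
      obtain ⟨rfl, rfl⟩ := hcl.unique hcl'
      exact hx'
  choose x hx using key
  exact ⟨x, hx⟩

variable {F}

/-- The coins of coordinate `j` differ on the two sides, but the bit of this coordinate is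
overwritten. The attacker thus needs no trapdoor for the challenge key. -/
theorem inputBits_eq (hF : ∀ h (ω : Coins E l) u y b d, Decodable h ω y →
      F (h, ω, u) (Sum.elim y (Sum.elim b d)) () = (decode h ω y (b ()) d).getD u)
    {ω : Fin n → Coins E l} {a : Coins E l} {y : Fin n → D.encY.W l → Bool}
    (hy : ∀ i, Decodable (h i) (Function.update ω j a i) (y i)) (adapt c b : Bool)
    (x : D.encX.W l → Bool) (p : ProverWire E n l P.aux → Bool) :
    inputBits F h r ρ ω j adapt c (Sum.elim p (recordOf y b x)) =
      Function.update (storedBits h r ρ (Function.update ω j a) y p) j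
        (xor c (if adapt then p (.committed j) else false)) := by
  funext i
  by_cases hi : i = j
  · subst hi
    rw [Function.update_self, inputBits, if_pos rfl]
    rfl
  · rw [Function.update_of_ne hi, inputBits, if_neg hi, storedBits]
    have := hy i
    rw [Function.update_of_ne hi] at this ⊢
    exact hF (h i) (ω i) (ρ i) (y i) (fun _ => xor (p (.committed i)) (r i)) _ this

/-- The output of the attacker which runs the distinguisher. -/
def runGuess (P : ProverAt E n l) (j : Fin n) (a : ℕ) (c : Bool) (v : P.AttackerWire a → Bool) :
    E.F.GuessWire l → Bool :=
  Sum.elim (fun _ => v (.inr (.inl (.inr (.inl ()))))) (Sum.elim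
    (fun q => v (.inr (.inl (.inr (.inr q))))) (Sum.elim (fun q => v (.inl (.extra j q)))
      fun _ => xor c (v (.inr (.inr (.inr (.inl ())))))))

theorem comp_runGuess (a : ℕ) (c : Bool) :
    Comp (1 + (Fintype.card (D.encX.W l) + (Fintype.card (Fin (E.F.w l)) + (1 + 1))))
      (runGuess P j a c) := by
  have h₁ : Comp (1 + 1) fun (v : P.AttackerWire a → Bool) (_ : Unit) =>
    xor c (v (.inr (.inr (.inr (.inl ()))))) := Comp.xor (Comp.const c) (Comp.bit _)
  have h₂ : Comp (Fintype.card (Fin (E.F.w l))) fun (v : P.AttackerWire a → Bool) q =>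
    v (.inl (.extra j q)) := Comp.wire _
  have h₃ : Comp (Fintype.card (D.encX.W l)) fun (v : P.AttackerWire a → Bool) q =>
    v (.inr (.inl (.inr (.inr q)))) := Comp.wire _
  have h₄ : Comp 1 fun (v : P.AttackerWire a → Bool) (_ : Unit) =>
    v (.inr (.inl (.inr (.inl ())))) := Comp.bit _
  exact h₄.prod (h₃.prod (h₂.prod h₁))

/-- Let t be the hardcore bit, b' the answer bit and p(e) the probability of verdict 0 when the j-th
bit is e, so that b' + t is stored. The attacker runs the distinguisher on c + b' and guesses c on
verdict 0 and its negation on verdict 1, which scores 2p(c + b') - 1 with the sign + if c = t and -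
otherwise. The sum over c is 2(p(b' + t) - p(b' + t + 1)). For `d` outside the good sets, both sides
vanish. -/
theorem sum_runGuess (hF : ∀ h (ω : Coins E l) u y b d, Decodable h ω y →
      F (h, ω, u) (Sum.elim y (Sum.elim b d)) () = (decode h ω y (b ()) d).getD u)
    (hP : acceptProb E P.testBehaviour h = 1) (hj : h j = true) (ω : Fin n → Coins E l)
    (g : Bits (E.G.coins l)) (u : Bits (E.F.coins l)) :
    (∑ c, ∑ v, ‖(runOp A (inputBits F h r ρ ω j true c) (P.twistOp r) *ᵥ
        runState (P.recordState j (keysAt h ω j g u))) v‖ ^ 2 *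
          E.F.guessSign l (E.F.gen l u).1 (runGuess P j A.anc c v)) =
      2 * diagTerm P A h r ρ j (Function.update ω j (u, g)) := by
  set ω' := Function.update ω j (u, g) with hω'
  obtain ⟨x, hx⟩ := exists_claws hP hj ω'
  have h₁ : ∀ c, (∑ v, ‖(runOp A (inputBits F h r ρ ω j true c) (P.twistOp r) *ᵥ
        runState (P.recordState j (keysAt h ω j g u))) v‖ ^ 2 *
          E.F.guessSign l (E.F.gen l u).1 (runGuess P j A.anc c v)) =
      ∑ y, ∑ b, ∑ p, ∑ e, ‖branch P h r j ω' y b p *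
        A.finalState (inputBits F h r ρ ω j true c (Sum.elim p (recordOf y b (x y b)))) e‖ ^ 2 *
          E.F.guessSign l (E.F.gen l u).1 (Sum.elim (fun _ => b) (Sum.elim (x y b)
            (Sum.elim (fun q => p (.extra j q)) fun _ => xor c (e (.inr (.inl ())))))) := by
    intro c
    rw [sum_runWire]
    simp only [runOp_mulVec]
    exact P.sum_recordState j (fun y => (hx y).1)
      (g := fun s φ => ∑ p, ∑ e, ‖(P.twistOp r *ᵥ φ) p *
        A.finalState (inputBits F h r ρ ω j true c (Sum.elim p s)) e‖ ^ 2 *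
          E.F.guessSign l (E.F.gen l u).1 (runGuess P j A.anc c (Sum.elim p (Sum.elim s e))))
      fun s => by simp
  simp only [h₁, diagTerm, Finset.mul_sum]
  rw [Finset.sum_comm]
  refine Finset.sum_congr rfl fun y _ => ?_
  rw [Finset.sum_comm]
  refine Finset.sum_congr rfl fun b _ => ?_
  rw [Finset.sum_comm]
  refine Finset.sum_congr rfl fun p _ => ?_
  rcases (hx y).2 with hy | ⟨hd, x₀, x₁, hcl, hxy⟩
  · simp [branch, hy, restrict_zero]
  · have hk : (ω' j).1 = u := by rw [hω', Function.update_self]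
    have hR := hcl.1
    rw [hk] at hR
    have hres := hcl.decode (p (.committed j)) fun q => p (.extra j q)
    rw [hk] at hres
    have h₂ : ∀ c, A.prob (inputBits F h r ρ ω j true c (Sum.elim p (recordOf y b (x y b))))
        (fun _ => false) = verdict A h r ρ j ω' y p (xor c (p (.committed j))) := by
      intro c
      rw [inputBits_eq r ρ hF hd]
      rfl
    have h₃ := fun c => A.sum_norm_mul (branch P h r j ω' y b p)
      (inputBits F h r ρ ω j true c (Sum.elim p (recordOf y b (x y b))))
      fun s => E.F.guessSign l (E.F.gen l u).1 (Sum.elim (fun _ => b) (Sum.elim (x y b)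
            (Sum.elim (fun q => p (.extra j q)) fun _ => xor c s)))
    rw [Finset.sum_congr rfl fun c _ => h₃ c]
    simp only [h₂]
    simp only [hxy, E.F.guessSign_eq (E.F.gen_mem l u) hR]
    rw [Fintype.sum_bool, resultAt, hres]
    by_cases hG : (fun q => p (.extra j q)) ∈
      E.F.G l (E.F.gen l u).1 false x₀ ∩ E.F.G l (E.F.gen l u).1 true x₁
    · simp only [if_pos hG]
      cases dot (fun q => p (.extra j q)) (bxor (E.F.J l x₀) (E.F.J l x₁)) <;>
        cases p (.committed j) <;> simp [storedAvg] <;> ring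
    · simp only [if_neg hG]
      simp

end Terms

/-! ### Bounds for the diagonal and the cross terms -/

section Terms
variable {D : Domains} {E : ExtendedTCF D} {n l : ℕ} {P : ProverAt E n l} {A : QAlg (Fin n) Unit}
  {F : (Bool × Coins E l × Bool) → (D.encY.W l ⊕ (Unit ⊕ Fin (E.F.w l)) → Bool) → Unit → Bool}
  {h : Fin n → Bool} (r ρ : Fin n → Bool) {j : Fin n}

/-- The size of the attacker which runs the distinguisher. -/
def runAttackerSize (P : ProverAt E n l) (A : QAlg (Fin n) Unit) (s : ℕ) : ℕ :=
  P.attackerSize A.anc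
    (A.circ.length + (inputSize E n l s + (n + P.test.length + P.had.length)))
    (1 + (Fintype.card (D.encX.W l) + (Fintype.card (Fin (E.F.w l)) + (1 + 1))))

theorem abs_expect_diagTerm_le {s : ℕ} (hFs : ∀ a, Comp s (F a))
    (hF : ∀ h (ω : Coins E l) u y b d, Decodable h ω y →
      F (h, ω, u) (Sum.elim y (Sum.elim b d)) () = (decode h ω y (b ()) d).getD u)
    (hP : acceptProb E P.testBehaviour h = 1) (hj : h j = true) {μ : ℝ}
    (hμ : ∀ A' : QAlg (D.encKey.W l) (E.F.GuessWire l),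
      A'.anc + A'.circ.length ≤ runAttackerSize P A s → |E.F.advantage l A'| ≤ μ)
    (ω : Fin n → Coins E l) (g : Bits (E.G.coins l)) :
    |expect fun u => diagTerm P A h r ρ j (Function.update ω j (u, g))| ≤ μ := by
  choose A' hA' hadv using fun c => P.exists_attacker j hj ω g
    (impl_runOp A (inputBits F h r ρ ω j true c) (P.twistOp r) (P.impl_twistOp r)
      (comp_inputBits F h r ρ ω j true c hFs)) (comp_runGuess (P := P) (j := j) A.anc c)
  have h₁ : ∑ c, E.F.advantage l (A' c) =
      2 * expect fun u => diagTerm P A h r ρ j (Function.update ω j (u, g)) := by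
    rw [Finset.sum_congr rfl fun c _ => hadv c, ← expect_const_mul, ← expect_sum]
    exact congrArg expect (funext fun u => sum_runGuess A r ρ hF hP hj ω g u)
  rw [Fintype.sum_bool] at h₁
  have h₂ := abs_le.1 (hμ (A' true) (hA' true))
  have h₃ := abs_le.1 (hμ (A' false) (hA' false))
  exact abs_le.2 ⟨by linarith, by linarith⟩

/-- The output of the attacker which applies a reflection: `d` and the bit `d · (J(x) ⊕ J(x'))`,
where `x` is the recorded value of the preimage register and `x'` is its present one. -/
def reflectGuess (P : ProverAt E n l) (j : Fin n) (a : ℕ)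
    (J : (D.encX.W l → Bool) → Bits (E.F.w l)) (d : Bits (E.F.w l)) (v : P.AttackerWire a → Bool) :
    E.F.GuessWire l → Bool :=
  Sum.elim (fun _ => v (.inr (.inl (.inr (.inl ()))))) (Sum.elim
    (fun q => v (.inr (.inl (.inr (.inr q))))) (Sum.elim d fun _ => dot d (bxor
      (J fun q => v (.inr (.inl (.inr (.inr q))))) (J fun q => v (.inl (.preimage j q))))))

/-- The size of a circuit for `reflectGuess`. -/
def reflectGuessSize (E : ExtendedTCF D) (l s : ℕ) : ℕ :=
  1 + (Fintype.card (D.encX.W l) + (Fintype.card (Fin (E.F.w l)) +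
    (2 * (Fintype.card (Fin (E.F.w l)) + ((Fintype.card (D.encX.W l) + s +
      Fintype.card (D.encX.W l) + Fintype.card (D.encX.W l)) + (Fintype.card (D.encX.W l) + s +
        Fintype.card (D.encX.W l) + Fintype.card (D.encX.W l)))) + 9 * E.F.w l)))

theorem comp_reflectGuess (a : ℕ) {J : (D.encX.W l → Bool) → Bits (E.F.w l)} {s : ℕ}
    (hJ : Comp s J) (d : Bits (E.F.w l)) :
    Comp (reflectGuessSize E l s) (reflectGuess P j a J d) := by
  have h₁ : Comp (Fintype.card (D.encX.W l)) fun (v : P.AttackerWire a → Bool) q =>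
    v (.inl (.preimage j q)) := Comp.wire _
  have h₂ : Comp (Fintype.card (Fin (E.F.w l))) fun (_ : P.AttackerWire a → Bool) => d :=
    Comp.consts _
  have h₃ : Comp (Fintype.card (D.encX.W l)) fun (v : P.AttackerWire a → Bool) q =>
    v (.inr (.inl (.inr (.inr q)))) := Comp.wire _
  have h₄ : Comp 1 fun (v : P.AttackerWire a → Bool) (_ : Unit) =>
    v (.inr (.inl (.inr (.inl ())))) := Comp.bit _
  have h₅ := Comp.comp hJ h₁
  have h₆ := Comp.comp hJ h₃
  have h₇ := Comp.dot h₂ (h₆.xor h₅)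
  exact h₄.prod (h₃.prod (h₂.prod h₇))

theorem reflectOp_mulVec_congr {Pw Rec I : Type} [Fintype Pw] [DecidableEq Pw] [Fintype Rec]
    [DecidableEq Rec] [Fintype I] [DecidableEq I] (A : QAlg I Unit)
    (F : (Pw ⊕ Rec → Bool) → I → Bool) (N : Matrix (Pw → Bool) (Pw → Bool) ℂ)
    {φ φ' : (Rec → Bool) → (Pw → Bool) → ℂ} {s : Rec → Bool} (hs : φ s = φ' s) (p)
    (e : I ⊕ (Unit ⊕ Fin A.anc) → Bool) :
    (reflectOp A F N *ᵥ runState φ) (Sum.elim p (Sum.elim s e)) =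
      (reflectOp A F N *ᵥ runState φ') (Sum.elim p (Sum.elim s e)) := by
  have h : e = Sum.elim (e ∘ Sum.inl) (e ∘ Sum.inr) := (Sum.elim_comp_inl_inr e).symm
  rw [h, reflectOp_mulVec, reflectOp_mulVec, hs]

theorem sum_norm_recordState (k : Fin n → D.Key l) {a : ℕ}
    {x : (Fin n → D.encY.W l → Bool) → Bool → D.encX.W l → Bool}
    (hx : ∀ y p, P.testState k y p ≠ 0 → (fun q => p (.preimage j q)) = x y (p (.committed j))) :
    ∑ v : P.AttackerWire a → Bool, ‖runState (P.recordState j k) v‖ ^ 2 = 1 := by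
  rw [sum_runWire, ← P.sum_testState k]
  have h₁ : ∀ s, (∑ p, ∑ e : Fin n ⊕ (Unit ⊕ Fin a) → Bool,
      ‖runState (P.recordState j k) (Sum.elim p (Sum.elim s e))‖ ^ 2) =
        ∑ p, ‖P.recordState j k s p‖ ^ 2 := by
    intro s
    refine Finset.sum_congr rfl fun p _ => ?_
    rw [Finset.sum_eq_single fun _ => false]
    · rw [runState_elim, if_pos rfl]
    · intro e _ he
      rw [runState_elim, if_neg he]
      simp
    · simp
  rw [Finset.sum_congr rfl fun s _ => h₁ s,
    P.sum_recordState j hx (g := fun _ φ => ∑ p, ‖φ p‖ ^ 2) fun s => by simp]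
  refine Finset.sum_congr rfl fun y _ => ?_
  rw [Finset.sum_comm]
  refine Finset.sum_congr rfl fun p _ => ?_
  rw [Fintype.sum_bool]
  cases hp : p (.committed j) <;> simp [restrict, hp]

/-- The attack is moved to the other side of the inner product, which leaves the branch of value 0
before the attack. That branch is supported where the preimage register holds the preimage for 0, so
only this part of the other vector matters. Cauchy-Schwarz over all `y` and basis states uses that
the branch has norm at most 1. -/
theorem sq_crossTerm_le (ω : Fin n → Coins E l) (c : Bool)
    {x : (Fin n → D.encY.W l → Bool) → Bool → D.encX.W l → Bool}
    (hx : ∀ y p, P.testState (keysOf h ω) y p ≠ 0 →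
      (fun q => p (.preimage j q)) = x y (p (.committed j))) :
    crossTerm P A h r ρ j c ω ^ 2 ≤ ∑ y, ∑ p,
      ‖((P.twistOp r)ᴴ *ᵥ fun p => branch P h r j ω y true p *
        ((2 * verdict A h r ρ j ω y p c - 1 : ℝ) : ℂ)) p‖ ^ 2 *
          if (fun q => p (.preimage j q)) = x y false then 1 else 0 := by
  set χ : (Fin n → D.encY.W l → Bool) → (ProverWire E n l P.aux → Bool) → ℂ := fun y =>
    (P.twistOp r)ᴴ *ᵥ fun p => branch P h r j ω y true p *
        ((2 * verdict A h r ρ j ω y p c - 1 : ℝ) : ℂ) with hχ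
  set φ : (Fin n → D.encY.W l → Bool) → (ProverWire E n l P.aux → Bool) → ℂ := fun y =>
    restrict (.committed j) false (P.testState (keysOf h ω) y) with hφ
  let δ : (Fin n → D.encY.W l → Bool) × (ProverWire E n l P.aux → Bool) → ℝ := fun a =>
    if (fun q => a.2 (.preimage j q)) = x a.1 false then 1 else 0
  have hδ : ∀ y p, φ y p ≠ 0 → δ (y, p) = 1 := by
    intro y p hp
    by_cases hc : p (.committed j) = false
    · refine if_pos ?_
      have hp' : P.testState (keysOf h ω) y p ≠ 0 := by
        intro h₀
        exact hp (by simp [hφ, restrict, h₀])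
      rw [hx y p hp', hc]
    · exact absurd (if_neg hc) hp
  have h₁ : crossTerm P A h r ρ j c ω = ∑ y, ∑ p, (star (φ y p) * χ y p).re := by
    rw [crossTerm]
    refine Finset.sum_congr rfl fun y _ => ?_
    rw [branch, ip_mulVec_left, ip, Complex.re_sum]
  have h₂ : |crossTerm P A h r ρ j c ω| ≤
      ∑ a : (Fin n → D.encY.W l → Bool) × (ProverWire E n l P.aux → Bool),
        ‖φ a.1 a.2‖ * (‖χ a.1 a.2‖ * δ a) := by
    rw [h₁, Fintype.sum_prod_type]
    refine (Finset.abs_sum_le_sum_abs _ _).trans (Finset.sum_le_sum fun y _ =>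
      (Finset.abs_sum_le_sum_abs _ _).trans (Finset.sum_le_sum fun p _ => ?_))
    refine (Complex.abs_re_le_norm _).trans ?_
    rw [norm_mul, norm_star]
    by_cases hp : φ y p = 0
    · simp [hp]
    · rw [hδ y p hp, mul_one]
  have h₃ : ∑ a : (Fin n → D.encY.W l → Bool) × (ProverWire E n l P.aux → Bool),
      ‖φ a.1 a.2‖ ^ 2 ≤ 1 := by
    rw [Fintype.sum_prod_type, ← P.sum_testState (keysOf h ω)]
    exact Finset.sum_le_sum fun y _ => sum_norm_restrict_le _ _ _
  have h₄ : ∀ a, (‖χ a.1 a.2‖ * δ a) ^ 2 = ‖χ a.1 a.2‖ ^ 2 * δ a := by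
    intro a
    rw [mul_pow]
    simp only [δ]
    split_ifs <;> simp
  rw [← sq_abs]
  refine (pow_le_pow_left₀ (abs_nonneg _) h₂ 2).trans
    ((Finset.sum_mul_sq_le_sq_mul_sq _ _ _).trans ?_)
  simp only [h₄]
  rw [← Fintype.sum_prod_type' (f := fun y p => ‖χ y p‖ ^ 2 *
    if (fun q => p (.preimage j q)) = x y false then 1 else 0)]
  refine mul_le_of_le_one_left (Finset.sum_nonneg fun a _ => mul_nonneg (by positivity) ?_) h₃
  simp only [δ]
  split_ifs <;> norm_num

end Terms

section Terms
variable {D : Domains} {E : ExtendedTCF D} {n l : ℕ} {P : ProverAt E n l} {A : QAlg (Fin n) Unit}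
  {F : (Bool × Coins E l × Bool) → (D.encY.W l ⊕ (Unit ⊕ Fin (E.F.w l)) → Bool) → Unit → Bool}
  {h : Fin n → Bool} (r ρ : Fin n → Bool) {j : Fin n}

/-- After the recorded answer was 1 and the reflection has been applied, the amplitude on the other
preimage in the preimage register is the one in `sq_crossTerm_le`. The recorded preimage and the
present one then form the claw, and the guess scores on average at least 1 - 2μ; otherwise it scores
at least -2μ. -/
theorem sq_crossTerm_le_sum (hF : ∀ h (ω : Coins E l) u y b d, Decodable h ω y →
      F (h, ω, u) (Sum.elim y (Sum.elim b d)) () = (decode h ω y (b ()) d).getD u)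
    (hP : acceptProb E P.testBehaviour h = 1) (hj : h j = true)
    {J : (D.encX.W l → Bool) → Bits (E.F.w l)} (hJ : ∀ x, J (D.encX.enc l x) = E.F.J l x) {μ : ℝ}
    (hμ : ∀ k ∈ E.F.K l, ∀ b x, ((E.F.G l k b x)ᶜ.ncard : ℝ) / 2 ^ E.F.w l ≤ μ)
    (ω : Fin n → Coins E l) (g : Bits (E.G.coins l)) (u : Bits (E.F.coins l)) (c : Bool) :
    crossTerm P A h r ρ j c (Function.update ω j (u, g)) ^ 2 ≤
      (∑ v, ‖(reflectOp A (inputBits F h r ρ ω j false c) (P.twistOp r) *ᵥ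
        runState (P.recordState j (keysAt h ω j g u))) v‖ ^ 2 *
          expect fun d => E.F.guessSign l (E.F.gen l u).1 (reflectGuess P j A.anc J d v)) +
      2 * μ := by
  set ω' := Function.update ω j (u, g) with hω'
  obtain ⟨x, hx⟩ := exists_claws hP hj ω'
  have hx₁ := fun y => (hx y).1
  set R := reflectOp A (inputBits F h r ρ ω j false c) (P.twistOp r)
  have hR : IsUnitary R := IsUnitary.reflectOp A _ (P.isUnitary_twistOp r)
  have hR₀ : ∀ p s e, (R *ᵥ runState fun _ => 0) (Sum.elim p (Sum.elim s e)) = 0 := fun p s e =>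
    reflectOp_mulVec_eq_zero A _ _ _ (fun _ => rfl) p e
  have h₁ : ∑ v, ‖(R *ᵥ runState (P.recordState j (keysAt h ω j g u))) v‖ ^ 2 = 1 := by
    rw [hR.norm_mulVec]
    exact sum_norm_recordState _ hx₁
  -- The score is shifted by 2μ, at no cost since the state has norm 1. The shifted score is
  -- nonnegative in the relevant cases, so contributions can be dropped.
  let K : (ProverWire E n l P.aux → Bool) → (RecWire D n l → Bool) → ℝ := fun p s =>
    (expect fun d => E.F.guessSign l (E.F.gen l u).1
      (reflectGuess P j A.anc J d (Sum.elim p (Sum.elim s fun _ => false)))) + 2 * μ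
  have h₂ : (∑ v, ‖(R *ᵥ runState (P.recordState j (keysAt h ω j g u))) v‖ ^ 2 *
        expect fun d => E.F.guessSign l (E.F.gen l u).1 (reflectGuess P j A.anc J d v)) + 2 * μ =
      ∑ y, ∑ b, ∑ p, ∑ e, ‖(R *ᵥ runState fun _ =>
        restrict (.committed j) b (P.testState (keysOf h ω') y))
          (Sum.elim p (Sum.elim (recordOf y b (x y b)) e))‖ ^ 2 * K p (recordOf y b (x y b)) := by
    have h₃ : (2 * μ : ℝ) = ∑ v, ‖(R *ᵥ runState (P.recordState j (keysAt h ω j g u))) v‖ ^ 2 *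
        (2 * μ) := by rw [← Finset.sum_mul, h₁, one_mul]
    rw [h₃, ← Finset.sum_add_distrib]
    simp only [← mul_add]
    rw [sum_runWire]
    have h₄ : ∀ s, (∑ p, ∑ e, ‖(R *ᵥ runState (P.recordState j (keysAt h ω j g u)))
          (Sum.elim p (Sum.elim s e))‖ ^ 2 *
        ((expect fun d => E.F.guessSign l (E.F.gen l u).1
          (reflectGuess P j A.anc J d (Sum.elim p (Sum.elim s e)))) + 2 * μ)) =
        ∑ p, ∑ e, ‖(R *ᵥ runState fun _ => P.recordState j (keysAt h ω j g u) s)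
          (Sum.elim p (Sum.elim s e))‖ ^ 2 * K p s := by
      intro s
      refine Finset.sum_congr rfl fun p _ => Finset.sum_congr rfl fun e _ => ?_
      rw [reflectOp_mulVec_congr A _ (P.twistOp r) (φ := P.recordState j (keysAt h ω j g u))
        (φ' := fun _ => P.recordState j (keysAt h ω j g u) s) rfl]
      rfl
    rw [Finset.sum_congr rfl fun s _ => h₄ s]
    exact P.sum_recordState j hx₁ (g := fun s φ => ∑ p, ∑ e, ‖(R *ᵥ runState fun _ => φ)
      (Sum.elim p (Sum.elim s e))‖ ^ 2 * K p s) fun s => Finset.sum_eq_zero fun p _ =>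
        Finset.sum_eq_zero fun e _ => by
          rw [hR₀]
          simp
  rw [h₂]
  refine (sq_crossTerm_le r ρ ω' c hx₁).trans (Finset.sum_le_sum fun y _ => ?_)
  rcases (hx y).2 with hy | ⟨hd, x₀, x₁, hcl, hxy⟩
  · have h₃ : ∀ b, restrict (.committed j) b (P.testState (keysOf h ω') y) = 0 := fun b => by
      rw [hy, restrict_zero]
    have h₄ : branch P h r j ω' y true = 0 := by
      rw [branch, h₃]
      exact mulVec_zero _
    simp only [h₄, h₃]
    refine le_of_eq (Eq.trans (b := 0) ?_ ?_)
    · refine Finset.sum_eq_zero fun p _ => ?_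
      simp only [Pi.zero_apply, zero_mul]
      have h₅ : ((P.twistOp r)ᴴ *ᵥ fun _ => (0 : ℂ)) p = 0 := congrFun (mulVec_zero _) p
      rw [h₅]
      simp
    · refine (Finset.sum_eq_zero fun b _ => Finset.sum_eq_zero fun p _ =>
        Finset.sum_eq_zero fun e _ => ?_).symm
      rw [hR₀]
      simp
  · have hk : (ω' j).1 = u := by rw [hω', Function.update_self]
    have hRk := hcl.1
    rw [hk] at hRk
    have h₃ : ∀ b p, (if J (fun q => p (.preimage j q)) = E.F.J l (if b then x₀ else x₁)
        then (1 : ℝ) else 0) ≤ K p (recordOf y b (x y b)) := by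
      intro b p
      have := E.F.sum_guessSign_ge (E.F.gen_mem l u) hRk b (J fun q => p (.preimage j q))
        (hμ _ (E.F.gen_mem l u))
      rw [← hJ (if b then x₁ else x₀), ← hxy] at this
      exact sub_le_iff_le_add.1 this
    have h₀ : ∀ b p, 0 ≤ K p (recordOf y b (x y b)) := fun b p =>
      le_trans (by split_ifs <;> norm_num) (h₃ b p)
    -- Of all outcomes only those with recorded bit 1 and, next, with the qubits of the algorithm
    -- back at zero are kept; there the reflection is known explicitly.
    refine le_trans ?_ (Finset.single_le_sum (f := fun b => ∑ p, ∑ e, ‖(R *ᵥ runState fun _ =>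
        restrict (.committed j) b (P.testState (keysOf h ω') y))
          (Sum.elim p (Sum.elim (recordOf y b (x y b)) e))‖ ^ 2 * K p (recordOf y b (x y b)))
      (fun b _ => Finset.sum_nonneg fun p _ => Finset.sum_nonneg fun e _ =>
        mul_nonneg (by positivity) (h₀ b p)) (Finset.mem_univ true))
    refine Finset.sum_le_sum fun p _ => ?_
    refine le_trans ?_ (Finset.single_le_sum (f := fun e => ‖(R *ᵥ runState fun _ =>
        restrict (.committed j) true (P.testState (keysOf h ω') y))
          (Sum.elim p (Sum.elim (recordOf y true (x y true)) e))‖ ^ 2 *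
            K p (recordOf y true (x y true)))
      (fun e _ => mul_nonneg (by positivity) (h₀ true p)) (Finset.mem_univ fun _ => false))
    simp only [R]
    rw [reflectOp_mulVec_zero]
    have h₄ : ∀ p' : ProverWire E n l P.aux → Bool, inputBits F h r ρ ω j false c (Sum.elim p' (recordOf y true (x y true))) =
        Function.update (storedBits h r ρ ω' y p') j c := by
      intro p'
      rw [inputBits_eq r ρ hF hd, if_neg Bool.false_ne_true, Bool.xor_false]
    simp only [h₄]
    refine mul_le_mul_of_nonneg_left (le_trans ?_ (h₃ true p)) (by positivity)
    by_cases hp : (fun q => p (.preimage j q)) = x y false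
    · rw [if_pos hp, if_pos]
      rw [hp, hxy, hJ]
      rfl
    · rw [if_neg hp]
      split_ifs <;> norm_num

/-- The size of the attacker which applies a reflection. -/
def reflectAttackerSize (P : ProverAt E n l) (A : QAlg (Fin n) Unit) (s s' : ℕ) : ℕ :=
  P.attackerSize A.anc
    (n + P.test.length + P.had.length + (inputSize E n l s + (A.circ.length +
      (1 + A.circ.length) + (inputSize E n l s + (n + P.test.length + P.had.length)))))
    (reflectGuessSize E l s')

/-- Each attacker has one fixed `d`, and the uniform average over `d` is taken over the attackers.
It is bounded because every one of them is. -/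
theorem abs_expect_crossTerm_le {s s' : ℕ} (hFs : ∀ a, Comp s (F a))
    (hF : ∀ h (ω : Coins E l) u y b d, Decodable h ω y →
      F (h, ω, u) (Sum.elim y (Sum.elim b d)) () = (decode h ω y (b ()) d).getD u)
    (hP : acceptProb E P.testBehaviour h = 1) (hj : h j = true)
    {J : (D.encX.W l → Bool) → Bits (E.F.w l)} (hJs : Comp s' J)
    (hJ : ∀ x, J (D.encX.enc l x) = E.F.J l x) {μ ν : ℝ}
    (hμ : ∀ A' : QAlg (D.encKey.W l) (E.F.GuessWire l),
      A'.anc + A'.circ.length ≤ reflectAttackerSize P A s s' → |E.F.advantage l A'| ≤ μ)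
    (hν : ∀ k ∈ E.F.K l, ∀ b x, ((E.F.G l k b x)ᶜ.ncard : ℝ) / 2 ^ E.F.w l ≤ ν)
    (ω : Fin n → Coins E l) (g : Bits (E.G.coins l)) (c : Bool) :
    |expect fun u => crossTerm P A h r ρ j c (Function.update ω j (u, g))| ≤
      Real.sqrt (μ + 2 * ν) := by
  refine Real.abs_le_sqrt ((expect_sq_le _).trans ?_)
  choose A' hA' hadv using fun d => P.exists_attacker j hj ω g
    (impl_reflectOp A (inputBits F h r ρ ω j false c) (P.twistOp r) (P.impl_twistOp r)
      (P.impl_twistOp_conjTranspose r) (comp_inputBits F h r ρ ω j false c hFs))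
    (comp_reflectGuess (P := P) (j := j) A.anc hJs d)
  refine (expect_mono fun u => sq_crossTerm_le_sum r ρ hF hP hj hJ hν ω g u c).trans ?_
  rw [expect_add, expect_const]
  refine add_le_add_left ?_ _
  have h₁ : (expect fun d => E.F.advantage l (A' d)) ≤ μ :=
    (le_abs_self _).trans (abs_expect_le fun d => hμ _ (hA' d))
  refine le_trans (le_of_eq ?_) h₁
  -- The averages over `d` and over the challenge coins are exchanged.
  rw [show (fun d => E.F.advantage l (A' d)) = _ from funext hadv, expect_comm]
  refine congrArg expect (funext fun u => ?_)
  rw [expect_sum]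
  refine Finset.sum_congr rfl fun v _ => ?_
  rw [expect_const_mul]

end Terms

/-! ### The distinguishing probability -/

section Step
variable {D : Domains} {E : ExtendedTCF D} {n l : ℕ} (P : ProverAt E n l) (A : QAlg (Fin n) Unit)
  (h r ρ : Fin n → Bool) (j : Fin n)

/-- The probability that the distinguisher returns `0`, for fixed coins. -/
def valueAt (ω : Fin n → Coins E l) : ℝ :=
  ∑ y, ∑ v, ‖(P.twistOp r *ᵥ P.testState (keysOf h ω) y) v‖ ^ 2 *
    storedAvg (decode (h j) (ω j) (y j) (xor (v (.committed j)) (r j)) fun q => v (.extra j q))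
      (verdict A h r ρ j ω y v)

theorem sum_twisted_eq :
    ∑ m, resultDist (P.twisted r) h m * A.prob m (fun _ => false) =
      expect fun ω => expect fun ρ => valueAt P A h r ρ j ω := by
  simp only [ProverAt.resultDist_twisted, ← expect_mul_const]
  rw [← expect_sum]
  refine congrArg expect (funext fun ω => ?_)
  simp only [Finset.sum_mul]
  rw [Finset.sum_comm]
  simp only [valueAt, expect_sum]
  refine Finset.sum_congr rfl fun y _ => ?_
  rw [Finset.sum_comm]
  refine Finset.sum_congr rfl fun v _ => ?_
  rw [expect_const_mul, P.twistOp_mulVec]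
  simp only [mul_assoc]
  rw [← Finset.mul_sum, sum_storedProb_update _ (fun m => A.prob m fun _ => false) j]
  rfl

/-- For a claw-free key the answer bit is only added to the result, and whether decoding fails does
not depend on it. -/
theorem decode_not {ω : Coins E l} (y : D.encY.W l → Bool) (b : Bool) (d : Bits (E.F.w l)) :
    decode true ω y (!b) d = (decode true ω y b d).map not := by
  unfold decode
  cases D.encY.dec l y with
  | none => rfl
  | some y =>
    simp only [if_true]
    cases E.F.inv l (E.F.gen l ω.1).2 false y with
    | none => rfl
    | some x₀ =>
      cases E.F.inv l (E.F.gen l ω.1).2 true y with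
      | none => rfl
      | some x₁ =>
        simp only
        split_ifs
        · simp
        · rfl

theorem decode_false (ω : Coins E l) (y : D.encY.W l → Bool) (b b' : Bool) (d : Bits (E.F.w l)) :
    decode false ω y b d = decode false ω y b' d := by
  simp [decode]

theorem verdict_update (c : Bool) (ω : Fin n → Coins E l) (y : Fin n → D.encY.W l → Bool)
    (v : ProverWire E n l P.aux → Bool) :
    verdict A h (Function.update r j c) ρ j ω y v = verdict A h r ρ j ω y v := by
  funext c'
  refine congrArg (fun m => A.prob m fun _ => false) (funext fun i => ?_)
  by_cases hi : i = j
  · subst hi; simp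
  · simp [hi, storedBits]

theorem norm_sq_add_mul_sub (a b : ℂ) (s t : ℝ) :
    ‖a + b‖ ^ 2 * s - ‖a - b‖ ^ 2 * t =
      (‖a‖ ^ 2 + ‖b‖ ^ 2) * (s - t) + 2 * (star a * b).re * (s + t) := by
  simp only [← Complex.normSq_eq_norm_sq, Complex.normSq_apply, Complex.add_re, Complex.add_im,
    Complex.sub_re, Complex.sub_im, Complex.star_def, Complex.mul_re, Complex.conj_re,
    Complex.conj_im]
  ring

variable {h j}

/-- The twists lead to the sum and to the difference of the two branches, with opposite results in
coordinate `j`. In the difference of the squares, the squared norms meet the difference of the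
verdicts for the result and its negation, and the interference meets their sum, which is the sum
over both bits. -/
theorem valueAt_sub_valueAt (hj : h j = true) (hr : r j = false) (ω : Fin n → Coins E l) :
    valueAt P A h r ρ j ω - valueAt P A h (Function.update r j true) ρ j ω =
      diagTerm P A h r ρ j ω + (crossTerm P A h r ρ j false ω + crossTerm P A h r ρ j true ω) := by
  unfold valueAt diagTerm crossTerm
  rw [← Finset.sum_sub_distrib, ← Finset.sum_add_distrib, ← Finset.sum_add_distrib]
  refine Finset.sum_congr rfl fun y _ => ?_
  have h₁ : P.twistOp r *ᵥ P.testState (keysOf h ω) y =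
      branch P h r j ω y false + branch P h r j ω y true := by
    rw [branch, branch, ← mulVec_add, restrict_add_restrict]
  have h₂ : P.twistOp (Function.update r j true) *ᵥ P.testState (keysOf h ω) y =
      branch P h r j ω y false - branch P h r j ω y true := by
    rw [branch, branch, ← mulVec_sub, P.twistOp_mulVec, phase_update r j hr, P.twistOp_mulVec]
  -- The branches have disjoint supports before a unitary attack, so their overlap is zero.
  -- Subtracting it replaces each weight 2p by the bias 2p - 1, which the reflection can realise.
  have h₃ : ∑ v, (star (branch P h r j ω y false v) * branch P h r j ω y true v).re = 0 := by
    rw [← Complex.re_sum]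
    change (ip _ _).re = 0
    rw [branch, branch, (P.isUnitary_twistOp r).ip_mulVec, ip_restrict, Complex.zero_re]
  rw [h₁, h₂, Fintype.sum_bool, ← Finset.sum_add_distrib, ip, ip, Complex.re_sum, Complex.re_sum,
    ← Finset.sum_sub_distrib, ← Finset.sum_add_distrib, ← Finset.sum_add_distrib,
    ← sub_zero (∑ v, _), ← mul_zero 2, ← h₃, Finset.mul_sum,
    ← Finset.sum_sub_distrib]
  refine Finset.sum_congr rfl fun v _ => ?_
  have h₄ : ∀ a b : ℂ, ∀ s : ℝ, (star a * (b * (s : ℂ))).re = (star a * b).re * s := by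
    intro a b s
    rw [← mul_assoc, Complex.re_mul_ofReal]
  have h₅ := storedAvg_add_not (resultAt j ω y v) (verdict A h r ρ j ω y v)
  have h₆ : (decode (h j) (ω j) (y j) (xor (v (.committed j)) (Function.update r j true j))
      fun q => v (.extra j q)) = (resultAt j ω y v).map not := by
    rw [hj, Function.update_self, Bool.xor_true, decode_not]
    rfl
  have h₇ : (decode (h j) (ω j) (y j) (xor (v (.committed j)) (r j))
      fun q => v (.extra j q)) = resultAt j ω y v := by
    rw [hj, hr, Bool.xor_false]
    rfl
  rw [h₄, h₄, h₆, h₇, verdict_update, Pi.add_apply, Pi.sub_apply, norm_sq_add_mul_sub, h₅]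
  ring

/-- An injective key makes the j-th committed bit a function of `y`, so the additional Z is a global
sign for each `y`; the result does not depend on the answer bit, so its flip has no effect either.
-/
theorem valueAt_update_of_false (hP : acceptProb E P.testBehaviour h = 1) (hj : h j = false)
    (hr : r j = false) (ω : Fin n → Coins E l) :
    valueAt P A h (Function.update r j true) ρ j ω = valueAt P A h r ρ j ω := by
  unfold valueAt
  refine Finset.sum_congr rfl fun y _ => ?_
  have h₁ : ∃ b, ∀ p, P.testState (keysOf h ω) y p ≠ 0 → p (.committed j) = b := by
    by_cases hy : ∃ p, P.testState (keysOf h ω) y p ≠ 0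
    · obtain ⟨p, hp⟩ := hy
      refine ⟨p (.committed j), fun p' hp' => ?_⟩
      have hc := ProverAt.testCheck_of_accept hP ω y p hp j
      have hc' := ProverAt.testCheck_of_accept hP ω y p' hp' j
      rw [hj] at hc hc'
      obtain ⟨x, hx⟩ := exists_imageAt hc
      obtain ⟨x', hx'⟩ := exists_imageAt hc'
      have e₁ := hx.decode false fun _ => false
      have e₂ := hx'.decode false fun _ => false
      exact Option.some.inj (e₂.symm.trans e₁)
    · exact ⟨false, fun p hp => absurd ⟨p, hp⟩ hy⟩
  obtain ⟨b, hb⟩ := h₁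
  have h₂ : phase (Function.update r j true) (P.testState (keysOf h ω) y) =
      (if b then (-1 : ℂ) else 1) • phase r (P.testState (keysOf h ω) y) := by
    funext p
    rw [Pi.smul_apply, smul_eq_mul, phase, phase, chi_update r _ j hr]
    by_cases hp : P.testState (keysOf h ω) y p = 0
    · rw [hp]; simp
    · rw [hb p hp]; ring
  refine Finset.sum_congr rfl fun v _ => ?_
  rw [verdict_update, hj, decode_false (b' := xor (v (.committed j)) (r j)), P.twistOp_mulVec,
    P.twistOp_mulVec, h₂, mulVec_smul, Pi.smul_apply, norm_smul]
  congr 2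
  cases b <;> simp

end Step

/-! ### The hybrid argument -/

section Hybrid
variable {D : Domains} {E : ExtendedTCF D} {n l : ℕ} {P : ProverAt E n l} {A : QAlg (Fin n) Unit}
  {F : (Bool × Coins E l × Bool) → (D.encY.W l ⊕ (Unit ⊕ Fin (E.F.w l)) → Bool) → Unit → Bool}
  {h : Fin n → Bool}

theorem abs_expect_valueAt_sub_le (r ρ : Fin n → Bool) {j : Fin n} {μ ν : ℝ}
    (hj : h j = true) (hr : r j = false)
    (hμ : ∀ (ω : Fin n → Coins E l) (g : Bits (E.G.coins l)),
      |expect fun u => diagTerm P A h r ρ j (Function.update ω j (u, g))| ≤ μ)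
    (hν : ∀ (ω : Fin n → Coins E l) (g : Bits (E.G.coins l)) (c : Bool),
      |expect fun u => crossTerm P A h r ρ j c (Function.update ω j (u, g))| ≤ ν) :
    |expect fun ω => valueAt P A h r ρ j ω - valueAt P A h (Function.update r j true) ρ j ω| ≤
      μ + (ν + ν) := by
  simp only [valueAt_sub_valueAt P A r ρ hj hr]
  rw [expect_resample j]
  refine abs_expect_le fun ω => ?_
  rw [expect_prod]
  refine abs_expect_le fun g => ?_
  rw [expect_add, expect_add]
  exact (abs_add_le _ _).trans (add_le_add (hμ ω g) ((abs_add_le _ _).trans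
    (add_le_add (hν ω g false) (hν ω g true))))

/-- The ones of `r` are switched on one at a time, so every twist is within nε of the trivial twist,
and hence so is their average. -/
theorem abs_sum_sub_sum_averaged_le {ε : ℝ} (hε : 0 ≤ ε)
    (hstep : ∀ (r : Fin n → Bool) j, r j = false →
      |∑ m, resultDist (P.twisted r) h m * A.prob m (fun _ => false) -
        ∑ m, resultDist (P.twisted (Function.update r j true)) h m * A.prob m (fun _ => false)| ≤
          ε) :
    |∑ m, resultDist P.hadamardBehaviour h m * A.prob m (fun _ => false) -
      ∑ m, resultDist P.averaged h m * A.prob m (fun _ => false)| ≤ n * ε := by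
  have key : ∀ S : Finset (Fin n),
      |∑ m, resultDist (P.twisted fun _ => false) h m * A.prob m (fun _ => false) -
        ∑ m, resultDist (P.twisted fun i => decide (i ∈ S)) h m * A.prob m (fun _ => false)| ≤
          S.card * ε := by
    intro S
    induction S using Finset.induction_on with
    | empty => simp
    | insert j S hj ih =>
      have h₁ : (fun i => decide (i ∈ insert j S)) =
          Function.update (fun i => decide (i ∈ S)) j true := by
        funext i
        by_cases hi : i = j
        · subst hi; simp
        · simp [hi]
      have h₂ := hstep (fun i => decide (i ∈ S)) j (by simpa using hj)
      rw [← h₁] at h₂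
      rw [Finset.card_insert_of_notMem hj]
      push_cast
      rw [add_mul, one_mul]
      exact (abs_sub_le _ _ _).trans (add_le_add ih h₂)
  have h₁ : ∀ r : Fin n → Bool,
      |∑ m, resultDist (P.twisted fun _ => false) h m * A.prob m (fun _ => false) -
        ∑ m, resultDist (P.twisted r) h m * A.prob m (fun _ => false)| ≤ n * ε := by
    intro r
    have h₂ := key (Finset.univ.filter fun i => r i = true)
    simp only [Finset.mem_filter, Finset.mem_univ, true_and, Bool.decide_eq_true] at h₂
    refine h₂.trans (mul_le_mul_of_nonneg_right ?_ hε)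
    exact_mod_cast (Finset.card_le_univ _).trans_eq (Fintype.card_fin n)
  rw [← P.twisted_zero]
  simp only [ProverAt.resultDist_averaged, ← expect_mul_const]
  rw [← expect_sum, ← expect_const (Ω := Fin n → Bool)
    (∑ m, resultDist (P.twisted fun _ => false) h m * A.prob m fun _ => false), ← expect_sub]
  exact abs_expect_le h₁

theorem abs_sum_sub_sum_le {s s' : ℕ} (hFs : ∀ a, Comp s (F a))
    (hF : ∀ h (ω : Coins E l) u y b d, Decodable h ω y →
      F (h, ω, u) (Sum.elim y (Sum.elim b d)) () = (decode h ω y (b ()) d).getD u)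
    (hP : acceptProb E P.testBehaviour h = 1)
    {J : (D.encX.W l → Bool) → Bits (E.F.w l)} (hJs : Comp s' J)
    (hJ : ∀ x, J (D.encX.enc l x) = E.F.J l x) {μ ν : ℝ} (hμ₀ : 0 ≤ μ)
    (hμ : ∀ A' : QAlg (D.encKey.W l) (E.F.GuessWire l),
      A'.anc + A'.circ.length ≤ runAttackerSize P A s + reflectAttackerSize P A s s' →
        |E.F.advantage l A'| ≤ μ)
    (hν : ∀ k ∈ E.F.K l, ∀ b x, ((E.F.G l k b x)ᶜ.ncard : ℝ) / 2 ^ E.F.w l ≤ ν) :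
    |∑ m, resultDist P.hadamardBehaviour h m * A.prob m (fun _ => false) -
      ∑ m, resultDist P.averaged h m * A.prob m (fun _ => false)| ≤
        n * (μ + (Real.sqrt (μ + 2 * ν) + Real.sqrt (μ + 2 * ν))) := by
  refine abs_sum_sub_sum_averaged_le (by positivity) fun r j hr => ?_
  rw [sum_twisted_eq P A h r j, sum_twisted_eq P A h _ j, ← expect_sub]
  simp only [← expect_sub]
  rw [expect_comm]
  refine abs_expect_le fun ρ => ?_
  -- With an injective key the step changes nothing; with a claw-free key it costs one diagonal and
  -- two cross terms.
  cases hj : h j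
  · simp only [valueAt_update_of_false P A r ρ hP hj hr, sub_self]
    rw [expect_const, abs_zero]
    positivity
  · exact abs_expect_valueAt_sub_le r ρ hj hr
      (abs_expect_diagTerm_le r ρ hFs hF hP hj fun A' h' => hμ A' (h'.trans le_self_add))
      (abs_expect_crossTerm_le r ρ hFs hF hP hj hJs hJ
        (fun A' h' => hμ A' (h'.trans le_add_self)) hν)

end Hybrid

/-! ### Polynomial bounds for the sizes of the attackers -/

section Sizes
variable {D : Domains} {E : ExtendedTCF D} {n : ℕ → ℕ} (P : Prover E n)

theorem PolyBounded.inputSize (E : ExtendedTCF D) (hn : PolyBounded n) {s : ℕ → ℕ}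
    (hs : PolyBounded s) : PolyBounded fun l => MeasurementProtocol.inputSize E (n l) l (s l) := by
  have hY := D.encY.poly
  have hw := E.F.w_poly
  exact hn.mul (((((hY.add ((PolyBounded.const 2).add hw)).add hs).add
    (hY.add ((PolyBounded.const 2).add hw))).add (hY.add ((PolyBounded.const 1).add hw))).add
      (.const 2))

theorem PolyBounded.attackerSize (hn : PolyBounded n) {a s s' : ℕ → ℕ} (ha : PolyBounded a)
    (hs : PolyBounded s) (hs' : PolyBounded s') :
    PolyBounded fun l => (P.at_ l).attackerSize (a l) (s l) (s' l) := by
  have hX := D.encX.poly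
  have hY := D.encY.poly
  have hK := D.encKey.poly
  have hw := E.F.w_poly
  have hW : PolyBounded fun l => Fintype.card ((P.at_ l).AttackerWire (a l)) := by
    have : PolyBounded fun l => (n l + n l * Fintype.card (D.encX.W l) + n l * E.F.w l +
      n l * Fintype.card (D.encY.W l) + n l * Fintype.card (D.encKey.W l) + (P.at_ l).aux) +
        ((n l * Fintype.card (D.encY.W l) + (1 + Fintype.card (D.encX.W l))) +
          (n l + (1 + a l))) :=
      ((((((hn.add (hn.mul hX)).add (hn.mul hw)).add (hn.mul hY)).add (hn.mul hK)).add
        P.poly_aux)).add (((hn.mul hY).add ((PolyBounded.const 1).add hX)).add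
          (hn.add ((PolyBounded.const 1).add ha)))
    refine this.mono fun l => le_of_eq ?_
    rw [Fintype.card_sum, Fintype.card_sum, Fintype.card_sum, Fintype.card_sum, Fintype.card_sum,
      Fintype.card_sum, ProverAt.card_proverWire, Fintype.card_prod, Fintype.card_fin,
      Fintype.card_fin, Fintype.card_unit]
  exact ((PolyBounded.const 2).mul (((hs.add (((PolyBounded.const 1).add hX).add
    (P.poly_test.add ((hn.mul hY).add (P.poly_commit.add (hn.mul hK)))))).add hs').add hK)).add hW

theorem PolyBounded.runAttackerSize (hn : PolyBounded n)
    (A : QPT (fun l => Fin (n l)) fun _ => Unit) {s : ℕ → ℕ} (hs : PolyBounded s) :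
    PolyBounded fun l => MeasurementProtocol.runAttackerSize (P.at_ l) (A.alg l) (s l) := by
  have hw : PolyBounded fun l => Fintype.card (Fin (E.F.w l)) := E.F.w_poly.mono fun l => by simp
  exact PolyBounded.attackerSize P hn (A.poly.mono fun l => Nat.le_add_right _ _)
    ((A.poly.mono fun l => Nat.le_add_left _ _).add
      ((hn.inputSize E hs).add ((hn.add P.poly_test).add P.poly_had)))
    ((PolyBounded.const 1).add (D.encX.poly.add (hw.add (.const 2))))

theorem PolyBounded.reflectAttackerSize (hn : PolyBounded n)
    (A : QPT (fun l => Fin (n l)) fun _ => Unit) {s s' : ℕ → ℕ} (hs : PolyBounded s)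
    (hs' : PolyBounded s') :
    PolyBounded fun l =>
      MeasurementProtocol.reflectAttackerSize (P.at_ l) (A.alg l) (s l) (s' l) := by
  have hw : PolyBounded fun l => Fintype.card (Fin (E.F.w l)) := E.F.w_poly.mono fun l => by simp
  have hX := D.encX.poly
  have hN := (hn.add P.poly_test).add P.poly_had
  have hA : PolyBounded fun l => (A.alg l).circ.length := A.poly.mono fun l => Nat.le_add_left _ _
  have hI := hn.inputSize E hs
  have hJ := ((hX.add hs').add hX).add hX
  exact PolyBounded.attackerSize P hn (A.poly.mono fun l => Nat.le_add_right _ _)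
    (hN.add (hI.add ((hA.add ((PolyBounded.const 1).add hA)).add (hI.add hN))))
    ((PolyBounded.const 1).add (hX.add (hw.add
      (((PolyBounded.const 2).mul (hw.add (hJ.add hJ))).add
        ((PolyBounded.const 9).mul E.F.w_poly)))))

end Sizes

/-- The attackers vary with the coordinate, the twist and all fixed coins, but their sizes have a
common polynomial bound. A single negligible function from `hardcore_uniform` therefore covers all
hybrids. -/
theorem Prover.compIndist_average {D : Domains} {E : ExtendedTCF D} {n : ℕ → ℕ}
    (hn : PolyBounded n) {P : Prover E n} (hP : P.IsPerfect) (h : ∀ l, Fin (n l) → Bool) :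
    CompIndist (fun l => P.dist l (h l)) fun l => (P.average hn).dist l (h l) := by
  intro A
  obtain ⟨F, ⟨s, hs, hFs⟩, hF⟩ := exists_comp_decode E
  obtain ⟨s', hs', J, hJ⟩ := E.F.J_eff.exists_comp (E.F.w_poly.mono fun l => by simp)
  obtain ⟨ν, hν, hG⟩ := E.F.G_large
  obtain ⟨μ, hμ, hA⟩ := E.F.hardcore_uniform ((PolyBounded.runAttackerSize P hn A hs).add
    (PolyBounded.reflectAttackerSize P hn A hs hs'))
  -- Absolute values make the bounds nonnegative without examining the given negligible functions.
  have hμ' : Negligible fun l => |μ l| := hμ.mono fun l => (abs_abs _).le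
  have hν' : Negligible fun l => |ν l| := hν.mono fun l => (abs_abs _).le
  have hsq := (hμ'.add (hν'.const_mul 2)).sqrt
  refine ⟨_, (hμ'.add (hsq.add hsq)).poly_mul hn, fun l => ?_⟩
  have h₁ := abs_sum_sub_sum_le (A := A.alg l) (hFs l) (hF l) (hP l (h l)) (hJ l).1 (hJ l).2
    (abs_nonneg (μ l)) (fun A' h' => (hA l A' h').trans (le_abs_self _))
    fun k hk b x => (hG l k hk b x).trans (le_abs_self (ν l))
  rw [← ProverAt.average_hadamardBehaviour] at h₁
  exact h₁

end MeasurementProtocol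

end

theorem mainTheorem5 (D : MeasurementProtocol.Domains) (E : MeasurementProtocol.ExtendedTCF D)
    (n : ℕ → ℕ) (hn : MeasurementProtocol.PolyBounded n)
    (P : MeasurementProtocol.Prover E n) (hP : P.IsPerfect) :
    ∃ Phat : MeasurementProtocol.Prover E n, Phat.IsTrivial ∧
      ∀ h : ∀ l, Fin (n l) → Bool,
        MeasurementProtocol.CompIndist (fun l => P.dist l (h l)) (fun l => Phat.dist l (h l)) := by
  exact ⟨P.average hn, MeasurementProtocol.Prover.average_isTrivial hn hP,
    MeasurementProtocol.Prover.compIndist_average hn hP⟩
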